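/- Let $m\ge 2$, $n\ge 1$, let $q=(q_0,\dots,q_{m-1})\in(\mathbb C^\times)^m$, and put $t_s=q_0q_1\cdots q_s$, $t=t_{m-1}$. Assume that $q$ is regular: $t$ is not a root of unity, and $\prod_{i\le l\le j}q_l\ne t^k$ for all $1\le i\le j\le m-1$ and $k\in\mathbb Z$. Indices of $X_i,Y_i$ are taken modulo $m$. *Tadpole space.* $\mathcal C^0_{n,t}$ is the space of $\mathrm{GL}_n$-orbits, for $g\cdot(X,Y,V,W)=(gXg^{-1},gYg^{-1},gV,Wg^{-1})$, of quadruples $X,Y\in\mathrm{Mat}_{n\times n}(\mathbb C)$, $V\in\mathrm{Mat}_{n\times1}(\mathbb C)$, $W\in\mathrm{Mat}_{1\times n}(\mathbb C)$ such that $X$, $1+XY$, $1+YX$, $1+VW$, $1+WV$ are invertible and $$(1+XY)(1+YX)^{-1}(1+VW)=t\,\mathrm{Id}_n,\qquad (1+WV)^{-1}=t^{-n}.$$ Put $A=X$, $B=Y+X^{-1}$. *Cyclic space.* $\mathcal C^0_{n,q}(m)$ is the space of $\mathrm{GL}_n^m$-orbits, for $X_i\mapsto g_iX_ig_{i+1}^{-1}$,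 $Y_i\mapsto g_{i+1}Y_ig_i^{-1}$, $V\mapsto g_0V$, $W\mapsto Wg_0^{-1}$, of data $X_i,Y_i\in\mathrm{Mat}_{n\times n}(\mathbb C)$ $(i\in\mathbb Z/m)$, $V\in\mathrm{Mat}_{n\times 1}(\mathbb C)$, $W\in\mathrm{Mat}_{1\times n}(\mathbb C)$ with all $X_i$, $1+X_iY_i$, $1+Y_iX_i$, $1+VW$, $1+WV$ invertible and $$(1+Y_{i-1}X_{i-1})^{-1}(1+X_iY_i)=q_i\,\mathrm{Id}_n\ (i\neq0),\qquad (1+Y_{m-1}X_{m-1})^{-1}(1+X_0Y_0)(1+VW)=q_0\,\mathrm{Id}_n,\qquad (1+WV)^{-1}=t^{-n}.$$ Put $Z_i=Y_i+X_i^{-1}$. *Poisson brackets.* For a function $F$ of the matrix entries and a matrix variable $M$, let $\partial_MF$ be the matrix with entries $(\partial_MF)_{ij}=\partial F/\partial M_{ji}$. On tadpole data put $\mathsf F_x(F)=\partial_YF\,Y-X\,\partial_XF$, $\mathsf F_y(F)=\partial_XF\,X-Y\,\partial_YF$, $\mathsf F_v(F)=\partial_WF\,W-V\,\partial_VF$ and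 $$\begin{aligned}\langle F,G\rangle=\operatorname{tr}\big[&(1+YX)\partial_XF\,\partial_YG-(1+XY)\partial_YF\,\partial_XG-\mathsf F_x(F)\mathsf F_y(G)-\mathsf F_x(F)\mathsf F_v(G)-\mathsf F_y(F)\mathsf F_v(G)\\&-(1+VW)\partial_WF\,\partial_VG\big]+\operatorname{tr}\big[(1+WV)\partial_VF\,\partial_WG\big].\end{aligned}$$ On cyclic data define likewise $\mathsf F_{x_i}(F)=\partial_{Y_i}F\,Y_i-X_i\,\partial_{X_i}F$, $\mathsf F_{y_i}(F)=\partial_{X_i}F\,X_i-Y_i\,\partial_{Y_i}F$, $\mathsf F_v$ as before, and $$\begin{aligned}\langle F,G\rangle=&\sum_{i\in\mathbb Z/m}\operatorname{tr}\big[(1+Y_iX_i)\partial_{X_i}F\,\partial_{Y_i}G-(1+X_iY_i)\partial_{Y_i}F\,\partial_{X_i}G-\mathsf F_{y_{i-1}}(F)\mathsf F_{x_i}(G)\big]\\&+\operatorname{tr}\big[(1+WV)\partial_VF\,\partial_WG\big]-\operatorname{tr}\big[(1+VW)\partial_WF\,\partial_VG+\mathsf F_{y_{m-1}}(F)\mathsf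 F_v(G)+\mathsf F_{x_0}(F)\mathsf F_v(G)\big].\end{aligned}$$ In both cases the quasi-Poisson bracket is $\{F,G\}=\tfrac12(\langle F,G\rangle-\langle G,F\rangle)$ (Van den Bergh's bracket for the double of the quiver, with arrows at the vertex $0$ ordered $x<y<v$, respectively $y_{i-1}<x_i$ at each vertex $i$ and $y_{m-1}<x_0<v$ at $0$). The Poisson bracket $\{f,g\}$ of (local holomorphic or regular) functions on the orbit space is $\{F,G\}$ restricted to the data satisfying the relations, where $F,G$ are any local holomorphic functions of the matrix entries whose restrictions to these data are the pull-backs of $f,g$. A regular function on an orbit space is one whose pull-back to the data is a polynomial in the entries of the matrices and of the inverses of the matrices required above to be invertible. **Statement.** Let $\xi:\mathcal C^0_{n,t}\to\mathcal C^0_{n,q}(m)$ send the class of $(A,B,\widetilde V,\widetilde W)$ to the class of $$X_s=\mathrm{Id}_n,\ Z_s=t_sB\quad(0\le s\le m-2),\qquad X_{m-1}=A,\ Z_{m-1}=tA^{-1}B,\qquad V=A^{-1}B^{-1}\widetilde V,\ W=\widetilde W BA.$$ Then $\xi$ is an isomorphism (a bijection identifying the regular functions on the two spaces), and it is a Poisson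 map: for all functions $f,g$ on $\mathcal C^0_{n,q}(m)$, regular or holomorphic near a point, the brackets below are well defined and $$\xi^*\{f,g\}=\{\xi^*f,\xi^*g\}.$$ Consequently, for $x,\sigma\in(\mathbb C^\times)^n$ with $x_i\neq x_j$, $x_i\ne t x_j$ for $i\neq j$, let $$A=\operatorname{diag}(x_1,\dots,x_n),\qquad B_{ij}=\sigma_j\,\frac{t-1}{t-x_ix_j^{-1}}\prod_{k\neq j}\frac{1-tx_jx_k^{-1}}{1-x_jx_k^{-1}}.$$ There are $\widetilde V,\widetilde W$, unique up to $(\widetilde V,\widetilde W)\mapsto(c\widetilde V,c^{-1}\widetilde W)$, $c\in\mathbb C^\times$, such that $(A,B,\widetilde V,\widetilde W)$ defines a point of $\mathcal C^0_{n,t}$. Mapping it to $\mathcal C^0_{n,q}(m)$ by $\xi$ gives a locally biholomorphic parametrisation, so that $(x_i,\sigma_i)$ are holomorphic local coordinates on $\mathcal C^0_{n,q}(m)$, and these satisfy $$\{x_i,x_j\}=0,\qquad\{x_i,\sigma_j\}=\delta_{ij}x_i\sigma_j,\qquad\{\sigma_i,\sigma_j\}=0.$$ -/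

import Mathlib

open scoped Topology Matrix

attribute [local instance] Matrix.normedAddCommGroup Matrix.normedSpace

namespace CalogeroMoser

noncomputable section

/-! ### Complex geometry of an orbit space of linear data

`E` is an affine space of matrix data, `L ⊆ E` the locus cut out by the defining relations, and
`s` the equivalence (isomorphism of the data) whose classes are the points of the moduli space. -/

section Quotients

variable {E : Type*} [NormedAddCommGroup E] [NormedSpace ℂ E] {L : Set E} {s : Setoid L}

/-- `F`, analytic near `p` in the ambient space, restricts on `L` near `p` to the pull-back of the
function `f` on the quotient. No invariance of `F` away from `L` is required. -/
def IsLiftAt (f : Quotient s → ℂ) (p : L) (F : E → ℂ) : Prop :=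
  AnalyticAt ℂ F (p : E) ∧ ∀ᶠ p' : L in 𝓝 p, F (p' : E) = f (Quotient.mk s p')

/-- `f` is a holomorphic function on the quotient near the point `c`. -/
def HolomorphicAt (f : Quotient s → ℂ) (c : Quotient s) : Prop :=
  ∃ p : L, Quotient.mk s p = c ∧ ∃ F : E → ℂ, IsLiftAt f p F

/-- `{f, g}(c) = b` for the bracket on the quotient induced by a bivector `P` on the ambient
space: `f` and `g` are holomorphic near `c`, and `P(dF, dG)` takes the value `b` for
all local lifts `F`, `G` of `f`, `g` at all points of `L` over `c`. -/
def HasBracketAt (P : E → (E →L[ℂ] ℂ) → (E →L[ℂ] ℂ) → ℂ) (f g : Quotient s → ℂ)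
    (c : Quotient s) (b : ℂ) : Prop :=
  HolomorphicAt f c ∧ HolomorphicAt g c ∧
    ∀ p : L, Quotient.mk s p = c → ∀ F G : E → ℂ, IsLiftAt f p F → IsLiftAt g p G →
      P (p : E) (fderiv ℂ F (p : E)) (fderiv ℂ G (p : E)) = b

/-- `f` is a regular function on the quotient: its pull-back to `L` belongs to the
coordinate ring `R` of `L`. -/
def IsRegularFunction (R : Subalgebra ℂ (L → ℂ)) (f : Quotient s → ℂ) : Prop :=
  (fun p : L => f (Quotient.mk s p)) ∈ R

/-- A map of quotients is Poisson at the level of germs of holomorphic functions: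
`{f, g} ∘ φ = {f ∘ φ, g ∘ φ}`. Both brackets are required to be well defined. -/
def IsPoissonMap {E' : Type*} [NormedAddCommGroup E'] [NormedSpace ℂ E'] {L' : Set E'}
    {s' : Setoid L'} (P : E → (E →L[ℂ] ℂ) → (E →L[ℂ] ℂ) → ℂ)
    (P' : E' → (E' →L[ℂ] ℂ) → (E' →L[ℂ] ℂ) → ℂ) (φ : Quotient s → Quotient s') : Prop :=
  ∀ (c : Quotient s) (f g : Quotient s' → ℂ),
    HolomorphicAt f (φ c) → HolomorphicAt g (φ c) →
      ∃ b : ℂ, HasBracketAt P' f g (φ c) b ∧ HasBracketAt P (f ∘ φ) (g ∘ φ) c b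

/-- Near `u` the map `ζ` is a holomorphic parametrisation of the quotient, and the components
`x₁, …, xₙ, σ₁, …, σₙ` of its local inverse are holomorphic local coordinates near `ζ u` with
`{xᵢ, xⱼ} = 0`, `{xᵢ, σⱼ} = δᵢⱼ xᵢ σⱼ`, `{σᵢ, σⱼ} = 0`. -/
def IsLogCanonicalChartAt {n : ℕ} (P : E → (E →L[ℂ] ℂ) → (E →L[ℂ] ℂ) → ℂ)
    (ζ : (Fin n → ℂ) × (Fin n → ℂ) → Quotient s) (u : (Fin n → ℂ) × (Fin n → ℂ)) : Prop :=
  (∀ f : Quotient s → ℂ, HolomorphicAt f (ζ u) → AnalyticAt ℂ (f ∘ ζ) u) ∧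
  ∃ x σ : Fin n → Quotient s → ℂ,
    (∀ᶠ u' in 𝓝 u, ∀ i, x i (ζ u') = u'.1 i ∧ σ i (ζ u') = u'.2 i) ∧
    ∀ᶠ c in 𝓝 (ζ u), ζ (fun i => x i c, fun i => σ i c) = c ∧
      ∀ i j, HasBracketAt P (x i) (x j) c 0 ∧
        HasBracketAt P (x i) (σ j) c (if i = j then x i c * σ j c else 0) ∧
        HasBracketAt P (σ i) (σ j) c 0

/-- The functions on `L` given by the entries of a matrix-valued function on `L`. -/
def entries {α β : Type*} (M : L → Matrix α β ℂ) : Set (L → ℂ) :=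
  {f | ∃ i j, f = fun p => M p i j}

end Quotients

/-! ### The tadpole quiver

Arrows `x : 0 → 0`, `v : 0 → ∞` and their opposites `y = x*`, `w = v*`, in dimension `(1, n)`. -/

/-- Quadruples `(X, Y, V, W)`: representations of the path algebra of the doubled quiver. -/
abbrev TadData (n : ℕ) : Type :=
  Matrix (Fin n) (Fin n) ℂ × Matrix (Fin n) (Fin n) ℂ ×
    Matrix (Fin n) (Fin 1) ℂ × Matrix (Fin 1) (Fin n) ℂ

namespace TadData

variable {n : ℕ}

abbrev X (p : TadData n) : Matrix (Fin n) (Fin n) ℂ := p.1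
abbrev Y (p : TadData n) : Matrix (Fin n) (Fin n) ℂ := p.2.1
abbrev V (p : TadData n) : Matrix (Fin n) (Fin 1) ℂ := p.2.2.1
abbrev W (p : TadData n) : Matrix (Fin 1) (Fin n) ℂ := p.2.2.2

/-- `Z = Y + X⁻¹`. -/
def Z (p : TadData n) : Matrix (Fin n) (Fin n) ℂ := p.Y + p.X⁻¹

end TadData

/-- The representations of the multiplicative preprojective algebra of the tadpole quiver, with
parameters `q₀ = t`, `q_∞ = t⁻ⁿ`, for which `X` is invertible. -/
def tadRep (n : ℕ) (t : ℂ) : Set (TadData n) :=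
  {p | IsUnit (1 + p.X * p.Y) ∧ IsUnit (1 + p.Y * p.X) ∧
    IsUnit (1 + p.V * p.W) ∧ IsUnit (1 + p.W * p.V) ∧
    (1 + p.X * p.Y) * (1 + p.Y * p.X)⁻¹ * (1 + p.V * p.W) = t • 1 ∧
    (1 + p.W * p.V)⁻¹ = (t ^ n)⁻¹ • 1 ∧
    IsUnit p.X}

/-- The action of `GLₙ` by change of basis. -/
def tadAct {n : ℕ} (g : GL (Fin n) ℂ) (p : TadData n) : TadData n :=
  (g.1 * p.X * g⁻¹.1, g.1 * p.Y * g⁻¹.1, g.1 * p.V, p.W * g⁻¹.1)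

theorem tadAct_one {n : ℕ} (p : TadData n) : tadAct 1 p = p := by
  simp [tadAct, TadData.X, TadData.Y, TadData.V, TadData.W]

theorem tadAct_mul {n : ℕ} (g h : GL (Fin n) ℂ) (p : TadData n) :
    tadAct (g * h) p = tadAct g (tadAct h p) := by
  simp [tadAct, TadData.X, TadData.Y, TadData.V, TadData.W, mul_inv_rev, Matrix.mul_assoc]

/-- Isomorphism of linear data. -/
def tadSetoid (n : ℕ) (t : ℂ) : Setoid (tadRep n t) where
  r p p' := ∃ g : GL (Fin n) ℂ, (p' : TadData n) = tadAct g p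
  iseqv :=
    { refl := fun p => ⟨1, (tadAct_one _).symm⟩
      symm := by
        rintro p p' ⟨g, hg⟩
        exact ⟨g⁻¹, by rw [hg, ← tadAct_mul, inv_mul_cancel, tadAct_one]⟩
      trans := by
        rintro p p' p'' ⟨g, hg⟩ ⟨h, hh⟩
        exact ⟨h * g, by rw [hh, hg, tadAct_mul]⟩ }

/-- The Calogero–Moser space `C⁰_{n,t}` of the tadpole quiver. -/
abbrev TadSpace (n : ℕ) (t : ℂ) : Type := Quotient (tadSetoid n t)

/-- The coordinate ring of `tadRep n t`, generated by the matrix entries of the generators of the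
localised path algebra. -/
def tadRing (n : ℕ) (t : ℂ) : Subalgebra ℂ (tadRep n t → ℂ) :=
  Algebra.adjoin ℂ
    (entries (fun p : tadRep n t => p.1.X) ∪ entries (fun p : tadRep n t => p.1.Y) ∪
      entries (fun p : tadRep n t => p.1.V) ∪ entries (fun p : tadRep n t => p.1.W) ∪
      entries (fun p : tadRep n t => p.1.X⁻¹) ∪
      entries (fun p : tadRep n t => (1 + p.1.X * p.1.Y)⁻¹) ∪
      entries (fun p : tadRep n t => (1 + p.1.Y * p.1.X)⁻¹) ∪
      entries (fun p : tadRep n t => (1 + p.1.V * p.1.W)⁻¹) ∪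
      entries (fun p : tadRep n t => (1 + p.1.W * p.1.V)⁻¹))

/-! For an arrow `a` and a covector `l`, the matrix `D_a l` with `(D_a l)ᵢⱼ = l (∂ / ∂(X_a)ⱼᵢ)` is
the value on `l` of the matrix-valued vector field induced by the double derivation `∂/∂a`. -/

section TadGradients

variable {n : ℕ} (l : TadData n →L[ℂ] ℂ)

def tadDx : Matrix (Fin n) (Fin n) ℂ := Matrix.of fun i j => l (Matrix.single j i 1, 0, 0, 0)
def tadDy : Matrix (Fin n) (Fin n) ℂ := Matrix.of fun i j => l (0, Matrix.single j i 1, 0, 0)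
def tadDv : Matrix (Fin 1) (Fin n) ℂ := Matrix.of fun i j => l (0, 0, Matrix.single j i 1, 0)
def tadDw : Matrix (Fin n) (Fin 1) ℂ := Matrix.of fun i j => l (0, 0, 0, Matrix.single j i 1)

variable (p : TadData n)

/-! `F_a = (∂/∂a*) a* - a (∂/∂a)` for the arrows `a = x, y, v` starting at the vertex `0`. -/

def tadFx : Matrix (Fin n) (Fin n) ℂ := tadDy l * p.Y - p.X * tadDx l
def tadFy : Matrix (Fin n) (Fin n) ℂ := tadDx l * p.X - p.Y * tadDy l
def tadFv : Matrix (Fin n) (Fin n) ℂ := tadDw l * p.W - p.V * tadDv l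

end TadGradients

/-- The sum of the terms `tr (δ₁(l₁) δ₂(l₂))` over the summands `δ₁ δ₂` of twice Van den Bergh's
bivector `½ ∑ₐ ε(a) (1 + a*a) (∂/∂a) (∂/∂a*) - ½ ∑_{a < b, t(a) = t(b)} F_a F_b`, for the
ordering `x < y < v` of the arrows starting at `0`. -/
def tadPre {n : ℕ} (p : TadData n) (l₁ l₂ : TadData n →L[ℂ] ℂ) : ℂ :=
  ((1 + p.Y * p.X) * tadDx l₁ * tadDy l₂).trace
    - ((1 + p.X * p.Y) * tadDy l₁ * tadDx l₂).trace
    + ((1 + p.W * p.V) * tadDv l₁ * tadDw l₂).trace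
    - ((1 + p.V * p.W) * tadDw l₁ * tadDv l₂).trace
    - (tadFx l₁ p * tadFy l₂ p).trace
    - (tadFx l₁ p * tadFv l₂ p).trace
    - (tadFy l₁ p * tadFv l₂ p).trace

/-- The quasi-Poisson bivector on the representation space of the doubled tadpole quiver. It gives
`{Xᵢⱼ, Xᵤᵥ} = ½ ((X²)ᵤⱼ δᵢᵥ - δᵤⱼ (X²)ᵢᵥ)`,
`{Xᵢⱼ, Yᵤᵥ} = δᵤⱼ δᵢᵥ + ½ ((YX)ᵤⱼ δᵢᵥ + δᵤⱼ (XY)ᵢᵥ + Yᵤⱼ Xᵢᵥ - Xᵤⱼ Yᵢᵥ)`, and so on. -/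
def tadBivector {n : ℕ} (p : TadData n) (l₁ l₂ : TadData n →L[ℂ] ℂ) : ℂ :=
  (tadPre p l₁ l₂ - tadPre p l₂ l₁) / 2

/-! ### The framed cyclic quiver with `m` vertices

Arrows `xᵢ : i → i + 1`, `i ∈ ℤ/m`, and `v : 0 → ∞` with opposites `yᵢ = xᵢ*`, `w = v*`, in
dimension `(1, n, …, n)`. The addition of `Fin m` is modulo `m`. -/

/-- Linear data `(X₀, …, X_{m-1}, Y₀, …, Y_{m-1}, V, W)`. -/
abbrev CycData (m n : ℕ) : Type :=
  (Fin m → Matrix (Fin n) (Fin n) ℂ) × (Fin m → Matrix (Fin n) (Fin n) ℂ) ×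
    Matrix (Fin n) (Fin 1) ℂ × Matrix (Fin 1) (Fin n) ℂ

namespace CycData

variable {m n : ℕ}

abbrev X (p : CycData m n) (i : Fin m) : Matrix (Fin n) (Fin n) ℂ := p.1 i
abbrev Y (p : CycData m n) (i : Fin m) : Matrix (Fin n) (Fin n) ℂ := p.2.1 i
abbrev V (p : CycData m n) : Matrix (Fin n) (Fin 1) ℂ := p.2.2.1
abbrev W (p : CycData m n) : Matrix (Fin 1) (Fin n) ℂ := p.2.2.2

end CycData

/-- The parameters are regular: `q^β ≠ 1` for the roots `β` of the cyclic quiver, which are, up to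
sign, the nonzero multiples of `δ = (1, …, 1)` and the sums of a multiple of `δ` and an interval
`[i, j]` not containing the vertex `0`. -/
def RegularParam {m : ℕ} [NeZero m] (q : Fin m → ℂ) : Prop :=
  (∀ i, q i ≠ 0) ∧
  (∀ k : ℕ, 0 < k → (∏ l, q l) ^ k ≠ 1) ∧
  ∀ i j : Fin m, i ≠ 0 → i ≤ j → ∀ k : ℤ, ∏ l ∈ Finset.Icc i j, q l ≠ (∏ l, q l) ^ k

/-- The representations of the multiplicative preprojective algebra of the framed cyclic quiver,
with parameters `q` and `q_∞ = t⁻ⁿ`, `t = ∏ qᵢ`, for which all `Xᵢ` are invertible. -/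
def cycRep (m n : ℕ) [NeZero m] (q : Fin m → ℂ) : Set (CycData m n) :=
  {p | (∀ i, IsUnit (1 + p.X i * p.Y i) ∧ IsUnit (1 + p.Y i * p.X i)) ∧
    IsUnit (1 + p.V * p.W) ∧ IsUnit (1 + p.W * p.V) ∧
    (∀ i, i ≠ 0 → (1 + p.Y (i - 1) * p.X (i - 1))⁻¹ * (1 + p.X i * p.Y i) = q i • 1) ∧
    (1 + p.Y (0 - 1) * p.X (0 - 1))⁻¹ * (1 + p.X 0 * p.Y 0) * (1 + p.V * p.W) = q 0 • 1 ∧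
    (1 + p.W * p.V)⁻¹ = ((∏ i, q i) ^ n)⁻¹ • 1 ∧
    ∀ i, IsUnit (p.X i)}

/-- The action of `GLₙ^m` by change of bases. -/
def cycAct {m n : ℕ} [NeZero m] (g : Fin m → GL (Fin n) ℂ) (p : CycData m n) : CycData m n :=
  (fun i => (g i).1 * p.X i * (g (i + 1))⁻¹.1, fun i => (g (i + 1)).1 * p.Y i * (g i)⁻¹.1,
    (g 0).1 * p.V, p.W * (g 0)⁻¹.1)

theorem cycAct_one {m n : ℕ} [NeZero m] (p : CycData m n) : cycAct 1 p = p := by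
  simp [cycAct, CycData.X, CycData.Y, CycData.V, CycData.W]

theorem cycAct_mul {m n : ℕ} [NeZero m] (g h : Fin m → GL (Fin n) ℂ) (p : CycData m n) :
    cycAct (g * h) p = cycAct g (cycAct h p) := by
  simp [cycAct, CycData.X, CycData.Y, CycData.V, CycData.W, mul_inv_rev, Matrix.mul_assoc]

/-- Isomorphism of linear data. -/
def cycSetoid (m n : ℕ) [NeZero m] (q : Fin m → ℂ) : Setoid (cycRep m n q) where
  r p p' := ∃ g : Fin m → GL (Fin n) ℂ, (p' : CycData m n) = cycAct g p
  iseqv :=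
    { refl := fun p => ⟨1, (cycAct_one _).symm⟩
      symm := by
        rintro p p' ⟨g, hg⟩
        exact ⟨g⁻¹, by rw [hg, ← cycAct_mul, inv_mul_cancel, cycAct_one]⟩
      trans := by
        rintro p p' p'' ⟨g, hg⟩ ⟨h, hh⟩
        exact ⟨h * g, by rw [hh, hg, cycAct_mul]⟩ }

/-- The Calogero–Moser space `C⁰_{n,q}(m)` of the cyclic quiver. -/
abbrev CycSpace (m n : ℕ) [NeZero m] (q : Fin m → ℂ) : Type := Quotient (cycSetoid m n q)

/-- The coordinate ring of `cycRep m n q`. -/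
def cycRing (m n : ℕ) [NeZero m] (q : Fin m → ℂ) : Subalgebra ℂ (cycRep m n q → ℂ) :=
  Algebra.adjoin ℂ
    ((⋃ i : Fin m, (entries (fun p : cycRep m n q => p.1.X i) ∪
        entries (fun p : cycRep m n q => p.1.Y i) ∪
        entries (fun p : cycRep m n q => (p.1.X i)⁻¹) ∪
        entries (fun p : cycRep m n q => (1 + p.1.X i * p.1.Y i)⁻¹) ∪
        entries (fun p : cycRep m n q => (1 + p.1.Y i * p.1.X i)⁻¹))) ∪
      entries (fun p : cycRep m n q => p.1.V) ∪ entries (fun p : cycRep m n q => p.1.W) ∪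
      entries (fun p : cycRep m n q => (1 + p.1.V * p.1.W)⁻¹) ∪
      entries (fun p : cycRep m n q => (1 + p.1.W * p.1.V)⁻¹))

section CycGradients

variable {m n : ℕ} (l : CycData m n →L[ℂ] ℂ)

def cycDx (s : Fin m) : Matrix (Fin n) (Fin n) ℂ :=
  Matrix.of fun i j => l (Pi.single s (Matrix.single j i 1), 0, 0, 0)
def cycDy (s : Fin m) : Matrix (Fin n) (Fin n) ℂ :=
  Matrix.of fun i j => l (0, Pi.single s (Matrix.single j i 1), 0, 0)
def cycDv : Matrix (Fin 1) (Fin n) ℂ := Matrix.of fun i j => l (0, 0, Matrix.single j i 1, 0)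
def cycDw : Matrix (Fin n) (Fin 1) ℂ := Matrix.of fun i j => l (0, 0, 0, Matrix.single j i 1)

variable (p : CycData m n)

/-! `F_a = (∂/∂a*) a* - a (∂/∂a)` for `a = xₛ` (starting at `s`), `a = yₛ` (starting at `s + 1`)
and `a = v` (starting at `0`). -/

def cycFx (s : Fin m) : Matrix (Fin n) (Fin n) ℂ := cycDy l s * p.Y s - p.X s * cycDx l s
def cycFy (s : Fin m) : Matrix (Fin n) (Fin n) ℂ := cycDx l s * p.X s - p.Y s * cycDy l s
def cycFv : Matrix (Fin n) (Fin n) ℂ := cycDw l * p.W - p.V * cycDv l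

end CycGradients

/-- As for the tadpole quiver, now with the orderings `y_{i-1} < xᵢ` (`i ≠ 0`) and
`y_{m-1} < x₀ < v` of the arrows starting at the vertices `i` and `0`. -/
def cycPre {m n : ℕ} [NeZero m] (p : CycData m n) (l₁ l₂ : CycData m n →L[ℂ] ℂ) : ℂ :=
  (∑ s : Fin m, (((1 + p.Y s * p.X s) * cycDx l₁ s * cycDy l₂ s).trace
      - ((1 + p.X s * p.Y s) * cycDy l₁ s * cycDx l₂ s).trace))
    + ((1 + p.W * p.V) * cycDv l₁ * cycDw l₂).trace
    - ((1 + p.V * p.W) * cycDw l₁ * cycDv l₂).trace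
    - (∑ s : Fin m, (cycFy l₁ p (s - 1) * cycFx l₂ p s).trace)
    - (cycFy l₁ p (0 - 1) * cycFv l₂ p).trace
    - (cycFx l₁ p 0 * cycFv l₂ p).trace

/-- The quasi-Poisson bivector on the representation space of the doubled framed cyclic quiver. -/
def cycBivector {m n : ℕ} [NeZero m] (p : CycData m n) (l₁ l₂ : CycData m n →L[ℂ] ℂ) : ℂ :=
  (cycPre p l₁ l₂ - cycPre p l₂ l₁) / 2

/-! ### The map `ξ` -/

section Xi

variable {m n : ℕ} (q : Fin m → ℂ) (p : TadData n)

/-- `tₛ = q₀ q₁ ⋯ qₛ`. -/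
def tpart (s : Fin m) : ℂ := ∏ i ∈ Finset.Iic s, q i

/-- `Xₛ = 1` for `s ≤ m - 2`, and `X_{m-1} = A`, where `A = X`. -/
def xiX (m : ℕ) (s : Fin m) : Matrix (Fin n) (Fin n) ℂ :=
  if s.val + 1 = m then p.X else 1

/-- `Zₛ = tₛ B` for `s ≤ m - 2`, and `Z_{m-1} = t_{m-1} A⁻¹ B`, where `A = X`, `B = Y + X⁻¹`. -/
def xiZ (s : Fin m) : Matrix (Fin n) (Fin n) ℂ :=
  if s.val + 1 = m then tpart q s • (p.X⁻¹ * p.Z) else tpart q s • p.Z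

/-- The map `ξ` on linear data; `Yₛ = Zₛ - Xₛ⁻¹`, `V = A⁻¹ B⁻¹ Ṽ`, `W = W̃ B A`. -/
def xiData : CycData m n :=
  (fun s => xiX p m s, fun s => xiZ q p s - (xiX p m s)⁻¹,
    p.X⁻¹ * p.Z⁻¹ * p.V, p.W * p.Z * p.X)

end Xi

/-! `ξ` sends linear data for the tadpole quiver to linear data for the cyclic quiver, compatibly
with isomorphisms. -/

section XiWellDefined

theorem isUnit_smul_mat {k : ℕ} {c : ℂ} (hc : c ≠ 0) {M : Matrix (Fin k) (Fin k) ℂ}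
    (hM : IsUnit M) : IsUnit (c • M) := by
  have h := (Units.mk0 c hc).isUnit.map (algebraMap ℂ (Matrix (Fin k) (Fin k) ℂ))
  have h2 := h.mul hM
  rwa [Units.val_mk0, Algebra.algebraMap_eq_smul_one, smul_mul_assoc, one_mul] at h2

theorem tpart_ne_zero {m : ℕ} {q : Fin m → ℂ} (hq : ∀ i, q i ≠ 0) (s : Fin m) : tpart q s ≠ 0 :=
  Finset.prod_ne_zero_iff.mpr fun i _ => hq i

variable {m n : ℕ} [NeZero m]

theorem tpart_zero (q : Fin m → ℂ) : tpart q 0 = q 0 := by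
  have h : Finset.Iic (0 : Fin m) = {0} := by ext i; simp
  rw [tpart, h, Finset.prod_singleton]

theorem val_sub_one {i : Fin m} (hi : i ≠ 0) : (i - 1).val + 1 = i.val := by
  have h0 : i.val ≠ 0 := fun h => hi (Fin.ext (by simpa using h))
  have hi2 := i.isLt
  have h1 : (1 : Fin m).val = 1 % m := rfl
  have h2 : (1 : ℕ) % m = 1 := Nat.mod_eq_of_lt (by omega)
  rw [Fin.val_sub, h1, h2, show m - 1 + i.val = (i.val - 1) + m by omega, Nat.add_mod_right,
    Nat.mod_eq_of_lt (by omega)]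
  omega

theorem val_zero_sub_one : (0 - 1 : Fin m).val + 1 = m := by
  have hm : 0 < m := Nat.pos_of_neZero m
  have h1 : (1 : Fin m).val = 1 % m := rfl
  rw [Fin.val_sub, h1]
  rcases Nat.lt_or_ge 1 m with h | h
  · rw [Nat.mod_eq_of_lt h]
    simp only [Fin.val_zero, add_zero]
    rw [Nat.mod_eq_of_lt (by omega)]
    omega
  · have : m = 1 := by omega
    subst this
    simp

theorem tpart_step (q : Fin m → ℂ) {i : Fin m} (hi : i ≠ 0) :
    tpart q i = tpart q (i - 1) * q i := by
  have hv := val_sub_one hi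
  have h : Finset.Iic i = insert i (Finset.Iic (i - 1)) := by
    ext j
    simp only [Finset.mem_Iic, Finset.mem_insert, Fin.le_def, Fin.ext_iff]
    omega
  have hn : i ∉ Finset.Iic (i - 1) := by
    simp only [Finset.mem_Iic, Fin.le_def]
    omega
  rw [tpart, h, Finset.prod_insert hn, mul_comm, tpart]

theorem tpart_last (q : Fin m → ℂ) : tpart q (0 - 1) = ∏ i, q i := by
  have hv := val_zero_sub_one (m := m)
  have h : Finset.Iic (0 - 1 : Fin m) = Finset.univ := by
    ext j
    have := j.isLt
    simp only [Finset.mem_Iic, Finset.mem_univ, iff_true, Fin.le_def]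
    omega
  rw [tpart, h]

theorem xiData_mem {q : Fin m → ℂ} (hq : ∀ i, q i ≠ 0) {p : TadData n}
    (hp : p ∈ tadRep n (∏ i, q i)) : xiData q p ∈ cycRep m n q := by
  obtain ⟨h1, h2, h3, h4, h5, h6, hX⟩ := hp
  have hXd := (Matrix.isUnit_iff_isUnit_det _).mp hX
  have hXZ : 1 + p.X * p.Y = p.X * p.Z := by
    rw [TadData.Z, Matrix.mul_add, Matrix.mul_nonsing_inv _ hXd, add_comm]
  have hZX : 1 + p.Y * p.X = p.Z * p.X := by
    rw [TadData.Z, Matrix.add_mul, Matrix.nonsing_inv_mul _ hXd, add_comm]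
  have hXi : IsUnit (p.X⁻¹) := by
    rw [Matrix.isUnit_nonsing_inv_iff]; exact hX
  have hZ : IsUnit p.Z := by
    have h : p.Z = p.X⁻¹ * (1 + p.X * p.Y) := by
      rw [hXZ, ← Matrix.mul_assoc, Matrix.nonsing_inv_mul _ hXd, Matrix.one_mul]
    rw [h]
    exact hXi.mul h1
  have hZd := (Matrix.isUnit_iff_isUnit_det _).mp hZ
  have hx : ∀ s : Fin m, IsUnit (xiX p m s) := by
    intro s
    unfold xiX
    split_ifs
    · exact hX
    · exact isUnit_one
  have hxz : ∀ s : Fin m, 1 + (xiData q p).X s * (xiData q p).Y s = tpart q s • p.Z := by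
    intro s
    have hd := (Matrix.isUnit_iff_isUnit_det _).mp (hx s)
    have : 1 + (xiData q p).X s * (xiData q p).Y s = xiX p m s * xiZ q p s := by
      simp only [xiData, CycData.X, CycData.Y]
      rw [Matrix.mul_sub, Matrix.mul_nonsing_inv _ hd]
      abel
    rw [this, xiX, xiZ]
    split_ifs
    · rw [Matrix.mul_smul, ← Matrix.mul_assoc, Matrix.mul_nonsing_inv _ hXd, Matrix.one_mul]
    · rw [Matrix.one_mul]
  have hzx : ∀ s : Fin m, 1 + (xiData q p).Y s * (xiData q p).X s
      = xiZ q p s * xiX p m s := by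
    intro s
    have hd := (Matrix.isUnit_iff_isUnit_det _).mp (hx s)
    simp only [xiData, CycData.X, CycData.Y]
    rw [Matrix.sub_mul, Matrix.nonsing_inv_mul _ hd]
    abel
  have hzu : ∀ s : Fin m, IsUnit (xiZ q p s) := by
    intro s
    unfold xiZ
    split_ifs
    · exact isUnit_smul_mat (tpart_ne_zero hq s) (hXi.mul hZ)
    · exact isUnit_smul_mat (tpart_ne_zero hq s) hZ
  have hVW : (1 + (xiData q p).V * (xiData q p).W) * (p.X⁻¹ * p.Z⁻¹)
      = (p.X⁻¹ * p.Z⁻¹) * (1 + p.V * p.W) := by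
    have hc : p.Z * p.X * (p.X⁻¹ * p.Z⁻¹) = 1 := by
      rw [Matrix.mul_assoc, ← Matrix.mul_assoc p.X, Matrix.mul_nonsing_inv _ hXd,
        Matrix.one_mul, Matrix.mul_nonsing_inv _ hZd]
    simp only [xiData, CycData.V, CycData.W]
    rw [Matrix.add_mul, Matrix.mul_add, Matrix.one_mul, Matrix.mul_one]
    congr 1
    calc p.X⁻¹ * p.Z⁻¹ * p.V * (p.W * p.Z * p.X) * (p.X⁻¹ * p.Z⁻¹)
        = p.X⁻¹ * p.Z⁻¹ * p.V * p.W * (p.Z * p.X * (p.X⁻¹ * p.Z⁻¹)) := by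
          simp only [Matrix.mul_assoc]
      _ = _ := by rw [hc, Matrix.mul_one, Matrix.mul_assoc]
  have hK : IsUnit (p.X⁻¹ * p.Z⁻¹) :=
    hXi.mul (by rw [Matrix.isUnit_nonsing_inv_iff]; exact hZ)
  have hKd := (Matrix.isUnit_iff_isUnit_det _).mp hK
  have hVW2 : 1 + (xiData q p).V * (xiData q p).W
      = (p.X⁻¹ * p.Z⁻¹) * (1 + p.V * p.W) * (p.X⁻¹ * p.Z⁻¹)⁻¹ := by
    rw [← hVW, Matrix.mul_assoc, Matrix.mul_nonsing_inv _ hKd, Matrix.mul_one]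
  have hWV : (xiData q p).W * (xiData q p).V = p.W * p.V := by
    simp only [xiData, CycData.V, CycData.W]
    calc p.W * p.Z * p.X * (p.X⁻¹ * p.Z⁻¹ * p.V)
        = p.W * (p.Z * (p.X * p.X⁻¹) * p.Z⁻¹) * p.V := by simp only [Matrix.mul_assoc]
      _ = _ := by
        rw [Matrix.mul_nonsing_inv _ hXd, Matrix.mul_one, Matrix.mul_nonsing_inv _ hZd,
          Matrix.mul_one]
  have hinv : ∀ c : ℂ, c ≠ 0 → ∀ M : Matrix (Fin n) (Fin n) ℂ, IsUnit M.det →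
      (c • M)⁻¹ = c⁻¹ • M⁻¹ := by
    intro c hc M hM
    apply Matrix.inv_eq_left_inv
    rw [Matrix.smul_mul, Matrix.mul_smul, smul_smul, inv_mul_cancel₀ hc, one_smul,
      Matrix.nonsing_inv_mul _ hM]
  refine ⟨fun s => ⟨?_, ?_⟩, ?_, ?_, ?_, ?_, ?_, hx⟩
  · rw [hxz]; exact isUnit_smul_mat (tpart_ne_zero hq s) hZ
  · rw [hzx]; exact (hzu s).mul (hx s)
  · rw [hVW2]
    exact (hK.mul h3).mul (by rw [Matrix.isUnit_nonsing_inv_iff]; exact hK)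
  · rw [hWV]; exact h4
  · intro i hi
    have hv := val_sub_one hi
    have hlt := i.isLt
    have hne : ¬ ((i - 1).val + 1 = m) := by omega
    have ht := tpart_ne_zero hq (i - 1)
    rw [hxz, hzx, xiX, xiZ, if_neg hne, if_neg hne, Matrix.mul_one, hinv _ ht _ hZd,
      Matrix.smul_mul, Matrix.mul_smul, smul_smul, Matrix.nonsing_inv_mul _ hZd, tpart_step q hi,
      inv_mul_cancel_left₀ ht]
  · have hl := val_zero_sub_one (m := m)
    have ht : (∏ i, q i) ≠ 0 := Finset.prod_ne_zero_iff.mpr fun i _ => hq i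
    have hB : IsUnit (p.X⁻¹ * p.Z * p.X) := (hXi.mul hZ).mul hX
    have e1 : 1 + (xiData q p).Y (0 - 1) * (xiData q p).X (0 - 1)
        = (∏ i, q i) • (p.X⁻¹ * p.Z * p.X) := by
      rw [hzx, xiX, xiZ, if_pos hl, if_pos hl, tpart_last, Matrix.smul_mul]
    have h5' : (p.X * p.Z) * (p.Z * p.X)⁻¹ * (1 + p.V * p.W) = (∏ i, q i) • 1 := by
      rw [← hXZ, ← hZX]; exact h5
    have e2 : (p.X⁻¹ * p.Z⁻¹)⁻¹ = p.Z * p.X := by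
      rw [Matrix.mul_inv_rev, Matrix.nonsing_inv_nonsing_inv _ hXd,
        Matrix.nonsing_inv_nonsing_inv _ hZd]
    have e3 : (p.X⁻¹ * p.Z * p.X)⁻¹ = p.X⁻¹ * p.Z⁻¹ * p.X := by
      rw [Matrix.mul_inv_rev, Matrix.mul_inv_rev, Matrix.nonsing_inv_nonsing_inv _ hXd,
        Matrix.mul_assoc]
    have e4 : p.X⁻¹ * p.Z⁻¹ = (p.Z * p.X)⁻¹ := by rw [Matrix.mul_inv_rev]
    rw [e1, hxz, hVW2, hinv _ ht _ ((Matrix.isUnit_iff_isUnit_det _).mp hB), tpart_zero, e2, e3]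
    have e5 : p.X⁻¹ * p.Z⁻¹ * p.X * p.Z * (p.X⁻¹ * p.Z⁻¹) * (1 + p.V * p.W) * (p.Z * p.X)
        = (∏ i, q i) • 1 := by
      calc p.X⁻¹ * p.Z⁻¹ * p.X * p.Z * (p.X⁻¹ * p.Z⁻¹) * (1 + p.V * p.W) * (p.Z * p.X)
          = p.X⁻¹ * p.Z⁻¹ * (p.X * p.Z * (p.Z * p.X)⁻¹ * (1 + p.V * p.W)) * (p.Z * p.X) := by
            rw [← e4]; simp only [Matrix.mul_assoc]
        _ = _ := by
            rw [h5', Matrix.mul_smul, Matrix.mul_one, Matrix.smul_mul, ← e2,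
              Matrix.mul_nonsing_inv _ hKd]
    calc (∏ i, q i)⁻¹ • (p.X⁻¹ * p.Z⁻¹ * p.X) * q 0 • p.Z *
          (p.X⁻¹ * p.Z⁻¹ * (1 + p.V * p.W) * (p.Z * p.X))
        = ((∏ i, q i)⁻¹ * q 0) • (p.X⁻¹ * p.Z⁻¹ * p.X * p.Z * (p.X⁻¹ * p.Z⁻¹) *
            (1 + p.V * p.W) * (p.Z * p.X)) := by
          simp only [Matrix.smul_mul, Matrix.mul_smul, smul_smul, Matrix.mul_assoc]
          rw [mul_comm]
      _ = q 0 • 1 := by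
          rw [e5, smul_smul]
          congr 1
          field_simp
  · rw [hWV]; exact h6

theorem xiData_act (q : Fin m → ℂ) (g : GL (Fin n) ℂ) (p : TadData n) :
    xiData q (tadAct g p) = cycAct (fun _ => g) (xiData q p) := by
  have hg : g.1⁻¹ = g⁻¹.1 := (Matrix.coe_units_inv g).symm
  have hgi : g⁻¹.1⁻¹ = g.1 := by rw [← Matrix.coe_units_inv, inv_inv]
  have c1 : g⁻¹.1 * g.1 = 1 := g.inv_mul
  have c2 : g.1 * g⁻¹.1 = 1 := g.mul_inv
  have c3 : ∀ {k : ℕ} (M : Matrix (Fin n) (Fin k) ℂ), g⁻¹.1 * (g.1 * M) = M := by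
    intro k M; rw [← Matrix.mul_assoc, c1, Matrix.one_mul]
  have eX : (tadAct g p).X = g.1 * p.X * g⁻¹.1 := rfl
  have eXi : (tadAct g p).X⁻¹ = g.1 * p.X⁻¹ * g⁻¹.1 := by
    rw [eX, Matrix.mul_inv_rev, Matrix.mul_inv_rev, hg, hgi, Matrix.mul_assoc]
  have eZ : (tadAct g p).Z = g.1 * p.Z * g⁻¹.1 := by
    rw [TadData.Z, eXi, TadData.Z, Matrix.mul_add, Matrix.add_mul]
    rfl
  have eZi : (tadAct g p).Z⁻¹ = g.1 * p.Z⁻¹ * g⁻¹.1 := by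
    rw [eZ, Matrix.mul_inv_rev, Matrix.mul_inv_rev, hg, hgi, Matrix.mul_assoc]
  have ex : ∀ s : Fin m, xiX (tadAct g p) m s = g.1 * xiX p m s * g⁻¹.1 := by
    intro s
    unfold xiX
    split_ifs
    · exact eX
    · rw [Matrix.mul_one, c2]
  have ez : ∀ s : Fin m, xiZ q (tadAct g p) s = g.1 * xiZ q p s * g⁻¹.1 := by
    intro s
    unfold xiZ
    split_ifs
    · rw [eXi, eZ, Matrix.mul_smul, Matrix.smul_mul]
      simp only [Matrix.mul_assoc, c3]
    · rw [eZ, Matrix.mul_smul, Matrix.smul_mul]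
  refine Prod.ext (funext fun s => ex s) (Prod.ext (funext fun s => ?_) (Prod.ext ?_ ?_))
  · change xiZ q (tadAct g p) s - (xiX (tadAct g p) m s)⁻¹
      = g.1 * (xiZ q p s - (xiX p m s)⁻¹) * g⁻¹.1
    rw [ez, ex, Matrix.mul_inv_rev, Matrix.mul_inv_rev, hg, hgi, Matrix.mul_sub, Matrix.sub_mul,
      Matrix.mul_assoc g.1 (xiX p m s)⁻¹]
  · change (tadAct g p).X⁻¹ * (tadAct g p).Z⁻¹ * (g.1 * p.V) = g.1 * (p.X⁻¹ * p.Z⁻¹ * p.V)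
    rw [eXi, eZi]
    simp only [Matrix.mul_assoc, c3]
  · change p.W * g⁻¹.1 * (tadAct g p).Z * (tadAct g p).X = p.W * p.Z * p.X * g⁻¹.1
    rw [eZ, eX]
    simp only [Matrix.mul_assoc, c3]

end XiWellDefined

/-- The map `ξ : C⁰_{n,t} → C⁰_{n,q}(m)`, `t = ∏ qᵢ`, on isomorphism classes. -/
def xi {m : ℕ} [NeZero m] (n : ℕ) (q : Fin m → ℂ) (hq : ∀ i, q i ≠ 0) :
    TadSpace n (∏ i, q i) → CycSpace m n q :=
  Quotient.map (fun p => ⟨xiData q p.1, xiData_mem hq p.2⟩) (by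
    rintro p p' ⟨g, hg⟩
    exact ⟨fun _ => g, by
      change xiData q p'.1 = _
      rw [hg, xiData_act]⟩)

/-! ### The coordinates `(x, σ)` -/

section Coordinates

variable {n : ℕ} (t : ℂ)

/-- Pairs `(x, σ)` with `xᵢ ≠ 0`, `σᵢ ≠ 0`, and `xᵢ ≠ xⱼ`, `xᵢ ≠ t xⱼ` for `i ≠ j`. -/
def coordDomain (n : ℕ) (t : ℂ) : Set ((Fin n → ℂ) × (Fin n → ℂ)) :=
  {u | (∀ i, u.1 i ≠ 0) ∧ (∀ i, u.2 i ≠ 0) ∧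
    ∀ i j, i ≠ j → u.1 i ≠ u.1 j ∧ u.1 i ≠ t * u.1 j}

/-- The Ruijsenaars–Schneider Lax matrix
`Bᵢⱼ = σⱼ (t - 1) / (t - xᵢ/xⱼ) ∏_{k ≠ j} (1 - t xⱼ/xₖ) / (1 - xⱼ/xₖ)`. -/
def laxMatrix (u : (Fin n → ℂ) × (Fin n → ℂ)) : Matrix (Fin n) (Fin n) ℂ :=
  Matrix.of fun i j => u.2 j * ((t - 1) / (t - u.1 i / u.1 j)) *
    ∏ k ∈ Finset.univ.erase j, (1 - t * u.1 j / u.1 k) / (1 - u.1 j / u.1 k)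

end Coordinates

end

end CalogeroMoser

open CalogeroMoser

namespace CalogeroMoser

/-! ### Covectors as gradients -/

section Gradients

variable {n : ℕ}

/-! Bijectivity is a gauge fixing. Since all X_s are invertible, the bases can be chosen so that
X_0, …, X_{m-2} are identities and X_{m-1} is the full product A = X_0⋯X_{m-1}. The relations at the
vertices i ≠ 0 then force 1 + X_s Y_s = t_s B with one and the same B, and the relation at 0 becomes
the tadpole relation once V and W are twisted by BA. This produces an explicit inverse `eta`. Both
maps are given by entries in the coordinate rings, so regular functions correspond (`xi_bijective`,
`regular_comp_xi`, `regular_of_comp_xi`).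

The brackets are well defined by reduction. The differential of a lift of a function on the orbit
space kills the orbit directions: it is horizontal. Two lifts differ by a function vanishing on the
representation locus. Because t is not a root of unity, the tadpole locus is locally a fibre of a
submersion, so the two differentials differ by a Lagrange multiplier covector. The Hamiltonian
vector of such a covector is tangent to the orbit (`tadBivector_conormal`), so it pairs to zero with
horizontal covectors. This gives `tadBivector_lift_eq`; on the cyclic side the same independence is
inherited through ξ (`cycHasBracketAt`).

For the Poisson property, `cycBivector_xiData` compares the two bivectors on horizontal covectors.
Along the image of ξ every arrow contributes a `chainForm` with the same matrix Z, and these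
contributions telescope (`chainForm_sum`): the m arrows act like one arrow whose Z-gradient is the
sum of theirs. The identity `chainForm_eq` then matches the result with the tadpole bivector.

For the coordinates, normalise A = diag x and V = (1, …, 1)ᵀ. The relation reads tBA - AB = Vρ with
a row ρ, so B is a Cauchy-type matrix determined by its diagonal, which is what σ parametrises. The
inverse function theorem for (g, x) ↦ (g diag(x) g⁻¹, g(1, …, 1)ᵀ) extends x and σ to analytic
functions of arbitrary nearby matrix data (`exists_localCoordinates`). To first order these depend
only on X and Z, so their brackets follow from `two_mul_tadBivector_of_XZ`, and ξ carries everything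
to the cyclic space. -/

theorem linearMap_eq_trace {a b : ℕ} (f : Matrix (Fin a) (Fin b) ℂ →ₗ[ℂ] ℂ)
    (M : Matrix (Fin a) (Fin b) ℂ) :
    f M = (Matrix.of (fun i j => f (Matrix.single j i 1)) * M).trace := by
  conv_lhs => rw [Matrix.matrix_eq_sum_single M]
  simp only [map_sum, Matrix.trace, Matrix.diag, Matrix.mul_apply, Matrix.of_apply]
  rw [Finset.sum_comm]
  refine Finset.sum_congr rfl fun j _ => Finset.sum_congr rfl fun i _ => ?_
  rw [show Matrix.single i j (M i j) = M i j • Matrix.single i j (1 : ℂ) by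
    simp [Matrix.smul_single], map_smul, smul_eq_mul, mul_comm]

theorem of_trace_single {a b : ℕ} (A : Matrix (Fin b) (Fin a) ℂ) :
    (Matrix.of fun i j => (A * Matrix.single j i (1 : ℂ)).trace) = A := by
  ext i j
  simp [Matrix.trace_mul_single]

theorem tadCovector_apply (l : TadData n →L[ℂ] ℂ) (δ : TadData n) :
    l δ = (tadDx l * δ.X).trace + (tadDy l * δ.Y).trace + (tadDv l * δ.V).trace
      + (tadDw l * δ.W).trace := by
  have h1 := linearMap_eq_trace (l.toLinearMap ∘ₗ LinearMap.inl ℂ _ _) δ.X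
  have h2 := linearMap_eq_trace (l.toLinearMap ∘ₗ LinearMap.inr ℂ _ _ ∘ₗ LinearMap.inl ℂ _ _) δ.Y
  have h3 := linearMap_eq_trace
    (l.toLinearMap ∘ₗ LinearMap.inr ℂ _ _ ∘ₗ LinearMap.inr ℂ _ _ ∘ₗ LinearMap.inl ℂ _ _) δ.V
  have h4 := linearMap_eq_trace
    (l.toLinearMap ∘ₗ LinearMap.inr ℂ _ _ ∘ₗ LinearMap.inr ℂ _ _ ∘ₗ LinearMap.inr ℂ _ _) δ.W
  have h : δ = (δ.X, 0, 0, 0) + (0, δ.Y, 0, 0) + (0, 0, δ.V, 0) + (0, 0, 0, δ.W) := by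
    simp [TadData.X, TadData.Y, TadData.V, TadData.W]
  conv_lhs => rw [h, map_add, map_add, map_add]
  exact congrArg₂ _ (congrArg₂ _ (congrArg₂ _ h1 h2) h3) h4

theorem tadGradient_eq {l : TadData n →L[ℂ] ℂ} {a b : Matrix (Fin n) (Fin n) ℂ}
    {v : Matrix (Fin 1) (Fin n) ℂ} {w : Matrix (Fin n) (Fin 1) ℂ}
    (h : ∀ δ : TadData n, l δ = (a * δ.X).trace + (b * δ.Y).trace + (v * δ.V).trace
      + (w * δ.W).trace) :
    tadDx l = a ∧ tadDy l = b ∧ tadDv l = v ∧ tadDw l = w := by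
  refine ⟨?_, ?_, ?_, ?_⟩
  · rw [← of_trace_single a]; ext i j; simp [tadDx, h, TadData.X, TadData.Y, TadData.V, TadData.W]
  · rw [← of_trace_single b]; ext i j; simp [tadDy, h, TadData.X, TadData.Y, TadData.V, TadData.W]
  · rw [← of_trace_single v]; ext i j; simp [tadDv, h, TadData.X, TadData.Y, TadData.V, TadData.W]
  · rw [← of_trace_single w]; ext i j; simp [tadDw, h, TadData.X, TadData.Y, TadData.V, TadData.W]

theorem cycCovector_apply {m : ℕ} (l : CycData m n →L[ℂ] ℂ) (δ : CycData m n) :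
    l δ = ∑ s, (cycDx l s * δ.X s).trace + ∑ s, (cycDy l s * δ.Y s).trace
      + (cycDv l * δ.V).trace + (cycDw l * δ.W).trace := by
  have h1 : ∀ s, _ := fun s => linearMap_eq_trace (l.toLinearMap ∘ₗ LinearMap.inl ℂ _ _ ∘ₗ
    LinearMap.single ℂ (fun _ : Fin m => Matrix (Fin n) (Fin n) ℂ) s) (δ.X s)
  have h2 : ∀ s, _ := fun s => linearMap_eq_trace (l.toLinearMap ∘ₗ LinearMap.inr ℂ _ _ ∘ₗ
    LinearMap.inl ℂ _ _ ∘ₗ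
    LinearMap.single ℂ (fun _ : Fin m => Matrix (Fin n) (Fin n) ℂ) s) (δ.Y s)
  have h3 := linearMap_eq_trace
    (l.toLinearMap ∘ₗ LinearMap.inr ℂ _ _ ∘ₗ LinearMap.inr ℂ _ _ ∘ₗ LinearMap.inl ℂ _ _) δ.V
  have h4 := linearMap_eq_trace
    (l.toLinearMap ∘ₗ LinearMap.inr ℂ _ _ ∘ₗ LinearMap.inr ℂ _ _ ∘ₗ LinearMap.inr ℂ _ _) δ.W
  have h : δ = LinearMap.inl ℂ _ _ (∑ s, LinearMap.single ℂ
        (fun _ : Fin m => Matrix (Fin n) (Fin n) ℂ) s (δ.X s))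
      + LinearMap.inr ℂ _ _ (LinearMap.inl ℂ _ _ (∑ s, LinearMap.single ℂ
        (fun _ : Fin m => Matrix (Fin n) (Fin n) ℂ) s (δ.Y s)))
      + (0, 0, δ.V, 0) + (0, 0, 0, δ.W) := by
    simp [CycData.X, CycData.Y, CycData.V, CycData.W, Finset.univ_sum_single]
  conv_lhs => rw [h, map_add, map_add, map_add, map_sum, map_sum, map_sum, map_sum, map_sum]
  exact congrArg₂ _ (congrArg₂ _ (congrArg₂ _ (Finset.sum_congr rfl fun s _ => h1 s)
    (Finset.sum_congr rfl fun s _ => h2 s)) h3) h4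

theorem cycGradient_eq {m : ℕ} {l : CycData m n →L[ℂ] ℂ} {a b : Fin m → Matrix (Fin n) (Fin n) ℂ}
    {v : Matrix (Fin 1) (Fin n) ℂ} {w : Matrix (Fin n) (Fin 1) ℂ}
    (h : ∀ δ : CycData m n, l δ = ∑ s, (a s * δ.X s).trace + ∑ s, (b s * δ.Y s).trace
      + (v * δ.V).trace + (w * δ.W).trace) :
    (∀ s, cycDx l s = a s) ∧ (∀ s, cycDy l s = b s) ∧ cycDv l = v ∧ cycDw l = w := by
  have key : ∀ (c : Fin m → Matrix (Fin n) (Fin n) ℂ) (s : Fin m) (M : Matrix (Fin n) (Fin n) ℂ),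
      ∑ r, (c r * (Pi.single s M : Fin m → Matrix (Fin n) (Fin n) ℂ) r).trace
        = (c s * M).trace := by
    intro c s M
    rw [Finset.sum_eq_single s]
    · rw [Pi.single_eq_same]
    · intro r _ hr; rw [Pi.single_eq_of_ne hr]; simp
    · simp
  refine ⟨fun s => ?_, fun s => ?_, ?_, ?_⟩
  · rw [← of_trace_single (a s)]; ext i j
    simp [cycDx, h, CycData.X, CycData.Y, CycData.V, CycData.W, key]
  · rw [← of_trace_single (b s)]; ext i j
    simp [cycDy, h, CycData.X, CycData.Y, CycData.V, CycData.W, key]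
  · rw [← of_trace_single v]; ext i j; simp [cycDv, h, CycData.X, CycData.Y, CycData.V, CycData.W]
  · rw [← of_trace_single w]; ext i j; simp [cycDw, h, CycData.X, CycData.Y, CycData.V, CycData.W]

end Gradients

/-! ### Gauge invariant covectors -/

section TadGauge

variable {n : ℕ}

/-- The covector `l` at `p` vanishes on the tangent space of the orbit of `p`. -/
def TadHorizontal (p : TadData n) (l : TadData n →L[ℂ] ℂ) : Prop :=
  tadFx l p + tadFy l p + tadFv l p = 0

/-- By cyclicity of the trace, `l` takes the value -tr((F_x + F_y + F_v) h) on the infinitesimal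
action of `h`, and the trace form is nondegenerate. -/
theorem tadHorizontal_iff (p : TadData n) (l : TadData n →L[ℂ] ℂ) :
    TadHorizontal p l ↔ ∀ h : Matrix (Fin n) (Fin n) ℂ,
      l (h * p.X - p.X * h, h * p.Y - p.Y * h, h * p.V, -(p.W * h)) = 0 := by
  have key : ∀ h : Matrix (Fin n) (Fin n) ℂ,
      l (h * p.X - p.X * h, h * p.Y - p.Y * h, h * p.V, -(p.W * h))
        = -((tadFx l p + tadFy l p + tadFv l p) * h).trace := by
    intro h
    rw [tadCovector_apply]
    change (tadDx l * (h * p.X - p.X * h)).trace + (tadDy l * (h * p.Y - p.Y * h)).trace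
      + (tadDv l * (h * p.V)).trace + (tadDw l * -(p.W * h)).trace = _
    have e1 := Matrix.trace_mul_cycle (tadDx l) h p.X
    have e2 := Matrix.trace_mul_cycle (tadDy l) h p.Y
    have e3 := Matrix.trace_mul_cycle (tadDv l) h p.V
    simp only [tadFx, tadFy, tadFv, Matrix.mul_sub, Matrix.add_mul, Matrix.sub_mul, Matrix.trace_add,
      Matrix.trace_sub, Matrix.mul_neg, Matrix.trace_neg, ← Matrix.mul_assoc, e1, e2, e3]
    ring
  constructor
  · intro hl h
    rw [key, hl]; simp
  · intro hl
    refine Matrix.ext_iff_trace_mul_right.mpr fun h => ?_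
    have := hl h
    rw [key, neg_eq_zero] at this
    simpa using this

/-- Horizontality eliminates F_v, and the symmetric traces cancel. What remains is linear in the
gradient of `l₂`, so the coefficients display the Hamiltonian vector of `l₁`. -/
theorem tadBivector_of_horizontal {p : TadData n} {l₁ l₂ : TadData n →L[ℂ] ℂ}
    (h₁ : TadHorizontal p l₁) (h₂ : TadHorizontal p l₂) :
    2 * tadBivector p l₁ l₂ =
      (((1 + p.Y * p.X) * tadDx l₁ + tadDx l₁ * (1 + p.X * p.Y)
          + tadFx l₁ p * p.Y + p.Y * tadFy l₁ p) * tadDy l₂).trace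
      - (((1 + p.X * p.Y) * tadDy l₁ + tadDy l₁ * (1 + p.Y * p.X)
          + p.X * tadFx l₁ p + tadFy l₁ p * p.X) * tadDx l₂).trace
      + (((1 + p.W * p.V) * tadDv l₁ + tadDv l₁ * (1 + p.V * p.W)) * tadDw l₂).trace
      - (((1 + p.V * p.W) * tadDw l₁ + tadDw l₁ * (1 + p.W * p.V)) * tadDv l₂).trace := by
  have g₁ : tadFv l₁ p = -(tadFx l₁ p + tadFy l₁ p) := by
    rw [eq_neg_iff_add_eq_zero, add_comm]; exact h₁
  have g₂ : tadFv l₂ p = -(tadFx l₂ p + tadFy l₂ p) := by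
    rw [eq_neg_iff_add_eq_zero, add_comm]; exact h₂
  have c1 := Matrix.trace_mul_comm (tadFx l₁ p) (tadFx l₂ p)
  have c2 := Matrix.trace_mul_comm (tadFy l₁ p) (tadFy l₂ p)
  have c3 := Matrix.trace_mul_comm (tadFx l₁ p) (tadFy l₂ p)
  have c4 := Matrix.trace_mul_comm (tadFx l₂ p) (tadFy l₁ p)
  have d1 := Matrix.trace_mul_cycle (1 + p.Y * p.X) (tadDx l₂) (tadDy l₁)
  have d2 := Matrix.trace_mul_cycle (1 + p.X * p.Y) (tadDy l₂) (tadDx l₁)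
  have d3 := Matrix.trace_mul_cycle (1 + p.W * p.V) (tadDv l₂) (tadDw l₁)
  have d4 := Matrix.trace_mul_cycle (1 + p.V * p.W) (tadDw l₂) (tadDv l₁)
  have e1 : (tadFx l₁ p * tadFy l₂ p).trace
      = (p.X * tadFx l₁ p * tadDx l₂).trace - (tadFx l₁ p * p.Y * tadDy l₂).trace := by
    rw [tadFy, Matrix.mul_sub, Matrix.trace_sub, ← Matrix.mul_assoc, ← Matrix.mul_assoc,
      Matrix.trace_mul_cycle]
  have e2 : (tadFx l₂ p * tadFy l₁ p).trace
      = (p.Y * tadFy l₁ p * tadDy l₂).trace - (tadFy l₁ p * p.X * tadDx l₂).trace := by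
    rw [Matrix.trace_mul_comm, tadFx, Matrix.mul_sub, Matrix.trace_sub, ← Matrix.mul_assoc,
      ← Matrix.mul_assoc, Matrix.trace_mul_cycle, Matrix.trace_mul_cycle p.Y]
  rw [tadBivector, tadPre, tadPre, g₁, g₂]
  simp only [Matrix.mul_neg, Matrix.trace_neg, Matrix.mul_add, Matrix.trace_add] at *
  simp only [Matrix.add_mul, Matrix.trace_add, ← Matrix.mul_assoc, Matrix.one_mul,
    Matrix.mul_one] at *
  linear_combination c1 + c2 + c3 - c4 - d1 + d2 - d3 + d4 - e1 + e2
end TadGauge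

/-! ### The tadpole relation and the radical of its bivector -/

section TadAlgebra

variable {n : ℕ} {t : ℂ}

/-- The moment relation without inverses, obtained by conjugating with 1 + XY; this polynomial form
is the one that can be differentiated. -/
theorem tadRep_relation {p : TadData n} (hp : p ∈ tadRep n t) :
    (1 + p.V * p.W) * (1 + p.X * p.Y) = t • (1 + p.Y * p.X) := by
  obtain ⟨h1, h2, h3, h4, h5, h6, hX⟩ := hp
  have d1 := (Matrix.isUnit_iff_isUnit_det _).mp h1
  have d2 := (Matrix.isUnit_iff_isUnit_det _).mp h2
  have e : (1 + p.Y * p.X)⁻¹ * (1 + p.V * p.W) * (1 + p.X * p.Y) = t • 1 := by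
    calc (1 + p.Y * p.X)⁻¹ * (1 + p.V * p.W) * (1 + p.X * p.Y)
        = (1 + p.X * p.Y)⁻¹ * ((1 + p.X * p.Y) * (1 + p.Y * p.X)⁻¹ * (1 + p.V * p.W))
            * (1 + p.X * p.Y) := by
          simp only [← Matrix.mul_assoc]
          rw [Matrix.nonsing_inv_mul _ d1, Matrix.one_mul]
      _ = _ := by
          rw [h5, Matrix.mul_smul, Matrix.mul_one, Matrix.smul_mul, Matrix.nonsing_inv_mul _ d1]
  calc _ = (1 + p.Y * p.X) * ((1 + p.Y * p.X)⁻¹ * (1 + p.V * p.W) * (1 + p.X * p.Y)) := by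
        simp only [← Matrix.mul_assoc]
        rw [Matrix.mul_nonsing_inv _ d2, Matrix.one_mul]
    _ = _ := by rw [e, Matrix.mul_smul, Matrix.mul_one]

/-- The differentials of the matrix entries of `(1 + VW)(1 + XY) - t (1 + YX)` span the radical of
the bivector on horizontal covectors. -/
theorem tadBivector_conormal {p : TadData n} (η : Matrix (Fin n) (Fin n) ℂ)
    (hrel : (1 + p.V * p.W) * (1 + p.X * p.Y) = t • (1 + p.Y * p.X))
    {l₁ l₂ : TadData n →L[ℂ] ℂ}
    (ha : tadDx l₁ = p.Y * η * (1 + p.V * p.W) - t • (η * p.Y))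
    (hb : tadDy l₁ = η * (1 + p.V * p.W) * p.X - t • (p.X * η))
    (hv : tadDv l₁ = p.W * ((1 + p.X * p.Y) * η))
    (hw : tadDw l₁ = (1 + p.X * p.Y) * η * p.V)
    (h₂ : TadHorizontal p l₂) : tadBivector p l₁ l₂ = 0 := by
  set X := p.X with hX
  set Y := p.Y with hY
  set U := 1 + p.V * p.W with hU
  have hP : p.V * p.W = U - 1 := by rw [hU]; abel
  have fx : tadFx l₁ p = t • (η * (1 + Y * X)) - (1 + X * Y) * η * U := by
    rw [tadFx, ha, hb, ← hX, ← hY]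
    have : t • (η * (1 + Y * X)) = η * (t • (1 + Y * X)) := by rw [mul_smul_comm]
    rw [this, ← hrel]
    simp only [sub_mul, mul_sub, smul_mul_assoc, mul_smul_comm]
    noncomm_ring
  have fy : tadFy l₁ p = t • ((1 + Y * X) * η) - t • (η * (1 + Y * X)) := by
    rw [tadFy, ha, hb, ← hX, ← hY]
    simp only [sub_mul, mul_sub, smul_mul_assoc, mul_smul_comm, add_mul, mul_add, smul_add]
    noncomm_ring
  have fv : tadFv l₁ p = (1 + X * Y) * η * U - t • ((1 + Y * X) * η) := by
    have e1 : (1 + X * Y) * η * p.V * p.W = (1 + X * Y) * η * (U - 1) := by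
      rw [Matrix.mul_assoc, hP]
    have e2 : p.V * (p.W * ((1 + X * Y) * η)) = (U - 1) * ((1 + X * Y) * η) := by
      rw [← Matrix.mul_assoc, hP]
    have e3 : t • ((1 + Y * X) * η) = U * (1 + X * Y) * η := by rw [hrel, smul_mul_assoc]
    rw [tadFv, hv, hw, e1, e2, e3]
    noncomm_ring
  have h₁ : TadHorizontal p l₁ := by
    rw [TadHorizontal, fx, fy, fv]; abel
  -- The identities `ka`, `kb`, `kv`, `kw` say that twice the bivector is minus the value of `l₂` on
  -- the infinitesimal action of κ, which vanishes because `l₂` is horizontal.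
  set κ := (1 + X * Y) * η * U + t • ((1 + Y * X) * η) with hκ
  have kb : (1 + Y * X) * tadDx l₁ + tadDx l₁ * (1 + X * Y) + tadFx l₁ p * Y + Y * tadFy l₁ p
      = Y * κ - κ * Y := by
    have e : Y * η * U * (1 + X * Y) = t • (Y * η * (1 + Y * X)) := by
      rw [mul_assoc (Y * η), hrel, mul_smul_comm]
    rw [ha, fx, fy, hκ, sub_mul _ _ (1 + X * Y), e]
    simp only [sub_mul, mul_sub, smul_mul_assoc, mul_smul_comm, add_mul, mul_add, smul_add, one_mul,
      mul_one, mul_assoc]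
    abel
  have ka : (1 + X * Y) * tadDy l₁ + tadDy l₁ * (1 + Y * X) + X * tadFx l₁ p + tadFy l₁ p * X
      = κ * X - X * κ := by
    have e : η * U * X * (1 + Y * X) = t • (η * (1 + Y * X) * X) := by
      calc η * U * X * (1 + Y * X) = η * (U * (1 + X * Y)) * X := by noncomm_ring
        _ = _ := by rw [hrel, mul_smul_comm, smul_mul_assoc]
    rw [hb, fx, fy, hκ, sub_mul _ _ (1 + Y * X), e]
    simp only [sub_mul, mul_sub, smul_mul_assoc, mul_smul_comm, add_mul, mul_add, smul_add, one_mul,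
      mul_one, mul_assoc]
    abel
  have hWU : (1 + p.W * p.V) * p.W = p.W * U := by
    rw [hU, Matrix.add_mul, Matrix.mul_add, Matrix.one_mul, Matrix.mul_one, Matrix.mul_assoc]
  have hUV : p.V * (1 + p.W * p.V) = U * p.V := by
    rw [hU, Matrix.add_mul, Matrix.mul_add, Matrix.one_mul, Matrix.mul_one, Matrix.mul_assoc]
  have kw : (1 + p.W * p.V) * tadDv l₁ + tadDv l₁ * U = p.W * κ := by
    calc _ = (1 + p.W * p.V) * p.W * ((1 + X * Y) * η) + p.W * ((1 + X * Y) * η * U) := by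
          rw [hv]; simp only [Matrix.mul_assoc]
      _ = p.W * (U * (1 + X * Y) * η) + p.W * ((1 + X * Y) * η * U) := by
          rw [hWU]; simp only [Matrix.mul_assoc]
      _ = _ := by rw [hrel, smul_mul_assoc, ← Matrix.mul_add, hκ, add_comm]
  have kv : U * tadDw l₁ + tadDw l₁ * (1 + p.W * p.V) = κ * p.V := by
    calc _ = U * (1 + X * Y) * η * p.V + (1 + X * Y) * η * (p.V * (1 + p.W * p.V)) := by
          rw [hw]; simp only [Matrix.mul_assoc]
      _ = U * (1 + X * Y) * η * p.V + (1 + X * Y) * η * U * p.V := by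
          rw [hUV]; simp only [Matrix.mul_assoc]
      _ = _ := by rw [hrel, smul_mul_assoc, ← Matrix.add_mul, hκ, add_comm]
  have main := tadBivector_of_horizontal h₁ h₂
  rw [kb, ka, kw, kv] at main
  have hz : ((tadFx l₂ p + tadFy l₂ p + tadFv l₂ p) * κ).trace = 0 := by
    rw [show tadFx l₂ p + tadFy l₂ p + tadFv l₂ p = 0 from h₂]; simp
  have e4 := Matrix.trace_mul_cycle X (tadDx l₂) κ
  have e5 := Matrix.trace_mul_cycle Y (tadDy l₂) κ
  have e6 := Matrix.trace_mul_cycle p.V (tadDv l₂) κ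
  have f1 := Matrix.trace_mul_cycle X κ (tadDx l₂)
  have f2 := Matrix.trace_mul_cycle Y κ (tadDy l₂)
  have f3 := Matrix.trace_mul_cycle p.W κ (tadDw l₂)
  simp only [tadFx, tadFy, tadFv, Matrix.add_mul, Matrix.sub_mul, Matrix.trace_add,
    Matrix.trace_sub] at main hz
  rw [← hX, ← hY] at hz
  linear_combination (1/2) * (main + hz + e4 + e5 + e6 + f1 + f2 + f3)
end TadAlgebra

/-! ### Smoothness of the tadpole locus when t is not a root of unity -/

section Simplicity

variable {n : ℕ} {t : ℂ}

/-- X and Z preserve the range of θ and act invertibly on it, and there XZ = t ZX. Taking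
determinants gives t^r = 1 with r the rank of θ, so r = 0. -/
theorem eq_zero_of_commute_of_qcommute (ht : ∀ k : ℕ, 0 < k → t ^ k ≠ 1)
    {X Z θ : Matrix (Fin n) (Fin n) ℂ} (hX : IsUnit X) (hZ : IsUnit Z)
    (hXθ : X * θ = θ * X) (hZθ : Z * θ = θ * Z) (h : X * Z * θ = t • (Z * X * θ)) : θ = 0 := by
  have inj : ∀ M : Matrix (Fin n) (Fin n) ℂ, IsUnit M → Function.Injective (Matrix.mulVecLin M) :=
    fun M hM => Matrix.mulVec_injective_iff_isUnit.mpr hM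
  have maps : ∀ M : Matrix (Fin n) (Fin n) ℂ, M * θ = θ * M →
      ∀ v ∈ LinearMap.range (Matrix.mulVecLin θ), Matrix.mulVecLin M v ∈
        LinearMap.range (Matrix.mulVecLin θ) := by
    rintro M hM _ ⟨v, rfl⟩
    exact ⟨M.mulVec v, by simp [Matrix.mulVec_mulVec, hM]⟩
  set f := (Matrix.mulVecLin X).restrict (maps X hXθ) with hf
  set g := (Matrix.mulVecLin Z).restrict (maps Z hZθ) with hg
  have unit : ∀ M : Matrix (Fin n) (Fin n) ℂ, IsUnit M → ∀ hM : M * θ = θ * M,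
      LinearMap.det ((Matrix.mulVecLin M).restrict (maps M hM)) ≠ 0 := by
    intro M hM hMθ
    refine (LinearMap.isUnit_det _ ?_).ne_zero
    rw [LinearMap.isUnit_iff_ker_eq_bot, LinearMap.ker_eq_bot]
    intro v w hvw
    exact Subtype.ext (inj M hM (congrArg Subtype.val hvw))
  have hfg : f * g = t • (g * f) := by
    ext ⟨_, v, rfl⟩ : 1
    refine Subtype.ext ?_
    have := congrArg (fun M : Matrix (Fin n) (Fin n) ℂ => M.mulVec v) h
    simp only [Matrix.smul_mulVec, ← Matrix.mulVec_mulVec] at this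
    exact this
  have hd := congrArg LinearMap.det hfg
  rw [LinearMap.det_smul, map_mul, map_mul, mul_comm (LinearMap.det g)] at hd
  have h1 : t ^ Module.finrank ℂ (LinearMap.range (Matrix.mulVecLin θ)) = 1 :=
    (mul_right_cancel₀ (mul_ne_zero (unit X hX hXθ) (unit Z hZ hZθ)) (by rw [one_mul]; exact hd)).symm
  have h2 : Module.finrank ℂ (LinearMap.range (Matrix.mulVecLin θ)) = 0 := by
    by_contra hne
    exact ht _ (Nat.pos_of_ne_zero hne) h1
  rw [Submodule.finrank_eq_zero, LinearMap.range_eq_bot] at h2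
  exact (LinearEquiv.map_eq_zero_iff Matrix.toLin').mp h2

/-- The differential of `(1 + VW)(1 + XY) - t (1 + YX)` is surjective along `tadRep n t`. -/
theorem eq_zero_of_conormal_eq_zero (ht : ∀ k : ℕ, 0 < k → t ^ k ≠ 1) {p : TadData n}
    (hp : p ∈ tadRep n t) {η : Matrix (Fin n) (Fin n) ℂ}
    (ha : p.Y * η * (1 + p.V * p.W) - t • (η * p.Y) = 0)
    (hb : η * (1 + p.V * p.W) * p.X - t • (p.X * η) = 0)
    (hv : p.W * ((1 + p.X * p.Y) * η) = 0)
    (hw : (1 + p.X * p.Y) * η * p.V = 0) : η = 0 := by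
  have hrel := tadRep_relation hp
  obtain ⟨h1, -, -, -, -, -, hX⟩ := hp
  have hXd := (Matrix.isUnit_iff_isUnit_det _).mp hX
  have hηV : η * p.V = 0 := by
    have := congrArg (fun M => (1 + p.X * p.Y)⁻¹ * M) hw
    simpa only [← Matrix.mul_assoc, Matrix.nonsing_inv_mul _
      ((Matrix.isUnit_iff_isUnit_det _).mp h1), Matrix.one_mul, Matrix.mul_zero] using this
  have hU : η * (1 + p.V * p.W) = η := by
    rw [mul_add, mul_one, ← Matrix.mul_assoc, hηV, Matrix.zero_mul, add_zero]
  rw [mul_assoc, hU, sub_eq_zero] at ha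
  rw [hU, sub_eq_zero] at hb
  set X := p.X
  set Y := p.Y
  set Z := p.Z with hZdef
  have hXZ : 1 + X * Y = X * Z := by
    rw [hZdef, TadData.Z, mul_add, Matrix.mul_nonsing_inv _ hXd, add_comm]
  have hZX : 1 + Y * X = Z * X := by
    rw [hZdef, TadData.Z, add_mul, Matrix.nonsing_inv_mul _ hXd, add_comm]
  have hZ : IsUnit Z := by
    have : Z = X⁻¹ * (1 + X * Y) := by
      rw [hXZ, ← mul_assoc, Matrix.nonsing_inv_mul _ hXd, one_mul]
    rw [this]
    exact (Matrix.isUnit_nonsing_inv_iff.mpr hX).mul h1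
  rw [hXZ, hZX] at hrel
  have hXη : X⁻¹ * η = t • (η * X⁻¹) := by
    have := congrArg (fun M => X⁻¹ * M * X⁻¹) hb
    simpa only [← mul_assoc, mul_smul_comm, smul_mul_assoc, Matrix.nonsing_inv_mul _ hXd, one_mul,
      Matrix.nonsing_inv_mul_cancel_right, Matrix.mul_nonsing_inv_cancel_right _ _ hXd] using this
  have hZη : Z * η = t • (η * Z) := by
    rw [hZdef, TadData.Z, add_mul, mul_add, smul_add, hXη, ← ha]
  have e1 : η * X * Z = t • (η * Z * X) := by
    calc η * X * Z = η * (1 + p.V * p.W) * X * Z := by rw [hU]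
      _ = η * ((1 + p.V * p.W) * (X * Z)) := by simp only [mul_assoc]
      _ = _ := by rw [hrel, mul_smul_comm, mul_assoc]
  have e2 : X * Z * η = η * X * Z := by
    rw [mul_assoc, hZη, mul_smul_comm, ← mul_assoc, hb, smul_mul_assoc]
  -- θ = XZη commutes with X and Z. Moreover WXZη = 0, so 1 + VW fixes θ and the relation (1 + VW)XZ
  -- = tZX reduces to XZ = tZX on the range of θ.
  have hθ : X * Z * η = 0 := by
    refine eq_zero_of_commute_of_qcommute ht hX hZ ?_ ?_ ?_
    · calc X * (X * Z * η) = X * (t • (η * Z * X)) := by rw [e2, e1]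
        _ = (t • (X * η)) * Z * X := by
          simp only [mul_smul_comm, smul_mul_assoc, mul_assoc]
        _ = X * Z * η * X := by rw [← hb, e2]
    · calc Z * (X * Z * η) = Z * η * X * Z := by rw [e2]; simp only [mul_assoc]
        _ = t • (η * Z * X) * Z := by rw [hZη]; simp only [smul_mul_assoc]
        _ = X * Z * η * Z := by rw [← e1, e2]
    · have hVθ : (1 + p.V * p.W) * (X * Z * η) = X * Z * η := by
        rw [add_mul, one_mul, Matrix.mul_assoc p.V, ← hXZ, hv, Matrix.mul_zero, add_zero]
      have hXZη : ∀ M : Matrix (Fin n) (Fin n) ℂ, M * (X * Z * η) = M * (η * X * Z) := by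
        intro M; rw [e2]
      calc X * Z * (X * Z * η) = X * Z * (η * X * Z) := hXZη _
        _ = X * Z * η * X * Z := by simp only [mul_assoc]
        _ = (1 + p.V * p.W) * (X * Z * η) * X * Z := by rw [hVθ]
        _ = ((1 + p.V * p.W) * (X * Z)) * (η * X * Z) := by simp only [mul_assoc]
        _ = _ := by rw [hrel, ← e2, smul_mul_assoc]
  have hXZd := (Matrix.isUnit_iff_isUnit_det _).mp (hX.mul hZ)
  have := congrArg (fun M => (X * Z)⁻¹ * M) hθ
  simpa only [← mul_assoc, Matrix.nonsing_inv_mul _ hXZd, one_mul, mul_zero] using this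

end Simplicity

/-! ### Invariance of the bivectors under changes of bases -/

section Invariance

variable {n : ℕ}

noncomputable section

/-- The action of `g` on linear data as a continuous linear map. -/
def tadActL (g : GL (Fin n) ℂ) : TadData n →L[ℂ] TadData n :=
  LinearMap.toContinuousLinearMap
    { toFun := tadAct g
      map_add' := fun p p' => by
        simp [tadAct, TadData.X, TadData.Y, TadData.V, TadData.W, mul_add, add_mul,
          Matrix.mul_add, Matrix.add_mul]
      map_smul' := fun c p => by
        simp [tadAct, TadData.X, TadData.Y, TadData.V, TadData.W] }

theorem tadActL_apply (g : GL (Fin n) ℂ) (p : TadData n) : tadActL g p = tadAct g p := rfl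

/-- The action of `g` on linear data as a continuous linear map. -/
def cycActL {m : ℕ} [NeZero m] (g : Fin m → GL (Fin n) ℂ) : CycData m n →L[ℂ] CycData m n :=
  LinearMap.toContinuousLinearMap
    { toFun := cycAct g
      map_add' := fun p p' => by
        simp only [cycAct, CycData.X, CycData.Y, CycData.V, CycData.W, mul_add, add_mul,
          Matrix.mul_add, Matrix.add_mul, Prod.fst_add, Prod.snd_add, Pi.add_apply]
        rfl
      map_smul' := fun c p => by
        simp only [cycAct, CycData.X, CycData.Y, CycData.V, CycData.W, Prod.smul_fst,
          Prod.smul_snd, Pi.smul_apply, Matrix.mul_smul, Matrix.smul_mul, RingHom.id_apply]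
        rfl }

theorem cycActL_apply {m : ℕ} [NeZero m] (g : Fin m → GL (Fin n) ℂ) (p : CycData m n) :
    cycActL g p = cycAct g p := rfl

theorem GL_inv_mul_cancel_left {k : ℕ} (g : GL (Fin n) ℂ) (M : Matrix (Fin n) (Fin k) ℂ) :
    g⁻¹.1 * (g.1 * M) = M := by
  rw [← Matrix.mul_assoc, show g⁻¹.1 * g.1 = 1 from g.inv_mul, Matrix.one_mul]

theorem GL_mul_inv_cancel_left {k : ℕ} (g : GL (Fin n) ℂ) (M : Matrix (Fin n) (Fin k) ℂ) :
    g.1 * (g⁻¹.1 * M) = M := by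
  rw [← Matrix.mul_assoc, show g.1 * g⁻¹.1 = 1 from g.mul_inv, Matrix.one_mul]

theorem GL_trace_conj (g : GL (Fin n) ℂ) (M : Matrix (Fin n) (Fin n) ℂ) :
    (g.1 * M * g⁻¹.1).trace = M.trace := by
  rw [Matrix.trace_mul_cycle, show g⁻¹.1 * g.1 = 1 from g.inv_mul, Matrix.one_mul]

theorem tadGradient_comp_act (g : GL (Fin n) ℂ) (l : TadData n →L[ℂ] ℂ) :
    tadDx (l.comp (tadActL g)) = g⁻¹.1 * tadDx l * g.1 ∧
    tadDy (l.comp (tadActL g)) = g⁻¹.1 * tadDy l * g.1 ∧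
    tadDv (l.comp (tadActL g)) = tadDv l * g.1 ∧
    tadDw (l.comp (tadActL g)) = g⁻¹.1 * tadDw l := by
  refine tadGradient_eq fun δ => ?_
  rw [ContinuousLinearMap.comp_apply, tadActL_apply, tadCovector_apply]
  have e : ∀ D M : Matrix (Fin n) (Fin n) ℂ,
      (D * (g.1 * M * g⁻¹.1)).trace = (g⁻¹.1 * D * g.1 * M).trace := by
    intro D M
    rw [Matrix.trace_mul_comm, Matrix.mul_assoc, Matrix.trace_mul_comm]
    rw [← Matrix.mul_assoc]
  have e3 : (tadDv l * (g.1 * δ.V)).trace = (tadDv l * g.1 * δ.V).trace := by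
    rw [Matrix.mul_assoc]
  have e4 : (tadDw l * (δ.W * g⁻¹.1)).trace = (g⁻¹.1 * tadDw l * δ.W).trace := by
    rw [← Matrix.mul_assoc, Matrix.trace_mul_comm, Matrix.mul_assoc]
  change (tadDx l * (g.1 * δ.X * g⁻¹.1)).trace + (tadDy l * (g.1 * δ.Y * g⁻¹.1)).trace
    + (tadDv l * (g.1 * δ.V)).trace + (tadDw l * (δ.W * g⁻¹.1)).trace = _
  rw [e, e, e3, e4]

theorem tadF_comp_act (g : GL (Fin n) ℂ) (p : TadData n) (l : TadData n →L[ℂ] ℂ) :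
    tadFx (l.comp (tadActL g)) p = g⁻¹.1 * tadFx l (tadAct g p) * g.1 ∧
    tadFy (l.comp (tadActL g)) p = g⁻¹.1 * tadFy l (tadAct g p) * g.1 ∧
    tadFv (l.comp (tadActL g)) p = g⁻¹.1 * tadFv l (tadAct g p) * g.1 := by
  obtain ⟨h1, h2, h3, h4⟩ := tadGradient_comp_act g l
  have eX : (tadAct g p).X = g.1 * p.X * g⁻¹.1 := rfl
  have eY : (tadAct g p).Y = g.1 * p.Y * g⁻¹.1 := rfl
  have eV : (tadAct g p).V = g.1 * p.V := rfl
  have eW : (tadAct g p).W = p.W * g⁻¹.1 := rfl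
  have c : g⁻¹.1 * g.1 = 1 := g.inv_mul
  refine ⟨?_, ?_, ?_⟩
  · rw [tadFx, tadFx, h1, h2, eX, eY]
    simp only [Matrix.mul_sub, Matrix.sub_mul, Matrix.mul_assoc, GL_inv_mul_cancel_left, c,
      Matrix.mul_one]
  · rw [tadFy, tadFy, h1, h2, eX, eY]
    simp only [Matrix.mul_sub, Matrix.sub_mul, Matrix.mul_assoc, GL_inv_mul_cancel_left, c,
      Matrix.mul_one]
  · rw [tadFv, tadFv, h3, h4, eV, eW]
    simp only [Matrix.mul_sub, Matrix.sub_mul, Matrix.mul_assoc, GL_inv_mul_cancel_left, c,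
      Matrix.mul_one]

theorem GL_trace_mul_conj (g : GL (Fin n) ℂ) (A B : Matrix (Fin n) (Fin n) ℂ) :
    ((g⁻¹.1 * A * g.1) * (g⁻¹.1 * B * g.1)).trace = (A * B).trace := by
  have h := GL_trace_conj g⁻¹ (A * B)
  rw [inv_inv] at h
  rw [← h]
  simp only [Matrix.mul_assoc, GL_mul_inv_cancel_left]

theorem tadPre_comp_act (g : GL (Fin n) ℂ) (p : TadData n) (l₁ l₂ : TadData n →L[ℂ] ℂ) :
    tadPre p (l₁.comp (tadActL g)) (l₂.comp (tadActL g)) = tadPre (tadAct g p) l₁ l₂ := by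
  obtain ⟨h1, h2, h3, h4⟩ := tadGradient_comp_act g l₁
  obtain ⟨k1, k2, k3, k4⟩ := tadGradient_comp_act g l₂
  obtain ⟨f1, f2, f3⟩ := tadF_comp_act g p l₁
  obtain ⟨f4, f5, f6⟩ := tadF_comp_act g p l₂
  have eX : (tadAct g p).X = g.1 * p.X * g⁻¹.1 := rfl
  have eY : (tadAct g p).Y = g.1 * p.Y * g⁻¹.1 := rfl
  have eV : (tadAct g p).V = g.1 * p.V := rfl
  have eW : (tadAct g p).W = p.W * g⁻¹.1 := rfl
  have c' : g.1 * g⁻¹.1 = 1 := g.mul_inv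
  have eYX : 1 + (tadAct g p).Y * (tadAct g p).X = g.1 * (1 + p.Y * p.X) * g⁻¹.1 := by
    rw [eX, eY]
    simp only [Matrix.mul_add, Matrix.add_mul, Matrix.mul_one, c', Matrix.mul_assoc,
      GL_inv_mul_cancel_left]
  have eXY : 1 + (tadAct g p).X * (tadAct g p).Y = g.1 * (1 + p.X * p.Y) * g⁻¹.1 := by
    rw [eX, eY]
    simp only [Matrix.mul_add, Matrix.add_mul, Matrix.mul_one, c', Matrix.mul_assoc,
      GL_inv_mul_cancel_left]
  have eVW : 1 + (tadAct g p).V * (tadAct g p).W = g.1 * (1 + p.V * p.W) * g⁻¹.1 := by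
    rw [eV, eW]
    simp only [Matrix.mul_add, Matrix.add_mul, Matrix.mul_one, c', Matrix.mul_assoc]
  have eWV : 1 + (tadAct g p).W * (tadAct g p).V = 1 + p.W * p.V := by
    rw [eV, eW]
    simp only [Matrix.mul_assoc, GL_inv_mul_cancel_left]
  have key : ∀ M A B : Matrix (Fin n) (Fin n) ℂ,
      (M * (g⁻¹.1 * A * g.1) * (g⁻¹.1 * B * g.1)).trace = (g.1 * M * g⁻¹.1 * A * B).trace := by
    intro M A B
    rw [← GL_trace_conj g]
    simp only [Matrix.mul_assoc, GL_mul_inv_cancel_left, c', Matrix.mul_one]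
  have e3 : ((1 + p.W * p.V) * (tadDv l₁ * g.1) * (g⁻¹.1 * tadDw l₂))
      = (1 + p.W * p.V) * tadDv l₁ * tadDw l₂ := by
    simp only [Matrix.mul_assoc, GL_mul_inv_cancel_left]
  have e4 : ((1 + p.V * p.W) * (g⁻¹.1 * tadDw l₁) * (tadDv l₂ * g.1)).trace
      = (g.1 * (1 + p.V * p.W) * g⁻¹.1 * tadDw l₁ * tadDv l₂).trace := by
    rw [← GL_trace_conj g]
    simp only [Matrix.mul_assoc, c', Matrix.mul_one]
  rw [tadPre, tadPre, h1, h2, h3, h4, k1, k2, k3, k4, f1, f2, f5, f6, eYX, eXY, eVW, eWV, key,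
    key, e3, e4, GL_trace_mul_conj, GL_trace_mul_conj, GL_trace_mul_conj]

theorem tadBivector_comp_act (g : GL (Fin n) ℂ) (p : TadData n) (l₁ l₂ : TadData n →L[ℂ] ℂ) :
    tadBivector p (l₁.comp (tadActL g)) (l₂.comp (tadActL g)) = tadBivector (tadAct g p) l₁ l₂ := by
  rw [tadBivector, tadBivector, tadPre_comp_act, tadPre_comp_act]

variable {m : ℕ} [NeZero m]

theorem cycGradient_comp_act (g : Fin m → GL (Fin n) ℂ) (l : CycData m n →L[ℂ] ℂ) :
    (∀ s, cycDx (l.comp (cycActL g)) s = (g (s + 1))⁻¹.1 * cycDx l s * (g s).1) ∧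
    (∀ s, cycDy (l.comp (cycActL g)) s = (g s)⁻¹.1 * cycDy l s * (g (s + 1)).1) ∧
    cycDv (l.comp (cycActL g)) = cycDv l * (g 0).1 ∧
    cycDw (l.comp (cycActL g)) = (g 0)⁻¹.1 * cycDw l := by
  refine cycGradient_eq fun δ => ?_
  rw [ContinuousLinearMap.comp_apply, cycActL_apply, cycCovector_apply]
  have e : ∀ (g h : GL (Fin n) ℂ) (D M : Matrix (Fin n) (Fin n) ℂ),
      (D * (g.1 * M * h.1)).trace = (h.1 * D * g.1 * M).trace := by
    intro g h D M
    rw [Matrix.trace_mul_comm, Matrix.mul_assoc, Matrix.trace_mul_comm]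
    rw [← Matrix.mul_assoc]
  have e3 : (cycDv l * ((g 0).1 * δ.V)).trace = (cycDv l * (g 0).1 * δ.V).trace := by
    rw [Matrix.mul_assoc]
  have e4 : (cycDw l * (δ.W * (g 0)⁻¹.1)).trace = ((g 0)⁻¹.1 * cycDw l * δ.W).trace := by
    rw [← Matrix.mul_assoc, Matrix.trace_mul_comm, Matrix.mul_assoc]
  change ∑ s, (cycDx l s * ((g s).1 * δ.X s * (g (s + 1))⁻¹.1)).trace
    + ∑ s, (cycDy l s * ((g (s + 1)).1 * δ.Y s * (g s)⁻¹.1)).trace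
    + (cycDv l * ((g 0).1 * δ.V)).trace + (cycDw l * (δ.W * (g 0)⁻¹.1)).trace = _
  simp only [e, e3, e4]

theorem cycF_comp_act (g : Fin m → GL (Fin n) ℂ) (p : CycData m n) (l : CycData m n →L[ℂ] ℂ) :
    (∀ s, cycFx (l.comp (cycActL g)) p s = (g s)⁻¹.1 * cycFx l (cycAct g p) s * (g s).1) ∧
    (∀ s, cycFy (l.comp (cycActL g)) p s
      = (g (s + 1))⁻¹.1 * cycFy l (cycAct g p) s * (g (s + 1)).1) ∧
    cycFv (l.comp (cycActL g)) p = (g 0)⁻¹.1 * cycFv l (cycAct g p) * (g 0).1 := by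
  obtain ⟨h1, h2, h3, h4⟩ := cycGradient_comp_act g l
  have eX : ∀ s, (cycAct g p).X s = (g s).1 * p.X s * (g (s + 1))⁻¹.1 := fun _ => rfl
  have eY : ∀ s, (cycAct g p).Y s = (g (s + 1)).1 * p.Y s * (g s)⁻¹.1 := fun _ => rfl
  have eV : (cycAct g p).V = (g 0).1 * p.V := rfl
  have eW : (cycAct g p).W = p.W * (g 0)⁻¹.1 := rfl
  have c : ∀ s, (g s)⁻¹.1 * (g s).1 = 1 := fun s => (g s).inv_mul
  refine ⟨fun s => ?_, fun s => ?_, ?_⟩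
  · rw [cycFx, cycFx, h1, h2, eX, eY]
    simp only [Matrix.mul_sub, Matrix.sub_mul, Matrix.mul_assoc, GL_inv_mul_cancel_left, c,
      Matrix.mul_one]
  · rw [cycFy, cycFy, h1, h2, eX, eY]
    simp only [Matrix.mul_sub, Matrix.sub_mul, Matrix.mul_assoc, GL_inv_mul_cancel_left, c,
      Matrix.mul_one]
  · rw [cycFv, cycFv, h3, h4, eV, eW]
    simp only [Matrix.mul_sub, Matrix.sub_mul, Matrix.mul_assoc, GL_inv_mul_cancel_left, c,
      Matrix.mul_one]

theorem cycPre_comp_act (g : Fin m → GL (Fin n) ℂ) (p : CycData m n)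
    (l₁ l₂ : CycData m n →L[ℂ] ℂ) :
    cycPre p (l₁.comp (cycActL g)) (l₂.comp (cycActL g)) = cycPre (cycAct g p) l₁ l₂ := by
  obtain ⟨h1, h2, h3, h4⟩ := cycGradient_comp_act g l₁
  obtain ⟨k1, k2, k3, k4⟩ := cycGradient_comp_act g l₂
  obtain ⟨f1, f2, f3⟩ := cycF_comp_act g p l₁
  obtain ⟨f4, f5, f6⟩ := cycF_comp_act g p l₂
  have eX : ∀ s, (cycAct g p).X s = (g s).1 * p.X s * (g (s + 1))⁻¹.1 := fun _ => rfl
  have eY : ∀ s, (cycAct g p).Y s = (g (s + 1)).1 * p.Y s * (g s)⁻¹.1 := fun _ => rfl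
  have eV : (cycAct g p).V = (g 0).1 * p.V := rfl
  have eW : (cycAct g p).W = p.W * (g 0)⁻¹.1 := rfl
  have c' : ∀ s, (g s).1 * (g s)⁻¹.1 = 1 := fun s => (g s).mul_inv
  have eYX : ∀ s, 1 + (cycAct g p).Y s * (cycAct g p).X s
      = (g (s + 1)).1 * (1 + p.Y s * p.X s) * (g (s + 1))⁻¹.1 := by
    intro s
    rw [eX, eY]
    simp only [Matrix.mul_add, Matrix.add_mul, Matrix.mul_one, c', Matrix.mul_assoc,
      GL_inv_mul_cancel_left]
  have eXY : ∀ s, 1 + (cycAct g p).X s * (cycAct g p).Y s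
      = (g s).1 * (1 + p.X s * p.Y s) * (g s)⁻¹.1 := by
    intro s
    rw [eX, eY]
    simp only [Matrix.mul_add, Matrix.add_mul, Matrix.mul_one, c', Matrix.mul_assoc,
      GL_inv_mul_cancel_left]
  have eVW : 1 + (cycAct g p).V * (cycAct g p).W
      = (g 0).1 * (1 + p.V * p.W) * (g 0)⁻¹.1 := by
    rw [eV, eW]
    simp only [Matrix.mul_add, Matrix.add_mul, Matrix.mul_one, c', Matrix.mul_assoc]
  have eWV : 1 + (cycAct g p).W * (cycAct g p).V = 1 + p.W * p.V := by
    rw [eV, eW]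
    simp only [Matrix.mul_assoc, GL_inv_mul_cancel_left]
  have key : ∀ (g h : GL (Fin n) ℂ) (M A B : Matrix (Fin n) (Fin n) ℂ),
      (M * (g⁻¹.1 * A * h.1) * (h⁻¹.1 * B * g.1)).trace = (g.1 * M * g⁻¹.1 * A * B).trace := by
    intro g h M A B
    rw [← GL_trace_conj g]
    simp only [Matrix.mul_assoc, GL_mul_inv_cancel_left, show g.1 * g⁻¹.1 = 1 from g.mul_inv,
      Matrix.mul_one]
  have e3 : ((1 + p.W * p.V) * (cycDv l₁ * (g 0).1) * ((g 0)⁻¹.1 * cycDw l₂))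
      = (1 + p.W * p.V) * cycDv l₁ * cycDw l₂ := by
    simp only [Matrix.mul_assoc, GL_mul_inv_cancel_left]
  have e4 : ((1 + p.V * p.W) * ((g 0)⁻¹.1 * cycDw l₁) * (cycDv l₂ * (g 0).1)).trace
      = ((g 0).1 * (1 + p.V * p.W) * (g 0)⁻¹.1 * cycDw l₁ * cycDv l₂).trace := by
    rw [← GL_trace_conj (g 0)]
    simp only [Matrix.mul_assoc, c', Matrix.mul_one]
  rw [cycPre, cycPre, h3, h4, k3, k4, f6, eVW, eWV, e3, e4]
  -- `sub_add_cancel` is the matching of vertices: y_{s-1} starts at (s - 1) + 1 = s, where x_s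
  -- starts, so both factors of the cross term are conjugated by the same g_s.
  simp only [h1, h2, k1, k2, f1, f2, f4, eYX, eXY, key, sub_add_cancel, GL_trace_mul_conj]

theorem cycBivector_comp_act (g : Fin m → GL (Fin n) ℂ) (p : CycData m n)
    (l₁ l₂ : CycData m n →L[ℂ] ℂ) :
    cycBivector p (l₁.comp (cycActL g)) (l₂.comp (cycActL g))
      = cycBivector (cycAct g p) l₁ l₂ := by
  rw [cycBivector, cycBivector, cycPre_comp_act, cycPre_comp_act]

end

end Invariance

/-! ### Calculus of matrix-valued functions -/

section Calculus

variable {E : Type*} [NormedAddCommGroup E] [NormedSpace ℂ E] {a b c : ℕ}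

/-- Matrices carry the entrywise sup norm, under which they are a normed space but not a normed
ring; products and inverses are therefore treated entry by entry. -/
theorem analyticAt_matrix {M : E → Matrix (Fin a) (Fin b) ℂ} {x : E} :
    AnalyticAt ℂ M x ↔ ∀ i j, AnalyticAt ℂ (fun y => M y i j) x := by
  have h1 := analyticAt_pi_iff (𝕜 := ℂ) (e := x) (f := fun i y => M y i)
  refine h1.trans (forall_congr' fun i => ?_)
  exact analyticAt_pi_iff (𝕜 := ℂ) (e := x) (f := fun j y => M y i j)

theorem hasDerivAt_matrix {M : ℂ → Matrix (Fin a) (Fin b) ℂ} {M' : Matrix (Fin a) (Fin b) ℂ}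
    {s : ℂ} : HasDerivAt M M' s ↔ ∀ i j, HasDerivAt (fun y => M y i j) (M' i j) s := by
  have h1 := hasDerivAt_pi (𝕜 := ℂ) (x := s) (φ := M) (φ' := M')
  refine h1.trans (forall_congr' fun i => ?_)
  exact hasDerivAt_pi (𝕜 := ℂ) (x := s) (φ := fun y => M y i) (φ' := M' i)

theorem analyticAt_matMul {M : E → Matrix (Fin a) (Fin b) ℂ} {N : E → Matrix (Fin b) (Fin c) ℂ}
    {x : E} (hM : AnalyticAt ℂ M x) (hN : AnalyticAt ℂ N x) :
    AnalyticAt ℂ (fun y => M y * N y) x := by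
  rw [analyticAt_matrix] at *
  intro i j
  simp only [Matrix.mul_apply]
  exact Finset.analyticAt_fun_sum _ fun k _ => (hM i k).mul (hN k j)

theorem hasDerivAt_matMul {M : ℂ → Matrix (Fin a) (Fin b) ℂ} {N : ℂ → Matrix (Fin b) (Fin c) ℂ}
    {M' : Matrix (Fin a) (Fin b) ℂ} {N' : Matrix (Fin b) (Fin c) ℂ} {s : ℂ}
    (hM : HasDerivAt M M' s) (hN : HasDerivAt N N' s) :
    HasDerivAt (fun y => M y * N y) (M' * N s + M s * N') s := by
  rw [hasDerivAt_matrix] at *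
  intro i j
  simp only [Matrix.mul_apply, Matrix.add_apply, ← Finset.sum_add_distrib]
  exact HasDerivAt.fun_sum fun k _ => (hM i k).mul (hN k j)

theorem analyticAt_matDet {M : E → Matrix (Fin a) (Fin a) ℂ} {x : E} (hM : AnalyticAt ℂ M x) :
    AnalyticAt ℂ (fun y => (M y).det) x := by
  rw [analyticAt_matrix] at hM
  simp only [Matrix.det_apply]
  exact Finset.analyticAt_fun_sum _ fun σ _ =>
    (Finset.analyticAt_fun_prod _ fun i _ => hM _ _).const_smul

/-- Cramer's rule: the inverse is the adjugate over the determinant, and each entry of the adjugate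
is a determinant with one row replaced by a constant one. -/
theorem analyticAt_matInv {M : E → Matrix (Fin a) (Fin a) ℂ} {x : E} (hM : AnalyticAt ℂ M x)
    (hx : IsUnit (M x)) : AnalyticAt ℂ (fun y => (M y)⁻¹) x := by
  have hd : (M x).det ≠ 0 := ((Matrix.isUnit_iff_isUnit_det _).mp hx).ne_zero
  have hdet := analyticAt_matDet hM
  rw [analyticAt_matrix] at *
  intro i j
  simp only [Matrix.inv_def, Matrix.smul_apply, smul_eq_mul, Ring.inverse_eq_inv,
    Matrix.adjugate_apply]
  refine (hdet.inv hd).mul (analyticAt_matDet (analyticAt_matrix.mpr fun k l => ?_))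
  by_cases hk : k = j
  · subst hk; simp only [Matrix.updateRow_self]; exact analyticAt_const
  · simp only [Matrix.updateRow_ne hk]; exact hM k l

theorem eventually_isUnit {E : Type*} [TopologicalSpace E] {M : E → Matrix (Fin a) (Fin a) ℂ} {x : E} (hM : ContinuousAt M x)
    (hx : IsUnit (M x)) : ∀ᶠ y in 𝓝 x, IsUnit (M y) := by
  have hd : (M x).det ≠ 0 := ((Matrix.isUnit_iff_isUnit_det _).mp hx).ne_zero
  have hc : ContinuousAt (fun y => (M y).det) x :=
    (Continuous.matrix_det continuous_id).continuousAt.comp hM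
  filter_upwards [hc.eventually_ne hd] with y hy
  exact (Matrix.isUnit_iff_isUnit_det _).mpr (isUnit_iff_ne_zero.mpr hy)

/-- Differentiability comes from analyticity of the inverse; the value then follows by
differentiating M M⁻¹ = 1, which holds near `s`. -/
theorem hasDerivAt_matInv {M : ℂ → Matrix (Fin a) (Fin a) ℂ} {M' : Matrix (Fin a) (Fin a) ℂ}
    {s : ℂ} (hM : HasDerivAt M M' s) (hs : IsUnit (M s)) :
    HasDerivAt (fun y => (M y)⁻¹) (-((M s)⁻¹ * M' * (M s)⁻¹)) s := by
  have hd := (Matrix.isUnit_iff_isUnit_det _).mp hs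
  have h1 : AnalyticAt ℂ (fun N : Matrix (Fin a) (Fin a) ℂ => N⁻¹) (M s) :=
    analyticAt_matInv analyticAt_id hs
  obtain ⟨R, hR⟩ : ∃ R, HasDerivAt (fun y => (M y)⁻¹) R s :=
    ⟨_, h1.differentiableAt.hasFDerivAt.comp_hasDerivAt s hM⟩
  have h2 := hasDerivAt_matMul hM hR
  have h3 : HasDerivAt (fun y => M y * (M y)⁻¹) 0 s := by
    refine (hasDerivAt_const s (1 : Matrix (Fin a) (Fin a) ℂ)).congr_of_eventuallyEq ?_
    filter_upwards [eventually_isUnit hM.continuousAt hs] with y hy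
    exact Matrix.mul_nonsing_inv _ ((Matrix.isUnit_iff_isUnit_det _).mp hy)
  have h4 : M' * (M s)⁻¹ + M s * R = 0 := h2.unique h3
  have h5 : R = -((M s)⁻¹ * M' * (M s)⁻¹) := by
    have := congrArg (fun N => (M s)⁻¹ * N) h4
    simp only [Matrix.mul_add, ← Matrix.mul_assoc, Matrix.nonsing_inv_mul _ hd, Matrix.one_mul,
      Matrix.mul_zero] at this
    exact eq_neg_of_add_eq_zero_right this
  rwa [h5] at hR

/-- The derivative along a curve determines the values of the total derivative. -/
theorem fderiv_apply_eq {F : Type*} [NormedAddCommGroup F] [NormedSpace ℂ F] {f : E → F} {x v : E}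
    {D : F} (hf : AnalyticAt ℂ f x) {γ : ℂ → E} (hγ0 : γ 0 = x) (hγ : HasDerivAt γ v 0)
    (h : HasDerivAt (fun s => f (γ s)) D 0) : fderiv ℂ f x v = D := by
  have h1 : HasFDerivAt f (fderiv ℂ f x) (γ 0) := by
    rw [hγ0]; exact hf.differentiableAt.hasFDerivAt
  exact (h1.comp_hasDerivAt 0 hγ).unique h

theorem hasDerivAt_line (x v : E) : HasDerivAt (fun s : ℂ => x + s • v) v 0 := by
  have := ((hasDerivAt_id (0 : ℂ)).smul_const v).const_add x
  simpa using this

/-- Lagrange multipliers for a function vanishing on a level set of a submersion. -/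
theorem exists_multiplier {F : Type*} [NormedAddCommGroup F] [NormedSpace ℂ F]
    [CompleteSpace E] [CompleteSpace F] {f : E → F} {φ : E → ℂ} {x : E} {f' : E →L[ℂ] F}
    {φ' : E →L[ℂ] ℂ} (hf : HasStrictFDerivAt f f' x) (hφ : HasStrictFDerivAt φ φ' x)
    (hzero : ∀ᶠ y in 𝓝 x, f y = f x → φ y = 0)
    (hsurj : ∀ Λ : F →ₗ[ℂ] ℂ, (∀ v, Λ (f' v) = 0) → Λ = 0) :
    ∃ Λ : F →ₗ[ℂ] ℂ, ∀ v, φ' v = Λ (f' v) := by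
  have hx : φ x = 0 := hzero.self_of_nhds rfl
  -- If the joint differential were onto, (f, φ) would be open at `x` and would attain (f x, w) with
  -- w ≠ 0 arbitrarily close to `x`, although φ vanishes on the level set.
  have hne : (f'.prod φ').range ≠ ⊤ := by
    intro htop
    have hmap := (hf.prodMk hφ).map_nhds_eq_of_surj htop
    have h1 : ∀ᶠ z in 𝓝 (f x, φ x), z.1 = f x → z.2 = 0 := by
      rw [← hmap, Filter.eventually_map]; exact hzero
    have h2 : ∀ᶠ w in 𝓝 (φ x), w = 0 := by
      have := ((Continuous.prodMk_right (f x)).continuousAt (x := φ x)).eventually h1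
      filter_upwards [this] with w hw using hw rfl
    rw [hx] at h2
    have h3 : ∀ᶠ w in 𝓝[≠] (0 : ℂ), w = 0 := h2.filter_mono nhdsWithin_le_nhds
    obtain ⟨w, hw, hw'⟩ := (h3.and self_mem_nhdsWithin).exists
    exact hw' hw
  obtain ⟨Λ', h0, hΛ'⟩ := Submodule.exists_le_ker_of_lt_top _ (lt_top_iff_ne_top.2 hne)
  have hdec : ∀ v, Λ' (f' v, 0) + φ' v * Λ' (0, 1) = 0 := by
    intro v
    have h1 : Λ' (f' v, φ' v) = 0 := hΛ' ⟨v, rfl⟩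
    have h2 : (f' v, φ' v) = (f' v, 0) + φ' v • ((0, 1) : F × ℂ) := by simp
    rw [h2, map_add, map_smul, smul_eq_mul] at h1
    exact h1
  -- A functional with no component along φ would kill the range of `f'` alone, hence vanish by
  -- `hsurj`. The remaining component can be normalised, which yields the multiplier.
  have hc : Λ' (0, 1) ≠ 0 := by
    intro hc
    have h1 : Λ' ∘ₗ LinearMap.inl ℂ F ℂ = 0 := by
      refine hsurj _ fun v => ?_
      have := hdec v
      rw [hc, mul_zero, add_zero] at this
      exact this
    refine h0 (LinearMap.ext fun z => ?_)
    have h2 : z = LinearMap.inl ℂ F ℂ z.1 + z.2 • ((0, 1) : F × ℂ) := by simp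
    rw [h2, map_add, map_smul, hc]
    have := LinearMap.congr_fun h1 z.1
    simpa using this
  refine ⟨(-(Λ' (0, 1))⁻¹) • (Λ' ∘ₗ LinearMap.inl ℂ F ℂ), fun v => ?_⟩
  have := hdec v
  simp only [LinearMap.smul_apply, LinearMap.comp_apply, LinearMap.inl_apply, smul_eq_mul]
  field_simp
  linear_combination this

end Calculus

/-! ### The bracket on the tadpole space -/

section TadBracket

variable {n : ℕ} {t : ℂ}

/-- The function whose zero locus is `tadRep n t`. -/
def tadMoment (t : ℂ) (p : TadData n) : Matrix (Fin n) (Fin n) ℂ :=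
  (1 + p.V * p.W) * (1 + p.X * p.Y) - t • (1 + p.Y * p.X)

theorem analyticAt_tadX (p : TadData n) : AnalyticAt ℂ (fun p : TadData n => p.X) p :=
  analyticAt_fst
theorem analyticAt_tadY (p : TadData n) : AnalyticAt ℂ (fun p : TadData n => p.Y) p :=
  analyticAt_fst.comp analyticAt_snd
theorem analyticAt_tadV (p : TadData n) : AnalyticAt ℂ (fun p : TadData n => p.V) p :=
  analyticAt_fst.comp (analyticAt_snd.comp analyticAt_snd)
theorem analyticAt_tadW (p : TadData n) : AnalyticAt ℂ (fun p : TadData n => p.W) p :=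
  analyticAt_snd.comp (analyticAt_snd.comp analyticAt_snd)

theorem analyticAt_tadMoment (p : TadData n) : AnalyticAt ℂ (tadMoment (n := n) t) p :=
  AnalyticAt.fun_sub (analyticAt_matMul
    (analyticAt_const.fun_add (analyticAt_matMul (analyticAt_tadV p) (analyticAt_tadW p)))
    (analyticAt_const.fun_add (analyticAt_matMul (analyticAt_tadX p) (analyticAt_tadY p))))
    (analyticAt_const.fun_add
      (analyticAt_matMul (analyticAt_tadY p) (analyticAt_tadX p))).fun_const_smul

/-- The determinant of `(1 + XY)(1 + YX)⁻¹(1 + VW) = t` determines `1 + WV`. -/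
theorem mem_tadRep_of_moment (ht0 : t ≠ 0) {p : TadData n} (h1 : IsUnit (1 + p.X * p.Y))
    (h2 : IsUnit (1 + p.Y * p.X)) (hX : IsUnit p.X) (h : tadMoment t p = 0) : p ∈ tadRep n t := by
  have hrel : (1 + p.V * p.W) * (1 + p.X * p.Y) = t • (1 + p.Y * p.X) := sub_eq_zero.mp h
  have d1 := (Matrix.isUnit_iff_isUnit_det _).mp h1
  have d2 := (Matrix.isUnit_iff_isUnit_det _).mp h2
  have hdet : (1 + p.V * p.W).det = t ^ n := by
    have := congrArg Matrix.det hrel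
    rw [Matrix.det_mul, Matrix.det_smul, Fintype.card_fin, Matrix.det_one_add_mul_comm p.Y p.X]
      at this
    exact mul_right_cancel₀ d1.ne_zero this
  have hU : IsUnit (1 + p.V * p.W) := by
    rw [Matrix.isUnit_iff_isUnit_det, hdet]; exact (pow_ne_zero _ ht0).isUnit
  have hWV : 1 + p.W * p.V = t ^ n • (1 : Matrix (Fin 1) (Fin 1) ℂ) := by
    rw [Matrix.det_one_add_mul_comm, Matrix.det_unique] at hdet
    ext i j
    fin_cases i; fin_cases j
    simpa using hdet
  refine ⟨h1, h2, hU, ?_, ?_, ?_, hX⟩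
  · rw [hWV]; exact isUnit_smul_mat (pow_ne_zero _ ht0) isUnit_one
  · have hU' : 1 + p.V * p.W = t • ((1 + p.Y * p.X) * (1 + p.X * p.Y)⁻¹) := by
      rw [← smul_mul_assoc, ← hrel, Matrix.mul_nonsing_inv_cancel_right _ _ d1]
    rw [hU', mul_smul_comm, ← mul_assoc, Matrix.nonsing_inv_mul_cancel_right _ _ d2,
      Matrix.mul_nonsing_inv _ d1]
  · rw [hWV]
    refine Matrix.inv_eq_left_inv ?_
    rw [Matrix.smul_mul, Matrix.one_mul, smul_smul, inv_mul_cancel₀ (pow_ne_zero _ ht0), one_smul]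

/-- Invertibility of 1 + XY, 1 + YX and X is open, and the other conditions follow from the moment
equation, so near a point of the locus this equation alone cuts it out. -/
theorem eventually_mem_tadRep (ht0 : t ≠ 0) {p : TadData n} (hp : p ∈ tadRep n t) :
    ∀ᶠ p' in 𝓝 p, tadMoment t p' = 0 → p' ∈ tadRep n t := by
  obtain ⟨h1, h2, -, -, -, -, hX⟩ := hp
  have c1 := (analyticAt_const (v := (1 : Matrix (Fin n) (Fin n) ℂ))).add
    (analyticAt_matMul (analyticAt_tadX p) (analyticAt_tadY p))
  have c2 := (analyticAt_const (v := (1 : Matrix (Fin n) (Fin n) ℂ))).add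
    (analyticAt_matMul (analyticAt_tadY p) (analyticAt_tadX p))
  filter_upwards [eventually_isUnit c1.continuousAt h1, eventually_isUnit c2.continuousAt h2,
    eventually_isUnit (analyticAt_tadX p).continuousAt hX] with p' e1 e2 e3 e
  exact mem_tadRep_of_moment ht0 e1 e2 e3 e

theorem fderiv_tadMoment (p δ : TadData n) : fderiv ℂ (tadMoment t) p δ =
    (δ.V * p.W + p.V * δ.W) * (1 + p.X * p.Y)
      + (1 + p.V * p.W) * (δ.X * p.Y + p.X * δ.Y) - t • (δ.Y * p.X + p.Y * δ.X) := by
  refine fderiv_apply_eq (analyticAt_tadMoment p) (γ := fun s => p + s • δ) (by simp)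
    (hasDerivAt_line p δ) ?_
  have hX := hasDerivAt_line p.X δ.X
  have hY := hasDerivAt_line p.Y δ.Y
  have hV := hasDerivAt_line p.V δ.V
  have hW := hasDerivAt_line p.W δ.W
  have := (hasDerivAt_matMul ((hasDerivAt_matMul hV hW).const_add 1)
    ((hasDerivAt_matMul hX hY).const_add 1)).fun_sub
    (((hasDerivAt_matMul hY hX).const_add 1).fun_const_smul t)
  simp only [zero_smul, add_zero] at this
  exact this

end TadBracket

/-! ### Pulling back lifts along analytic maps -/

section Lifts

variable {E : Type*} [NormedAddCommGroup E] [NormedSpace ℂ E] {L : Set E} {s : Setoid L}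
  {E' : Type*} [NormedAddCommGroup E'] [NormedSpace ℂ E'] {L' : Set E'} {s' : Setoid L'}

theorem isLiftAt_iff {f : Quotient s → ℂ} {p : L} {F : E → ℂ} :
    IsLiftAt f p F ↔ AnalyticAt ℂ F (p : E) ∧
      ∀ᶠ y in 𝓝 (p : E), ∀ hy : y ∈ L, F y = f (Quotient.mk s ⟨y, hy⟩) := by
  refine and_congr_right fun _ => ?_
  rw [nhds_subtype_eq_comap, Filter.eventually_comap]
  refine Filter.eventually_congr (Filter.Eventually.of_forall fun y => ?_)
  constructor
  · intro h hy; exact h ⟨y, hy⟩ rfl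
  · rintro h ⟨z, hz⟩ rfl; exact h hz

/-- One principle for changes of bases, for ξ and for its inverse: an analytic ambient map that
carries one locus into the other compatibly with the functions pulls lifts back to lifts. -/
theorem isLiftAt_comp {f : Quotient s → ℂ} {f' : Quotient s' → ℂ} {p : L} {p' : L'} {F : E' → ℂ}
    {φ : E → E'} (hφ : AnalyticAt ℂ φ p) (hp : φ p = p')
    (hmap : ∀ (y : E) (hy : y ∈ L), ∃ hy' : φ y ∈ L',
      f' (Quotient.mk s' ⟨φ y, hy'⟩) = f (Quotient.mk s ⟨y, hy⟩))
    (h : IsLiftAt f' p' F) : IsLiftAt f p (F ∘ φ) := by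
  rw [isLiftAt_iff] at h ⊢
  rw [← hp] at h
  refine ⟨h.1.comp hφ, ?_⟩
  filter_upwards [hφ.continuousAt.eventually h.2] with y hy hyL
  obtain ⟨hy', e⟩ := hmap y hyL
  rw [← e]
  exact hy hy'

end Lifts

/-! ### Independence of the tadpole bracket of lifts and representatives -/

section TadBracket

variable {n : ℕ} {t : ℂ}

theorem tadRep_units {p : TadData n} (hp : p ∈ tadRep n t) :
    IsUnit p.X ∧ IsUnit p.Z ∧ 1 + p.X * p.Y = p.X * p.Z ∧ 1 + p.Y * p.X = p.Z * p.X := by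
  obtain ⟨h1, -, -, -, -, -, hX⟩ := hp
  have hXd := (Matrix.isUnit_iff_isUnit_det _).mp hX
  have hXZ : 1 + p.X * p.Y = p.X * p.Z := by
    rw [TadData.Z, mul_add, Matrix.mul_nonsing_inv _ hXd, add_comm]
  refine ⟨hX, ?_, hXZ, ?_⟩
  · have : p.Z = p.X⁻¹ * (1 + p.X * p.Y) := by
      rw [hXZ, ← mul_assoc, Matrix.nonsing_inv_mul _ hXd, one_mul]
    rw [this]
    exact (Matrix.isUnit_nonsing_inv_iff.mpr hX).mul h1
  · rw [TadData.Z, add_mul, Matrix.nonsing_inv_mul _ hXd, add_comm]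

theorem tadAct_mem (ht0 : t ≠ 0) (g : GL (Fin n) ℂ) {p : TadData n} (hp : p ∈ tadRep n t) :
    tadAct g p ∈ tadRep n t := by
  have hrel := tadRep_relation hp
  obtain ⟨h1, h2, -, -, -, -, hX⟩ := hp
  have eX : (tadAct g p).X = g.1 * p.X * g⁻¹.1 := rfl
  have eY : (tadAct g p).Y = g.1 * p.Y * g⁻¹.1 := rfl
  have eV : (tadAct g p).V = g.1 * p.V := rfl
  have eW : (tadAct g p).W = p.W * g⁻¹.1 := rfl
  have c' : g.1 * g⁻¹.1 = 1 := g.mul_inv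
  have eYX : 1 + (tadAct g p).Y * (tadAct g p).X = g.1 * (1 + p.Y * p.X) * g⁻¹.1 := by
    rw [eX, eY]
    simp only [Matrix.mul_add, Matrix.add_mul, Matrix.mul_one, c', Matrix.mul_assoc,
      GL_inv_mul_cancel_left]
  have eXY : 1 + (tadAct g p).X * (tadAct g p).Y = g.1 * (1 + p.X * p.Y) * g⁻¹.1 := by
    rw [eX, eY]
    simp only [Matrix.mul_add, Matrix.add_mul, Matrix.mul_one, c', Matrix.mul_assoc,
      GL_inv_mul_cancel_left]
  have eVW : 1 + (tadAct g p).V * (tadAct g p).W = g.1 * (1 + p.V * p.W) * g⁻¹.1 := by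
    rw [eV, eW]
    simp only [Matrix.mul_add, Matrix.add_mul, Matrix.mul_one, c', Matrix.mul_assoc]
  refine mem_tadRep_of_moment ht0 ?_ ?_ ?_ ?_
  · rw [eXY]; exact (g.isUnit.mul h1).mul g⁻¹.isUnit
  · rw [eYX]; exact (g.isUnit.mul h2).mul g⁻¹.isUnit
  · exact (g.isUnit.mul hX).mul g⁻¹.isUnit
  · rw [tadMoment, eYX, eXY, eVW, sub_eq_zero]
    calc _ = g.1 * ((1 + p.V * p.W) * (1 + p.X * p.Y)) * g⁻¹.1 := by
          simp only [Matrix.mul_assoc, GL_inv_mul_cancel_left]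
      _ = _ := by rw [hrel, mul_smul_comm, smul_mul_assoc]

/-- For small s the matrix 1 + s h is invertible, so s ↦ (1 + s h)·p is a curve inside one orbit of
the locus. The lift is constant along it although it need not be invariant elsewhere; differentiate
at s = 0. -/
theorem tadHorizontal_of_lift (ht0 : t ≠ 0) {f : TadSpace n t → ℂ} {p : tadRep n t}
    {F : TadData n → ℂ} (hF : IsLiftAt f p F) : TadHorizontal p.1 (fderiv ℂ F p.1) := by
  rw [tadHorizontal_iff]
  intro h
  rw [isLiftAt_iff] at hF
  have hg : HasDerivAt (fun s : ℂ => 1 + s • h) h 0 := hasDerivAt_line 1 h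
  have hu0 : IsUnit (1 + (0 : ℂ) • h) := by simp
  have hgi := hasDerivAt_matInv hg hu0
  simp only [zero_smul, add_zero, inv_one, one_mul, mul_one] at hgi
  let γ : ℂ → TadData n := fun s =>
    ((1 + s • h) * p.1.X * (1 + s • h)⁻¹, (1 + s • h) * p.1.Y * (1 + s • h)⁻¹,
      (1 + s • h) * p.1.V, p.1.W * (1 + s • h)⁻¹)
  have hγ0 : γ 0 = p.1 := by simp [γ]
  have hconj : ∀ M : Matrix (Fin n) (Fin n) ℂ,
      HasDerivAt (fun s : ℂ => (1 + s • h) * M * (1 + s • h)⁻¹) (h * M - M * h) 0 := by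
    intro M
    have := hasDerivAt_matMul (hasDerivAt_matMul hg (hasDerivAt_const 0 M)) hgi
    simpa [sub_eq_add_neg] using this
  have hγ : HasDerivAt γ (h * p.1.X - p.1.X * h, h * p.1.Y - p.1.Y * h, h * p.1.V,
      -(p.1.W * h)) 0 := by
    refine (hconj _).prodMk ((hconj _).prodMk (HasDerivAt.prodMk ?_ ?_))
    · have := hasDerivAt_matMul hg (hasDerivAt_const 0 p.1.V)
      rw [Matrix.mul_zero, add_zero] at this
      exact this
    · have := hasDerivAt_matMul (hasDerivAt_const 0 p.1.W) hgi
      rw [Matrix.zero_mul, zero_add, Matrix.mul_neg] at this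
      exact this
  refine fderiv_apply_eq hF.1 hγ0 hγ ?_
  refine (hasDerivAt_const (0 : ℂ) (f (Quotient.mk _ p))).congr_of_eventuallyEq ?_
  have hc := hγ.continuousAt
  rw [ContinuousAt, hγ0] at hc
  filter_upwards [hc.eventually hF.2, eventually_isUnit hg.continuousAt hu0] with s hs hu
  obtain ⟨g, hg'⟩ := hu
  have e : γ s = tadAct g p.1 := by
    have : g⁻¹.1 = (1 + s • h)⁻¹ := by rw [← hg', Matrix.coe_units_inv]
    simp only [γ, tadAct, this, hg']
  rw [hs (e ▸ tadAct_mem ht0 g p.2)]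
  exact congrArg f (Quotient.sound ⟨g⁻¹, by
    change p.1 = tadAct g⁻¹ (γ s)
    rw [e, ← tadAct_mul, inv_mul_cancel, tadAct_one]⟩)

theorem tadGradient_sub (l l' : TadData n →L[ℂ] ℂ) :
    tadDx (l - l') = tadDx l - tadDx l' ∧ tadDy (l - l') = tadDy l - tadDy l' ∧
    tadDv (l - l') = tadDv l - tadDv l' ∧ tadDw (l - l') = tadDw l - tadDw l' := by
  refine ⟨?_, ?_, ?_, ?_⟩ <;> ext i j <;> simp [tadDx, tadDy, tadDv, tadDw]

theorem tadF_sub (l l' : TadData n →L[ℂ] ℂ) (p : TadData n) :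
    tadFx (l - l') p = tadFx l p - tadFx l' p ∧ tadFy (l - l') p = tadFy l p - tadFy l' p ∧
    tadFv (l - l') p = tadFv l p - tadFv l' p := by
  obtain ⟨h1, h2, h3, h4⟩ := tadGradient_sub l l'
  refine ⟨?_, ?_, ?_⟩
  · rw [tadFx, h1, h2, tadFx, tadFx, Matrix.sub_mul, Matrix.mul_sub]; abel
  · rw [tadFy, h1, h2, tadFy, tadFy, Matrix.sub_mul, Matrix.mul_sub]; abel
  · rw [tadFv, h3, h4, tadFv, tadFv, Matrix.sub_mul, Matrix.mul_sub]; abel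

theorem tadBivector_sub_left (p : TadData n) (l l' l₂ : TadData n →L[ℂ] ℂ) :
    tadBivector p (l - l') l₂ = tadBivector p l l₂ - tadBivector p l' l₂ := by
  obtain ⟨h1, h2, h3, h4⟩ := tadGradient_sub l l'
  obtain ⟨f1, f2, f3⟩ := tadF_sub l l' p
  simp only [tadBivector, tadPre, h1, h2, h3, h4, f1, f2, f3, Matrix.mul_sub, Matrix.sub_mul,
    Matrix.trace_sub]
  ring

theorem tadBivector_antisymm (p : TadData n) (l l' : TadData n →L[ℂ] ℂ) :
    tadBivector p l l' = -tadBivector p l' l := by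
  rw [tadBivector, tadBivector]; ring

/-- The transpose of the differential of the moment map: the multiplier Λ becomes a matrix η through
the trace form, and cyclicity moves each variation to the end. -/
theorem tadConormal_gradient (p : TadData n) (η : Matrix (Fin n) (Fin n) ℂ)
    (Λ : Matrix (Fin n) (Fin n) ℂ →ₗ[ℂ] ℂ) (hη : ∀ M, Λ M = (η * M).trace)
    {l : TadData n →L[ℂ] ℂ} (h₁ : ∀ δ, l δ = Λ (fderiv ℂ (tadMoment t) p δ)) :
    tadDx l = p.Y * η * (1 + p.V * p.W) - t • (η * p.Y) ∧
    tadDy l = η * (1 + p.V * p.W) * p.X - t • (p.X * η) ∧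
    tadDv l = p.W * ((1 + p.X * p.Y) * η) ∧ tadDw l = (1 + p.X * p.Y) * η * p.V := by
  refine tadGradient_eq fun δ => ?_
  rw [h₁, fderiv_tadMoment, hη]
  set U := 1 + p.V * p.W
  set N := 1 + p.X * p.Y
  have e : η * ((δ.V * p.W + p.V * δ.W) * N + U * (δ.X * p.Y + p.X * δ.Y)
        - t • (δ.Y * p.X + p.Y * δ.X))
      = η * δ.V * (p.W * N) + η * p.V * δ.W * N + η * U * δ.X * p.Y + η * U * p.X * δ.Y
        - t • (η * δ.Y * p.X) - t • (η * p.Y * δ.X) := by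
    simp only [Matrix.mul_add, Matrix.mul_sub, Matrix.add_mul, Matrix.mul_smul, smul_add,
      Matrix.mul_assoc]
    abel
  rw [e]
  simp only [Matrix.trace_add, Matrix.trace_sub, Matrix.trace_smul, Matrix.sub_mul,
    Matrix.smul_mul]
  rw [Matrix.trace_mul_cycle η δ.V, Matrix.trace_mul_cycle (η * p.V) δ.W,
    Matrix.trace_mul_cycle (η * U) δ.X, Matrix.trace_mul_cycle η δ.Y]
  simp only [← Matrix.mul_assoc]
  ring

/-- A covector that vanishes on the tangent space of `tadRep n t` is in the radical of the bivector
on horizontal covectors. -/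
theorem tadBivector_eq_zero_of_multiplier {p : TadData n} (hp : p ∈ tadRep n t)
    {l₁ l₂ : TadData n →L[ℂ] ℂ} (Λ : Matrix (Fin n) (Fin n) ℂ →ₗ[ℂ] ℂ)
    (h₁ : ∀ δ, l₁ δ = Λ (fderiv ℂ (tadMoment t) p δ)) (h₂ : TadHorizontal p l₂) :
    tadBivector p l₁ l₂ = 0 := by
  obtain ⟨η, hη⟩ : ∃ η : Matrix (Fin n) (Fin n) ℂ, ∀ M, Λ M = (η * M).trace :=
    ⟨_, linearMap_eq_trace Λ⟩
  obtain ⟨h1, h2, h3, h4⟩ := tadConormal_gradient p η Λ hη h₁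
  exact tadBivector_conormal η (tadRep_relation hp) h1 h2 h3 h4 h₂

/-- The difference of two lifts vanishes on the locus, a level set of a submersion near the point.
Its differential is thus a multiplier of the moment map, and such covectors pair to zero with
horizontal ones. -/
theorem tadBivector_lift_left (ht0 : t ≠ 0) (ht : ∀ k : ℕ, 0 < k → t ^ k ≠ 1)
    {f : TadSpace n t → ℂ} {p : tadRep n t} {F F' : TadData n → ℂ}
    (hF : IsLiftAt f p F) (hF' : IsLiftAt f p F') {l : TadData n →L[ℂ] ℂ}
    (hl : TadHorizontal p.1 l) :
    tadBivector p.1 (fderiv ℂ F p.1) l = tadBivector p.1 (fderiv ℂ F' p.1) l := by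
  have hp0 : tadMoment t p.1 = 0 := sub_eq_zero.mpr (tadRep_relation p.2)
  rw [isLiftAt_iff] at hF hF'
  obtain ⟨Λ, hΛ⟩ := exists_multiplier (f := tadMoment t) (φ := fun y => F y - F' y) (x := p.1)
    (analyticAt_tadMoment p.1).hasStrictFDerivAt
    (hF.1.hasStrictFDerivAt.fun_sub hF'.1.hasStrictFDerivAt)
    (by
      filter_upwards [hF.2, hF'.2, eventually_mem_tadRep ht0 p.2] with y h1 h2 h3 h4
      rw [hp0] at h4
      rw [h1 (h3 h4), h2 (h3 h4), sub_self])
    (by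
      intro Λ hΛ
      obtain ⟨η, hη⟩ : ∃ η : Matrix (Fin n) (Fin n) ℂ, ∀ M, Λ M = (η * M).trace :=
        ⟨_, linearMap_eq_trace Λ⟩
      -- Surjectivity in dual form: if Λ kills the range of the differential, its conormal covector
      -- is 0, and `eq_zero_of_conormal_eq_zero` makes the matrix of Λ vanish.
      obtain ⟨h1, h2, h3, h4⟩ := tadConormal_gradient (t := t) p.1 η Λ hη (l := 0) fun δ =>
        (hΛ δ).symm
      have z : tadDx (0 : TadData n →L[ℂ] ℂ) = 0 ∧ tadDy (0 : TadData n →L[ℂ] ℂ) = 0 ∧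
          tadDv (0 : TadData n →L[ℂ] ℂ) = 0 ∧ tadDw (0 : TadData n →L[ℂ] ℂ) = 0 := by
        refine ⟨?_, ?_, ?_, ?_⟩ <;> ext i j <;> simp [tadDx, tadDy, tadDv, tadDw]
      rw [z.1] at h1
      rw [z.2.1] at h2
      rw [z.2.2.1] at h3
      rw [z.2.2.2] at h4
      have := eq_zero_of_conormal_eq_zero ht p.2 h1.symm h2.symm h3.symm h4.symm
      ext M
      simp [hη, this])
  have := tadBivector_eq_zero_of_multiplier p.2 Λ hΛ hl
  exact sub_eq_zero.mp ((tadBivector_sub_left p.1 _ _ l).symm.trans this)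

theorem isLiftAt_comp_tadAct (ht0 : t ≠ 0) {f : TadSpace n t → ℂ} {p p' : tadRep n t}
    (g : GL (Fin n) ℂ) (hg : p'.1 = tadAct g p.1) {F : TadData n → ℂ} (hF : IsLiftAt f p' F) :
    IsLiftAt f p (F ∘ tadActL g) :=
  isLiftAt_comp ((tadActL g).analyticAt _) hg.symm
    (fun y hy => ⟨tadAct_mem ht0 g hy, congrArg f (Quotient.sound ⟨g⁻¹, by
      change y = tadAct g⁻¹ (tadAct g y)
      rw [← tadAct_mul, inv_mul_cancel, tadAct_one]⟩)⟩) hF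

theorem fderiv_comp_clm {E E' : Type*} [NormedAddCommGroup E] [NormedSpace ℂ E]
    [NormedAddCommGroup E'] [NormedSpace ℂ E'] {F : E' → ℂ} (A : E →L[ℂ] E') {x : E}
    (hF : AnalyticAt ℂ F (A x)) : fderiv ℂ (F ∘ A) x = (fderiv ℂ F (A x)).comp A := by
  rw [fderiv_comp x hF.differentiableAt A.differentiableAt, A.fderiv]

theorem fderiv_comp_tadAct {p p' : TadData n} (g : GL (Fin n) ℂ) (hg : p' = tadAct g p)
    {F : TadData n → ℂ} (hF : AnalyticAt ℂ F p') :
    fderiv ℂ (F ∘ tadActL g) p = (fderiv ℂ F p').comp (tadActL g) := by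
  subst hg
  exact fderiv_comp_clm (tadActL g) hF

/-- The bracket of functions on the tadpole space does not depend on the choices of lifts and of a
representative. -/
theorem tadBivector_lift_eq (ht0 : t ≠ 0) (ht : ∀ k : ℕ, 0 < k → t ^ k ≠ 1)
    {f f' : TadSpace n t → ℂ} {p p' : tadRep n t}
    (hpp' : Quotient.mk (tadSetoid n t) p = Quotient.mk (tadSetoid n t) p')
    {F G F' G' : TadData n → ℂ} (hF : IsLiftAt f p F) (hG : IsLiftAt f' p G)
    (hF' : IsLiftAt f p' F') (hG' : IsLiftAt f' p' G') :
    tadBivector p.1 (fderiv ℂ F p.1) (fderiv ℂ G p.1)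
      = tadBivector p'.1 (fderiv ℂ F' p'.1) (fderiv ℂ G' p'.1) := by
  obtain ⟨g, hg⟩ := Quotient.exact hpp'
  have hF'' := isLiftAt_comp_tadAct ht0 g hg hF'
  have hG'' := isLiftAt_comp_tadAct ht0 g hg hG'
  -- The lifts are exchanged one at a time; antisymmetry brings the second one to the left slot.
  rw [tadBivector_lift_left ht0 ht hF hF'' (tadHorizontal_of_lift ht0 hG), tadBivector_antisymm,
    tadBivector_lift_left ht0 ht hG hG'' (tadHorizontal_of_lift ht0 hF''), ← tadBivector_antisymm]
  rw [fderiv_comp_tadAct g hg hF'.1, fderiv_comp_tadAct g hg hG'.1, hg]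
  exact tadBivector_comp_act g p.1 _ _

theorem tadHasBracketAt (ht0 : t ≠ 0) (ht : ∀ k : ℕ, 0 < k → t ^ k ≠ 1)
    {f f' : TadSpace n t → ℂ} {p : tadRep n t} {F G : TadData n → ℂ} (hF : IsLiftAt f p F)
    (hG : IsLiftAt f' p G) :
    HasBracketAt tadBivector f f' (Quotient.mk _ p)
      (tadBivector p.1 (fderiv ℂ F p.1) (fderiv ℂ G p.1)) :=
  ⟨⟨p, rfl, F, hF⟩, ⟨p, rfl, G, hG⟩, fun _ hp' _ _ hF' hG' =>
    tadBivector_lift_eq ht0 ht hp' hF' hG' hF hG⟩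

theorem exists_lift_of_holomorphicAt (ht0 : t ≠ 0) {f : TadSpace n t → ℂ} {p : tadRep n t}
    (hf : HolomorphicAt f (Quotient.mk _ p)) : ∃ F : TadData n → ℂ, IsLiftAt f p F := by
  obtain ⟨p', hp', F, hF⟩ := hf
  obtain ⟨g, hg⟩ := Quotient.exact hp'.symm
  exact ⟨_, isLiftAt_comp_tadAct ht0 g hg hF⟩

end TadBracket

/-! ### Comparison of the bivectors along `ξ` -/

section Telescope

variable {n : ℕ}

noncomputable section

/-- The contribution of a chain of arrows of the cyclic quiver to twice the bivector. -/
def chainForm (Z c₁ c₂ β₁ β₂ : Matrix (Fin n) (Fin n) ℂ) : ℂ :=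
  ((Z * β₁ + β₁ * Z) * c₂).trace - ((Z * β₂ + β₂ * Z) * c₁).trace
    - (Z * Z * (β₁ * β₂ - β₂ * β₁)).trace

/-- The cocycle rule behind the telescoping: crossing an arrow with gradient β shifts c by the
commutator [Z, β], and two consecutive arrows then merge into a single one with gradient β + B. -/
theorem chainForm_add (Z c₁ c₂ β₁ β₂ B₁ B₂ : Matrix (Fin n) (Fin n) ℂ) :
    chainForm Z c₁ c₂ β₁ β₂
        + chainForm Z (c₁ + (Z * β₁ - β₁ * Z)) (c₂ + (Z * β₂ - β₂ * Z)) B₁ B₂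
      = chainForm Z c₁ c₂ (β₁ + B₁) (β₂ + B₂) := by
  have e3 := Matrix.trace_mul_comm (B₁ * Z) (β₂ * Z)
  have e4 := Matrix.trace_mul_comm (B₂ * Z) (β₁ * Z)
  have f3 := Matrix.trace_mul_comm (B₁ * Z * Z) β₂
  have f4 := Matrix.trace_mul_comm (B₂ * Z * Z) β₁
  have h1 := Matrix.trace_mul_comm (β₂ * B₁) (Z * Z)
  have h2 := Matrix.trace_mul_comm (β₁ * B₂) (Z * Z)
  have i1 := Matrix.trace_mul_comm (Z * B₁ * Z) β₂
  have i2 := Matrix.trace_mul_comm (Z * B₂ * Z) β₁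
  have i3 := Matrix.trace_mul_comm (Z * B₁ * β₂) Z
  have i4 := Matrix.trace_mul_comm (Z * B₂ * β₁) Z
  simp only [chainForm, mul_add, add_mul, mul_sub, Matrix.trace_add, Matrix.trace_sub,
    mul_assoc] at *
  linear_combination i1 - e3 - i2 + e4 + f3 + h1 - f4 - h2 + i4 - i3

/-- The contribution of a single arrow. -/
theorem chainForm_block {X Y Z a₁ b₁ a₂ b₂ : Matrix (Fin n) (Fin n) ℂ} {t : ℂ} (ht : t ≠ 0)
    (hX : IsUnit X) (hY : Y = X⁻¹ * (t • Z - 1)) :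
    ((1 + Y * X) * a₁ * b₂).trace - ((1 + X * Y) * b₁ * a₂).trace
        - (((1 + Y * X) * a₂ * b₁).trace - ((1 + X * Y) * b₂ * a₁).trace)
      = chainForm Z (b₁ * Y - X * a₁) (b₂ * Y - X * a₂) (t • (b₁ * X⁻¹)) (t • (b₂ * X⁻¹)) := by
  have hXd := (Matrix.isUnit_iff_isUnit_det _).mp hX
  -- As Y = X⁻¹(tZ - 1), the matrix B = t b X⁻¹ is the gradient in Z at fixed X. Expressing b
  -- through B leaves an identity in Z, B and A = Xa that holds up to cyclicity of the trace.
  obtain ⟨B₁, rfl⟩ : ∃ B, b₁ = t⁻¹ • (B * X) := ⟨t • (b₁ * X⁻¹), by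
    rw [smul_mul_assoc, smul_smul, inv_mul_cancel₀ ht, one_smul,
      Matrix.nonsing_inv_mul_cancel_right _ _ hXd]⟩
  obtain ⟨B₂, rfl⟩ : ∃ B, b₂ = t⁻¹ • (B * X) := ⟨t • (b₂ * X⁻¹), by
    rw [smul_mul_assoc, smul_smul, inv_mul_cancel₀ ht, one_smul,
      Matrix.nonsing_inv_mul_cancel_right _ _ hXd]⟩
  have hB : ∀ B : Matrix (Fin n) (Fin n) ℂ, t • (t⁻¹ • (B * X) * X⁻¹) = B := by
    intro B
    rw [smul_mul_assoc, smul_smul, mul_inv_cancel₀ ht, one_smul,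
      Matrix.mul_nonsing_inv_cancel_right _ _ hXd]
  have hbY : ∀ B : Matrix (Fin n) (Fin n) ℂ, t⁻¹ • (B * X) * Y = B * Z - t⁻¹ • B := by
    intro B
    rw [hY, smul_mul_assoc, ← mul_assoc, Matrix.mul_nonsing_inv_cancel_right _ _ hXd, mul_sub,
      mul_one, mul_smul_comm, smul_sub, smul_smul, inv_mul_cancel₀ ht, one_smul]
  have hXY : 1 + X * Y = t • Z := by
    rw [hY, ← mul_assoc, Matrix.mul_nonsing_inv _ hXd, one_mul]; abel
  have hYX : 1 + Y * X = t • (X⁻¹ * Z * X) := by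
    rw [hY, mul_sub, sub_mul, mul_one, Matrix.nonsing_inv_mul _ hXd, mul_smul_comm,
      smul_mul_assoc]; abel
  have key : ∀ a B : Matrix (Fin n) (Fin n) ℂ,
      (t • (X⁻¹ * Z * X) * a * (t⁻¹ • (B * X))).trace = (Z * (X * a) * B).trace := by
    intro a B
    have : t • (X⁻¹ * Z * X) * a * (t⁻¹ • (B * X)) = (X⁻¹ * (Z * (X * a) * B) * X) := by
      simp only [smul_mul_assoc, mul_smul_comm, smul_smul, inv_mul_cancel₀ ht, one_smul, mul_assoc]
    rw [this, Matrix.trace_mul_cycle, Matrix.mul_nonsing_inv _ hXd, one_mul]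
  have key2 : ∀ a B : Matrix (Fin n) (Fin n) ℂ,
      (t • Z * (t⁻¹ • (B * X)) * a).trace = (Z * B * (X * a)).trace := by
    intro a B
    simp only [smul_mul_assoc, mul_smul_comm, smul_smul, inv_mul_cancel₀ ht, one_smul, mul_assoc]
  obtain ⟨A₁, hA₁⟩ : ∃ A, A = X * a₁ := ⟨_, rfl⟩
  obtain ⟨A₂, hA₂⟩ : ∃ A, A = X * a₂ := ⟨_, rfl⟩
  rw [hB, hB, hbY, hbY, hXY, hYX, key, key, key2, key2, ← hA₁, ← hA₂]
  have e1 := Matrix.trace_mul_comm (Z * A₁) B₂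
  have e2 := Matrix.trace_mul_comm (Z * A₂) B₁
  have e3 := Matrix.trace_mul_comm (Z * B₁) (B₂ * Z)
  have e4 := Matrix.trace_mul_comm (Z * B₂) (B₁ * Z)
  have e5 := Matrix.trace_mul_comm (Z * B₁ * B₂) Z
  have e6 := Matrix.trace_mul_comm (Z * B₂ * B₁) Z
  have e7 := Matrix.trace_mul_comm (B₁ * Z) (B₂ * Z)
  have e8 := Matrix.trace_mul_comm (Z * B₁) (Z * B₂)
  have e9 := Matrix.trace_mul_comm (Z * B₁) B₂
  have e10 := Matrix.trace_mul_comm (Z * B₂) B₁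
  have e11 := Matrix.trace_mul_comm (Z * B₂ * Z) B₁
  have e12 := Matrix.trace_mul_comm (Z * B₁ * Z) B₂
  simp only [chainForm, mul_add, add_mul, mul_sub, Matrix.trace_add, Matrix.trace_sub,
    mul_smul_comm, Matrix.trace_smul, smul_eq_mul, mul_assoc] at *
  grind

/-- Induction with `chainForm_add`. The B live on the k arrows of the chain and the c on its k + 1
vertices; the total shift of c is recorded because the induction and the closing of the cycle both
use it. -/
theorem chainForm_sum (Z : Matrix (Fin n) (Fin n) ℂ) (k : ℕ)
    (c₁ c₂ : Fin (k + 1) → Matrix (Fin n) (Fin n) ℂ) (B₁ B₂ : Fin k → Matrix (Fin n) (Fin n) ℂ)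
    (h₁ : ∀ s, c₁ s.succ = c₁ s.castSucc + (Z * B₁ s - B₁ s * Z))
    (h₂ : ∀ s, c₂ s.succ = c₂ s.castSucc + (Z * B₂ s - B₂ s * Z)) :
    c₁ (Fin.last k) = c₁ 0 + (Z * (∑ s, B₁ s) - (∑ s, B₁ s) * Z) ∧
    c₂ (Fin.last k) = c₂ 0 + (Z * (∑ s, B₂ s) - (∑ s, B₂ s) * Z) ∧
    ∑ s, chainForm Z (c₁ s.castSucc) (c₂ s.castSucc) (B₁ s) (B₂ s)
      = chainForm Z (c₁ 0) (c₂ 0) (∑ s, B₁ s) (∑ s, B₂ s) := by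
  induction k with
  | zero => simp [chainForm]
  | succ k ih =>
    obtain ⟨i1, i2, i3⟩ := ih (fun s => c₁ s.castSucc) (fun s => c₂ s.castSucc)
      (fun s => B₁ s.castSucc) (fun s => B₂ s.castSucc)
      (fun s => by rw [← Fin.succ_castSucc, h₁]) (fun s => by rw [← Fin.succ_castSucc, h₂])
    have z : (0 : Fin (k + 1)).castSucc = 0 := rfl
    rw [z] at i1 i2 i3
    have l1 := h₁ (Fin.last k)
    have l2 := h₂ (Fin.last k)
    rw [Fin.succ_last, i1] at l1
    rw [Fin.succ_last, i2] at l2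
    rw [Fin.sum_univ_castSucc B₁, Fin.sum_univ_castSucc B₂, Fin.sum_univ_castSucc, i3, i1, i2,
      chainForm_add, l1, l2]
    refine ⟨?_, ?_, rfl⟩ <;> rw [mul_add, add_mul] <;> abel

end

end Telescope

/-! ### The tadpole bivector in the variables X, Z -/

section TadSide

variable {n : ℕ}

/-- Since Y = Z - X⁻¹, the matrix u is the Z-gradient times Z, and -c is the X-gradient at fixed Z
times X. In these terms F_x = u + XcX⁻¹ and F_y = -c - ZuZ⁻¹; the same c will reappear as F_{x_0} of
the cyclic covector. -/
theorem two_mul_tadBivector {p : TadData n} (hX : IsUnit p.X) (hZ : IsUnit p.Z)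
    (hXY : 1 + p.X * p.Y = p.X * p.Z) (hYX : 1 + p.Y * p.X = p.Z * p.X)
    {l₁ l₂ : TadData n →L[ℂ] ℂ} {u₁ u₂ c₁ c₂ : Matrix (Fin n) (Fin n) ℂ}
    (hb₁ : tadDy l₁ = u₁ * p.Z⁻¹) (hb₂ : tadDy l₂ = u₂ * p.Z⁻¹)
    (ha₁ : tadDx l₁ = -(c₁ * p.X⁻¹) - p.X⁻¹ * tadDy l₁ * p.X⁻¹)
    (ha₂ : tadDx l₂ = -(c₂ * p.X⁻¹) - p.X⁻¹ * tadDy l₂ * p.X⁻¹)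
    (h₁ : TadHorizontal p l₁) (h₂ : TadHorizontal p l₂) :
    2 * tadBivector p l₁ l₂ =
      (((1 + p.W * p.V) * tadDv l₁ * tadDw l₂).trace
        - ((1 + p.V * p.W) * tadDw l₁ * tadDv l₂).trace
        - (((1 + p.W * p.V) * tadDv l₂ * tadDw l₁).trace
          - ((1 + p.V * p.W) * tadDw l₂ * tadDv l₁).trace))
      + (((u₁ + p.X * c₁ * p.X⁻¹ + p.Z * u₁ * p.Z⁻¹) * c₂).trace
        + ((u₁ + p.X * c₁ * p.X⁻¹) * (p.Z * u₂ * p.Z⁻¹)).trace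
        - (p.X * c₁ * p.X⁻¹ * u₂).trace)
      - (((u₂ + p.X * c₂ * p.X⁻¹ + p.Z * u₂ * p.Z⁻¹) * c₁).trace
        + ((u₂ + p.X * c₂ * p.X⁻¹) * (p.Z * u₁ * p.Z⁻¹)).trace
        - (p.X * c₂ * p.X⁻¹ * u₁).trace) := by
  have hXd := (Matrix.isUnit_iff_isUnit_det _).mp hX
  have hZd := (Matrix.isUnit_iff_isUnit_det _).mp hZ
  have hY : p.Y = p.Z - p.X⁻¹ := by rw [TadData.Z]; abel
  have fx : ∀ {l : TadData n →L[ℂ] ℂ} {u c : Matrix (Fin n) (Fin n) ℂ},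
      tadDy l = u * p.Z⁻¹ → tadDx l = -(c * p.X⁻¹) - p.X⁻¹ * tadDy l * p.X⁻¹ →
      tadFx l p = u + p.X * c * p.X⁻¹ := by
    intro l u c hb ha
    rw [tadFx, ha, hb, hY]
    simp only [mul_sub, mul_neg, ← mul_assoc, Matrix.mul_nonsing_inv _ hXd, one_mul,
      Matrix.nonsing_inv_mul_cancel_right _ _ hZd]
    abel
  have fy : ∀ {l : TadData n →L[ℂ] ℂ} {u c : Matrix (Fin n) (Fin n) ℂ},
      tadDy l = u * p.Z⁻¹ → tadDx l = -(c * p.X⁻¹) - p.X⁻¹ * tadDy l * p.X⁻¹ →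
      tadFy l p = -c - p.Z * u * p.Z⁻¹ := by
    intro l u c hb ha
    rw [tadFy, ha, hb, hY]
    simp only [sub_mul, neg_mul, ← mul_assoc, Matrix.nonsing_inv_mul_cancel_right _ _ hXd]
    abel
  have fx₁ := fx hb₁ ha₁
  have fx₂ := fx hb₂ ha₂
  have fy₁ := fy hb₁ ha₁
  have fy₂ := fy hb₂ ha₂
  have g₁ : tadFx l₁ p + tadFy l₁ p = -tadFv l₁ p := eq_neg_of_add_eq_zero_left h₁
  have g₂ : tadFx l₂ p + tadFy l₂ p = -tadFv l₂ p := eq_neg_of_add_eq_zero_left h₂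
  -- By horizontality the terms with F_v add up to a multiple of tr(F_v F_v), which is symmetric in
  -- the two covectors and drops out after antisymmetrisation.
  have sym := Matrix.trace_mul_comm (tadFv l₁ p) (tadFv l₂ p)
  have v1 : (tadFx l₁ p * tadFv l₂ p).trace + (tadFy l₁ p * tadFv l₂ p).trace
      = -(tadFv l₁ p * tadFv l₂ p).trace := by
    rw [← Matrix.trace_add, ← add_mul, g₁, neg_mul, Matrix.trace_neg]
  have v2 : (tadFx l₂ p * tadFv l₁ p).trace + (tadFy l₂ p * tadFv l₁ p).trace
      = -(tadFv l₂ p * tadFv l₁ p).trace := by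
    rw [← Matrix.trace_add, ← add_mul, g₂, neg_mul, Matrix.trace_neg]
  have w : ∀ (b b' c : Matrix (Fin n) (Fin n) ℂ),
      ((p.Z * p.X) * (-(c * p.X⁻¹) - p.X⁻¹ * b * p.X⁻¹) * b').trace
        = -(p.X * c * p.X⁻¹ * (b' * p.Z)).trace - (p.Z * b * p.X⁻¹ * b').trace := by
    intro b b' c
    have : (p.Z * p.X) * (-(c * p.X⁻¹) - p.X⁻¹ * b * p.X⁻¹) * b'
        = -(p.Z * (p.X * c * p.X⁻¹ * b')) - p.Z * b * p.X⁻¹ * b' := by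
      simp only [mul_sub, sub_mul, mul_neg, neg_mul, ← mul_assoc,
        Matrix.mul_nonsing_inv_cancel_right _ _ hXd]
    rw [this, Matrix.trace_sub, Matrix.trace_neg, Matrix.trace_mul_comm p.Z]
    simp only [mul_assoc]
  have w' : ∀ (b b' c : Matrix (Fin n) (Fin n) ℂ),
      ((p.X * p.Z) * b * (-(c * p.X⁻¹) - p.X⁻¹ * b' * p.X⁻¹)).trace
        = -(p.Z * b * c).trace - (p.Z * b * p.X⁻¹ * b').trace := by
    intro b b' c
    have : (p.X * p.Z) * b * (-(c * p.X⁻¹) - p.X⁻¹ * b' * p.X⁻¹)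
        = p.X * (-(p.Z * b * c) - p.Z * b * p.X⁻¹ * b') * p.X⁻¹ := by
      simp only [mul_sub, sub_mul, mul_neg, neg_mul, mul_assoc]
    rw [this, Matrix.trace_mul_cycle, Matrix.nonsing_inv_mul _ hXd, one_mul, Matrix.trace_sub,
      Matrix.trace_neg]
  have x1 := w (tadDy l₁) (tadDy l₂) c₁
  have x2 := w (tadDy l₂) (tadDy l₁) c₂
  have y1 := w' (tadDy l₁) (tadDy l₂) c₂
  have y2 := w' (tadDy l₂) (tadDy l₁) c₁
  rw [← ha₁] at x1 y2
  rw [← ha₂] at x2 y1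
  rw [show tadDy l₂ * p.Z = u₂ by
    rw [hb₂, Matrix.nonsing_inv_mul_cancel_right _ _ hZd]] at x1
  rw [show tadDy l₁ * p.Z = u₁ by
    rw [hb₁, Matrix.nonsing_inv_mul_cancel_right _ _ hZd]] at x2
  rw [show p.Z * tadDy l₁ * c₂ = p.Z * u₁ * p.Z⁻¹ * c₂ by rw [hb₁, ← mul_assoc]] at y1
  rw [show p.Z * tadDy l₂ * c₁ = p.Z * u₂ * p.Z⁻¹ * c₁ by rw [hb₂, ← mul_assoc]] at y2
  have r1 : (tadFx l₁ p * tadFy l₂ p).trace = -((u₁ + p.X * c₁ * p.X⁻¹) * c₂).trace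
      - ((u₁ + p.X * c₁ * p.X⁻¹) * (p.Z * u₂ * p.Z⁻¹)).trace := by
    rw [fx₁, fy₂, mul_sub, mul_neg, Matrix.trace_sub, Matrix.trace_neg]
  have r2 : (tadFx l₂ p * tadFy l₁ p).trace = -((u₂ + p.X * c₂ * p.X⁻¹) * c₁).trace
      - ((u₂ + p.X * c₂ * p.X⁻¹) * (p.Z * u₁ * p.Z⁻¹)).trace := by
    rw [fx₂, fy₁, mul_sub, mul_neg, Matrix.trace_sub, Matrix.trace_neg]
  rw [add_mul _ _ c₂, add_mul _ _ c₁, Matrix.trace_add, Matrix.trace_add, tadBivector, tadPre,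
    tadPre, hXY, hYX]
  linear_combination x1 - x2 - y1 + y2 - r1 + r2 - v1 + v2 + sym

end TadSide

/-! ### The cyclic bivector along the image of ξ -/

section Comparison

variable {n : ℕ}

noncomputable section

/-- The covector `l` at `p` vanishes on the tangent space of the orbit of `p`. -/
def CycHorizontal {m : ℕ} [NeZero m] (p : CycData m n) (l : CycData m n →L[ℂ] ℂ) : Prop :=
  (∀ s, s ≠ 0 → cycFx l p s + cycFy l p (s - 1) = 0) ∧
    cycFx l p 0 + cycFy l p (0 - 1) + cycFv l p = 0

/-- At a vertex s ≠ 0 horizontality gives F_{y_{s-1}} = -F_{x_s}, so the cross term there is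
symmetric and cancels. Only the cross term of y_{m-1} and x_0 survives. -/
theorem two_mul_cycBivector {m : ℕ} [NeZero m] {p : CycData m n} {l₁ l₂ : CycData m n →L[ℂ] ℂ}
    (h₁ : CycHorizontal p l₁) (h₂ : CycHorizontal p l₂) :
    2 * cycBivector p l₁ l₂ =
      (((1 + p.W * p.V) * cycDv l₁ * cycDw l₂).trace
        - ((1 + p.V * p.W) * cycDw l₁ * cycDv l₂).trace
        - (((1 + p.W * p.V) * cycDv l₂ * cycDw l₁).trace
          - ((1 + p.V * p.W) * cycDw l₂ * cycDv l₁).trace))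
      + ∑ s, (((1 + p.Y s * p.X s) * cycDx l₁ s * cycDy l₂ s).trace
          - ((1 + p.X s * p.Y s) * cycDy l₁ s * cycDx l₂ s).trace
          - (((1 + p.Y s * p.X s) * cycDx l₂ s * cycDy l₁ s).trace
            - ((1 + p.X s * p.Y s) * cycDy l₂ s * cycDx l₁ s).trace))
      - ((cycFy l₁ p (0 - 1) * cycFx l₂ p 0).trace - (cycFy l₂ p (0 - 1) * cycFx l₁ p 0).trace) := by
  have hs : ∑ s, (cycFy l₁ p (s - 1) * cycFx l₂ p s).trace
      - ∑ s, (cycFy l₂ p (s - 1) * cycFx l₁ p s).trace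
      = (cycFy l₁ p (0 - 1) * cycFx l₂ p 0).trace
        - (cycFy l₂ p (0 - 1) * cycFx l₁ p 0).trace := by
    rw [← Finset.sum_sub_distrib]
    refine Finset.sum_eq_single 0 (fun s _ hs => ?_) (by simp)
    rw [eq_neg_of_add_eq_zero_right (h₁.1 s hs), eq_neg_of_add_eq_zero_right (h₂.1 s hs), neg_mul,
      neg_mul, Matrix.trace_neg, Matrix.trace_neg, Matrix.trace_mul_comm, sub_self]
  have v : ∀ l l' : CycData m n →L[ℂ] ℂ, CycHorizontal p l →
      (cycFy l p (0 - 1) * cycFv l' p).trace + (cycFx l p 0 * cycFv l' p).trace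
        = -(cycFv l p * cycFv l' p).trace := by
    intro l l' h
    rw [← Matrix.trace_add, ← add_mul, add_comm, eq_neg_of_add_eq_zero_left h.2, neg_mul,
      Matrix.trace_neg]
  have v1 := v l₁ l₂ h₁
  have v2 := v l₂ l₁ h₂
  have sym := Matrix.trace_mul_comm (cycFv l₁ p) (cycFv l₂ p)
  rw [cycBivector, cycPre, cycPre]
  simp only [Finset.sum_sub_distrib]
  linear_combination -hs - v1 + v2 + sym

/-- The differential of `ξ` on linear data. -/
def xiDeriv {m : ℕ} (q : Fin m → ℂ) (p δ : TadData n) : CycData m n :=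
  (fun s => if s.val + 1 = m then δ.X else 0,
    fun s => if s.val + 1 = m then
      tpart q s • (p.X⁻¹ * (δ.Y - p.X⁻¹ * δ.X * p.X⁻¹) - p.X⁻¹ * δ.X * p.X⁻¹ * p.Z)
        + p.X⁻¹ * δ.X * p.X⁻¹
      else tpart q s • (δ.Y - p.X⁻¹ * δ.X * p.X⁻¹),
    p.X⁻¹ * p.Z⁻¹ * δ.V - (p.X⁻¹ * δ.X * p.X⁻¹ * p.Z⁻¹
      + p.X⁻¹ * p.Z⁻¹ * (δ.Y - p.X⁻¹ * δ.X * p.X⁻¹) * p.Z⁻¹) * p.V,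
    δ.W * p.Z * p.X + p.W * (δ.Y - p.X⁻¹ * δ.X * p.X⁻¹) * p.X + p.W * p.Z * δ.X)

/-- The chain rule for ξ, transposed: cyclicity of the trace moves the variations δX, δY, δV, δW to
the end of each term. -/
theorem tadGradient_pullback {k : ℕ} (q : Fin (k + 1) → ℂ) {p : TadData n}
    {l : CycData (k + 1) n →L[ℂ] ℂ} {l' : TadData n →L[ℂ] ℂ}
    (h : ∀ δ, l' δ = l (xiDeriv q p δ)) :
    tadDx l' = cycDx l (Fin.last k)
        - tpart q (Fin.last k) • (p.X⁻¹ * p.Z * cycDy l (Fin.last k) * p.X⁻¹)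
        + p.X⁻¹ * cycDy l (Fin.last k) * p.X⁻¹
        - p.X⁻¹ * p.Z⁻¹ * p.V * cycDv l * p.X⁻¹ + cycDw l * p.W * p.Z
        - p.X⁻¹ * (∑ s : Fin k, tpart q s.castSucc • cycDy l s.castSucc
          + tpart q (Fin.last k) • (cycDy l (Fin.last k) * p.X⁻¹)
          - p.Z⁻¹ * p.V * cycDv l * p.X⁻¹ * p.Z⁻¹ + p.X * cycDw l * p.W) * p.X⁻¹ ∧
    tadDy l' = ∑ s : Fin k, tpart q s.castSucc • cycDy l s.castSucc
        + tpart q (Fin.last k) • (cycDy l (Fin.last k) * p.X⁻¹)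
        - p.Z⁻¹ * p.V * cycDv l * p.X⁻¹ * p.Z⁻¹ + p.X * cycDw l * p.W ∧
    tadDv l' = cycDv l * p.X⁻¹ * p.Z⁻¹ ∧ tadDw l' = p.Z * p.X * cycDw l := by
  refine tadGradient_eq fun δ => ?_
  rw [h, cycCovector_apply, Fin.sum_univ_castSucc, Fin.sum_univ_castSucc]
  have hne : ∀ s : Fin k, ¬ ((s.castSucc : Fin (k + 1)).val + 1 = k + 1) := fun s => by
    have := s.isLt; simp only [Fin.val_castSucc]; omega
  have hl : (Fin.last k).val + 1 = k + 1 := by simp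
  -- ζ is the variation of Z = Y + X⁻¹. All entries of the differential of ξ are simpler in (δX, ζ),
  -- so δY is eliminated in its favour.
  obtain ⟨ζ, hζ⟩ : ∃ ζ, ζ = δ.Y - p.X⁻¹ * δ.X * p.X⁻¹ := ⟨_, rfl⟩
  have hY : δ.Y = ζ + p.X⁻¹ * δ.X * p.X⁻¹ := by rw [hζ]; abel
  obtain ⟨S, hS⟩ : ∃ S, S = ∑ s : Fin k, tpart q s.castSucc • cycDy l s.castSucc := ⟨_, rfl⟩
  have x1 : ∀ s : Fin k, (xiDeriv q p δ).X s.castSucc = 0 := fun s => if_neg (hne s)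
  have x2 : (xiDeriv q p δ).X (Fin.last k) = δ.X := if_pos hl
  have y1 : ∀ s : Fin k, (xiDeriv q p δ).Y s.castSucc = tpart q s.castSucc • ζ := fun s => by
    rw [hζ]; exact if_neg (hne s)
  have y2 : (xiDeriv q p δ).Y (Fin.last k) = tpart q (Fin.last k) •
      (p.X⁻¹ * ζ - p.X⁻¹ * δ.X * p.X⁻¹ * p.Z) + p.X⁻¹ * δ.X * p.X⁻¹ := by
    rw [hζ]; exact if_pos hl
  have y3 : ∑ s : Fin k, (cycDy l s.castSucc * (xiDeriv q p δ).Y s.castSucc).trace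
      = (S * ζ).trace := by
    rw [hS, Finset.sum_mul, Matrix.trace_sum]
    refine Finset.sum_congr rfl fun s _ => ?_
    rw [y1, mul_smul_comm, smul_mul_assoc]
  have v1 : (xiDeriv q p δ).V = p.X⁻¹ * p.Z⁻¹ * δ.V - (p.X⁻¹ * δ.X * p.X⁻¹ * p.Z⁻¹
      + p.X⁻¹ * p.Z⁻¹ * ζ * p.Z⁻¹) * p.V := by rw [hζ]; rfl
  have w1 : (xiDeriv q p δ).W = δ.W * p.Z * p.X + p.W * ζ * p.X + p.W * p.Z * δ.X := by
    rw [hζ]; rfl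
  rw [y3, v1, w1, x2, y2, hY, ← hS]
  simp only [x1, mul_zero, Matrix.trace_zero, Finset.sum_const_zero, zero_add]
  set a := cycDx l (Fin.last k)
  set b := cycDy l (Fin.last k)
  set v := cycDv l
  set w := cycDw l
  set t := tpart q (Fin.last k)
  have e1 := Matrix.trace_mul_cycle (b * p.X⁻¹) δ.X (p.X⁻¹ * p.Z)
  have e2 := Matrix.trace_mul_cycle (b * p.X⁻¹) δ.X p.X⁻¹
  have e3 := Matrix.trace_mul_cycle (v * p.X⁻¹) δ.X (p.X⁻¹ * p.Z⁻¹ * p.V)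
  have e4 := Matrix.trace_mul_cycle (v * p.X⁻¹ * p.Z⁻¹) ζ (p.Z⁻¹ * p.V)
  have e5 := Matrix.trace_mul_cycle w δ.W (p.Z * p.X)
  have e6 := Matrix.trace_mul_cycle (w * p.W) ζ p.X
  have f1 := Matrix.trace_mul_cycle S (p.X⁻¹ * δ.X) p.X⁻¹
  have f2 := Matrix.trace_mul_cycle (b * p.X⁻¹) (p.X⁻¹ * δ.X) p.X⁻¹
  have f3 := Matrix.trace_mul_cycle (p.Z⁻¹ * p.V * v * p.X⁻¹ * p.Z⁻¹) (p.X⁻¹ * δ.X) p.X⁻¹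
  have f4 := Matrix.trace_mul_cycle (p.X * w * p.W) (p.X⁻¹ * δ.X) p.X⁻¹
  simp only [Matrix.mul_add, Matrix.add_mul, Matrix.mul_sub, Matrix.sub_mul, Matrix.trace_add,
    Matrix.trace_sub, Matrix.mul_smul, Matrix.smul_mul, Matrix.trace_smul, smul_eq_mul, smul_sub,
    Matrix.mul_assoc] at *
  linear_combination -t * e1 + e2 - e3 - e4 + e5 + e6 - f1 - t * f2 + f3 - f4

/-- The identity behind the comparison of the two bivectors. -/
theorem chainForm_eq {Z : Matrix (Fin n) (Fin n) ℂ} (hZ : IsUnit Z)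
    {c₁ c₂ γ₁ γ₂ K₁ K₂ u₁ u₂ : Matrix (Fin n) (Fin n) ℂ} (hu₁ : u₁ = Z * γ₁ + c₁ - K₁)
    (hu₂ : u₂ = Z * γ₂ + c₂ - K₂) :
    ((u₁ + K₁ + Z * u₁ * Z⁻¹) * c₂).trace + ((u₁ + K₁) * (Z * u₂ * Z⁻¹)).trace
          - (K₁ * u₂).trace
        - (((u₂ + K₂ + Z * u₂ * Z⁻¹) * c₁).trace + ((u₂ + K₂) * (Z * u₁ * Z⁻¹)).trace
          - (K₂ * u₁).trace)
      = chainForm Z c₁ c₂ γ₁ γ₂ - (-((c₁ + (Z * γ₁ - γ₁ * Z)) * K₂).trace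
          - -((c₂ + (Z * γ₂ - γ₂ * Z)) * K₁).trace) := by
  have hZd := (Matrix.isUnit_iff_isUnit_det _).mp hZ
  have k1 : u₁ + K₁ = Z * γ₁ + c₁ := by rw [hu₁]; abel
  have k2 : u₂ + K₂ = Z * γ₂ + c₂ := by rw [hu₂]; abel
  have z : ∀ γ u : Matrix (Fin n) (Fin n) ℂ,
      (Z * γ * (Z * u * Z⁻¹)).trace = (γ * Z * u).trace := by
    intro γ u
    have : Z * γ * (Z * u * Z⁻¹) = Z * (γ * Z * u) * Z⁻¹ := by
      simp only [mul_assoc]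
    rw [this, Matrix.trace_mul_cycle, Matrix.nonsing_inv_mul _ hZd, one_mul]
  have z1 := z γ₁ u₂
  have z2 := z γ₂ u₁
  -- The inverse of Z enters only through Q = ZuZ⁻¹, about which `z1` and `z2` say all that is
  -- needed. With Q opaque the claim is polynomial, up to cyclicity of the trace.
  obtain ⟨Q₁, hQ₁⟩ : ∃ Q, Q = Z * u₁ * Z⁻¹ := ⟨_, rfl⟩
  obtain ⟨Q₂, hQ₂⟩ : ∃ Q, Q = Z * u₂ * Z⁻¹ := ⟨_, rfl⟩
  rw [← hQ₂] at z1
  rw [← hQ₁] at z2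
  rw [k1, k2, ← hQ₁, ← hQ₂]
  clear hQ₁ hQ₂ k1 k2 z
  subst hu₁ hu₂
  have m1 := Matrix.trace_mul_comm c₁ Q₂
  have m2 := Matrix.trace_mul_comm c₂ Q₁
  have m3 := Matrix.trace_mul_comm c₁ c₂
  have m4 := Matrix.trace_mul_comm K₁ K₂
  have m5 := Matrix.trace_mul_comm c₁ K₂
  have m6 := Matrix.trace_mul_comm c₂ K₁
  have m7 := Matrix.trace_mul_comm (Z * γ₁) K₂
  have m8 := Matrix.trace_mul_comm (Z * γ₂) K₁
  have m9 := Matrix.trace_mul_comm (γ₁ * Z * Z) γ₂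
  have m10 := Matrix.trace_mul_comm (γ₂ * Z * Z) γ₁
  have m11 := Matrix.trace_mul_comm (γ₁ * γ₂) (Z * Z)
  have m12 := Matrix.trace_mul_comm (γ₂ * γ₁) (Z * Z)
  simp only [chainForm, mul_add, add_mul, mul_sub, sub_mul, Matrix.trace_add, Matrix.trace_sub,
    mul_assoc] at *
  grind

/-- `ξ` matches the bivectors on horizontal covectors. -/
theorem cycBivector_xiData {k : ℕ} {q : Fin (k + 1) → ℂ} (hq : ∀ i, q i ≠ 0) {p : TadData n}
    (hX : IsUnit p.X) (hZ : IsUnit p.Z)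
    (hXY : 1 + p.X * p.Y = p.X * p.Z) (hYX : 1 + p.Y * p.X = p.Z * p.X)
    {l₁ l₂ : CycData (k + 1) n →L[ℂ] ℂ} {l₁' l₂' : TadData n →L[ℂ] ℂ}
    (h₁ : ∀ δ, l₁' δ = l₁ (xiDeriv q p δ)) (h₂ : ∀ δ, l₂' δ = l₂ (xiDeriv q p δ))
    (hl₁ : CycHorizontal (xiData q p) l₁) (hl₂ : CycHorizontal (xiData q p) l₂)
    (hl₁' : TadHorizontal p l₁') (hl₂' : TadHorizontal p l₂') :
    cycBivector (xiData q p) l₁ l₂ = tadBivector p l₁' l₂' := by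
  have hXd := (Matrix.isUnit_iff_isUnit_det _).mp hX
  have hZd := (Matrix.isUnit_iff_isUnit_det _).mp hZ
  set P := xiData q p with hP
  have hne : ∀ s : Fin k, ¬ ((s.castSucc : Fin (k + 1)).val + 1 = k + 1) := fun s => by
    have := s.isLt; simp only [Fin.val_castSucc]; omega
  have hlast : (Fin.last k).val + 1 = k + 1 := by simp
  have hz : (0 - 1 : Fin (k + 1)) = Fin.last k :=
    Fin.ext (by have := val_zero_sub_one (m := k + 1); simp only [Fin.val_last]; omega)
  have hPX : ∀ s : Fin k, P.X s.castSucc = 1 := fun s => if_neg (hne s)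
  have hPXl : P.X (Fin.last k) = p.X := if_pos hlast
  have hPXu : ∀ s, IsUnit (P.X s) := by
    intro s
    cases s using Fin.lastCases with
    | last => rw [hPXl]; exact hX
    | cast s => rw [hPX]; exact isUnit_one
  have hPY : ∀ s, P.Y s = (P.X s)⁻¹ * (tpart q s • p.Z - 1) := by
    intro s
    rw [mul_sub, mul_one, mul_smul_comm]
    cases s using Fin.lastCases with
    | last =>
      change xiZ q p (Fin.last k) - (P.X (Fin.last k))⁻¹ = _
      rw [hPXl, xiZ, if_pos hlast]
    | cast s =>
      change xiZ q p s.castSucc - (P.X s.castSucc)⁻¹ = _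
      rw [hPX, xiZ, if_neg (hne s), inv_one, one_mul]
  have block : ∀ s, _ := fun s => chainForm_block (X := P.X s) (Y := P.Y s) (Z := p.Z)
    (a₁ := cycDx l₁ s) (b₁ := cycDy l₁ s) (a₂ := cycDx l₂ s) (b₂ := cycDy l₂ s)
    (tpart_ne_zero hq s) (hPXu s) (hPY s)
  -- the moment map contributions at the two ends of an arrow
  have hF : ∀ (l : CycData (k + 1) n →L[ℂ] ℂ) (s : Fin (k + 1)), P.X s * cycFy l P s * (P.X s)⁻¹
      = -(cycFx l P s + (p.Z * (tpart q s • (cycDy l s * (P.X s)⁻¹))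
        - (tpart q s • (cycDy l s * (P.X s)⁻¹)) * p.Z)) := by
    intro l s
    have hd := (Matrix.isUnit_iff_isUnit_det _).mp (hPXu s)
    rw [cycFy, cycFx, hPY]
    simp only [mul_sub, sub_mul, ← mul_assoc, Matrix.mul_nonsing_inv _ hd, mul_one, one_mul,
      Matrix.mul_nonsing_inv_cancel_right _ _ hd, mul_smul_comm, smul_mul_assoc]
    abel
  -- `B l s` is the gradient of `l` at the arrow s with respect to the common matrix Z. The family
  -- `c l` consists of F_{x_s} at the start of each arrow, extended past the last arrow by -X
  -- F_{y_{m-1}} X⁻¹.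
  set B : (CycData (k + 1) n →L[ℂ] ℂ) → Fin (k + 1) → Matrix (Fin n) (Fin n) ℂ :=
    fun l s => tpart q s • (cycDy l s * (P.X s)⁻¹) with hB
  set c : (CycData (k + 1) n →L[ℂ] ℂ) → Fin (k + 2) → Matrix (Fin n) (Fin n) ℂ :=
    fun l => Fin.snoc (α := fun _ => Matrix (Fin n) (Fin n) ℂ) (fun s => cycFx l P s)
      (-(p.X * cycFy l P (Fin.last k) * p.X⁻¹)) with hc
  have hcs : ∀ l (s : Fin (k + 1)), c l s.castSucc = cycFx l P s := fun l s => by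
    simp only [hc, Fin.snoc_castSucc]
  have hcl : ∀ l, c l (Fin.last (k + 1)) = -(p.X * cycFy l P (Fin.last k) * p.X⁻¹) := fun l => by
    simp only [hc, Fin.snoc_last]
  -- `hF` compares the two ends of an arrow, and horizontality identifies -F_{y_s} with F_{x_{s+1}}.
  -- Together they give the recursion required by `chainForm_sum`.
  have hrec : ∀ l, CycHorizontal P l → ∀ s, c l s.succ = c l s.castSucc
      + (p.Z * B l s - B l s * p.Z) := by
    intro l hl s
    have h := hF l s
    rw [hcs]
    cases s using Fin.lastCases with
    | last =>
      rw [hPXl] at h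
      rw [Fin.succ_last, hcl, h, hB, neg_neg]
      simp only [hPXl]
    | cast s =>
      have hs := hl.1 s.succ (Fin.succ_ne_zero s)
      have e : s.succ - 1 = s.castSucc := by
        apply Fin.ext
        have := val_sub_one (Fin.succ_ne_zero s)
        simp only [Fin.val_succ, Fin.val_castSucc] at this ⊢
        omega
      rw [hPX, inv_one, one_mul, mul_one] at h
      rw [e, h] at hs
      rw [Fin.succ_castSucc, hcs, eq_neg_of_add_eq_zero_left hs, neg_neg, hB]
      simp only [hPX, inv_one]
  obtain ⟨s1, s2, s3⟩ := chainForm_sum p.Z (k + 1) (c l₁) (c l₂) (B l₁) (B l₂) (hrec l₁ hl₁)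
    (hrec l₂ hl₂)
  have c0 : ∀ l, c l 0 = cycFx l P 0 := fun l => hcs l 0
  rw [hcl, c0] at s1 s2
  rw [c0, c0] at s3
  -- The pulled-back covector has the shape expected by `two_mul_tadBivector`, with c = F_{x_0} and
  -- u = Z ∑B + c - XcX⁻¹. Horizontality at the vertex 0 is used to express F_v by the ends of the
  -- chain.
  have key : ∀ (l : CycData (k + 1) n →L[ℂ] ℂ) (l' : TadData n →L[ℂ] ℂ),
      (∀ δ, l' δ = l (xiDeriv q p δ)) → CycHorizontal P l →
      (-(p.X * cycFy l P (Fin.last k) * p.X⁻¹)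
        = cycFx l P 0 + (p.Z * (∑ s, B l s) - (∑ s, B l s) * p.Z)) →
      tadDy l' = (p.Z * (∑ s, B l s) + cycFx l P 0 - p.X * cycFx l P 0 * p.X⁻¹) * p.Z⁻¹ ∧
      tadDx l' = -(cycFx l P 0 * p.X⁻¹) - p.X⁻¹ * tadDy l' * p.X⁻¹ ∧
      tadDv l' = cycDv l * p.X⁻¹ * p.Z⁻¹ ∧ tadDw l' = p.Z * p.X * cycDw l := by
    intro l l' h hl hs
    obtain ⟨g1, g2, g3, g4⟩ := tadGradient_pullback q h
    have hv : cycFv l P = cycDw l * p.W * p.Z * p.X - p.X⁻¹ * p.Z⁻¹ * p.V * cycDv l := by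
      change cycDw l * (p.W * p.Z * p.X) - p.X⁻¹ * p.Z⁻¹ * p.V * cycDv l = _
      simp only [Matrix.mul_assoc]
    have hv2 : cycFv l P = -(cycFx l P 0 + cycFy l P (Fin.last k)) := by
      rw [← hz]; exact eq_neg_of_add_eq_zero_right hl.2
    have hβ : ∑ s : Fin k, tpart q s.castSucc • cycDy l s.castSucc
        + tpart q (Fin.last k) • (cycDy l (Fin.last k) * p.X⁻¹) = ∑ s, B l s := by
      rw [Fin.sum_univ_castSucc, hB]
      simp only [hPX, hPXl, inv_one, mul_one]
    rw [← g2] at g1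
    rw [hβ] at g2
    refine ⟨?_, ?_, g3, g4⟩
    · have e : ∑ s, B l s - p.Z⁻¹ * p.V * cycDv l * p.X⁻¹ * p.Z⁻¹ + p.X * cycDw l * p.W
          = (∑ s, B l s) + p.X * cycFv l P * p.X⁻¹ * p.Z⁻¹ := by
        rw [hv]
        simp only [mul_sub, sub_mul, ← Matrix.mul_assoc, Matrix.mul_nonsing_inv _ hXd,
          Matrix.one_mul, Matrix.mul_nonsing_inv_cancel_right _ _ hXd,
          Matrix.mul_nonsing_inv_cancel_right _ _ hZd]
        abel
      have e2 : (∑ s, B l s) + p.X * cycFv l P * p.X⁻¹ * p.Z⁻¹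
          = ((∑ s, B l s) * p.Z + -(p.X * cycFy l P (Fin.last k) * p.X⁻¹)
            - p.X * cycFx l P 0 * p.X⁻¹) * p.Z⁻¹ := by
        rw [hv2, sub_mul, add_mul, Matrix.mul_nonsing_inv_cancel_right _ _ hZd]
        simp only [mul_add, add_mul, mul_neg, neg_mul]
        abel
      rw [g2, e, e2, hs]
      congr 1
      abel
    · have e : cycDx l (Fin.last k)
          - tpart q (Fin.last k) • (p.X⁻¹ * p.Z * cycDy l (Fin.last k) * p.X⁻¹)
          + p.X⁻¹ * cycDy l (Fin.last k) * p.X⁻¹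
          - p.X⁻¹ * p.Z⁻¹ * p.V * cycDv l * p.X⁻¹ + cycDw l * p.W * p.Z
          = (cycFy l P (Fin.last k) + cycFv l P) * p.X⁻¹ := by
        rw [hv, cycFy, hPY, hPXl]
        simp only [add_mul, sub_mul, mul_sub, mul_one, mul_smul_comm, smul_mul_assoc,
          Matrix.mul_nonsing_inv_cancel_right _ _ hXd]
        abel
      rw [g1, e, hv2, neg_add_rev, add_neg_cancel_left, neg_mul]
  obtain ⟨b₁, a₁, v₁, w₁⟩ := key l₁ l₁' h₁ hl₁ s1
  obtain ⟨b₂, a₂, v₂, w₂⟩ := key l₂ l₂' h₂ hl₂ s2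
  have tad := two_mul_tadBivector hX hZ hXY hYX b₁ b₂ a₁ a₂ hl₁' hl₂'
  have cyc := two_mul_cycBivector hl₁ hl₂
  have hsum : ∑ s, (((1 + P.Y s * P.X s) * cycDx l₁ s * cycDy l₂ s).trace
          - ((1 + P.X s * P.Y s) * cycDy l₁ s * cycDx l₂ s).trace
          - (((1 + P.Y s * P.X s) * cycDx l₂ s * cycDy l₁ s).trace
            - ((1 + P.X s * P.Y s) * cycDy l₂ s * cycDx l₁ s).trace))
      = chainForm p.Z (cycFx l₁ P 0) (cycFx l₂ P 0) (∑ s, B l₁ s) (∑ s, B l₂ s) := by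
    rw [← s3]
    refine Finset.sum_congr rfl fun s _ => ?_
    rw [block, hcs, hcs, hB]
    rfl
  have hPV : P.V = p.X⁻¹ * p.Z⁻¹ * p.V := rfl
  have hPW : P.W = p.W * p.Z * p.X := rfl
  have hWV : P.W * P.V = p.W * p.V := by
    rw [hPV, hPW]
    simp only [← Matrix.mul_assoc, Matrix.mul_nonsing_inv_cancel_right _ _ hXd,
      Matrix.mul_nonsing_inv_cancel_right _ _ hZd]
  have vw : ∀ l l' : CycData (k + 1) n →L[ℂ] ℂ,
      ((1 + P.W * P.V) * cycDv l * cycDw l').trace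
        = ((1 + p.W * p.V) * (cycDv l * p.X⁻¹ * p.Z⁻¹) * (p.Z * p.X * cycDw l')).trace := by
    intro l l'
    rw [hWV]
    simp only [← Matrix.mul_assoc, Matrix.nonsing_inv_mul_cancel_right _ _ hXd,
      Matrix.nonsing_inv_mul_cancel_right _ _ hZd]
  have wv : ∀ l l' : CycData (k + 1) n →L[ℂ] ℂ,
      ((1 + P.V * P.W) * cycDw l * cycDv l').trace
        = ((1 + p.V * p.W) * (p.Z * p.X * cycDw l) * (cycDv l' * p.X⁻¹ * p.Z⁻¹)).trace := by
    intro l l'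
    have e : (1 + p.V * p.W) * (p.Z * p.X * cycDw l) * (cycDv l' * p.X⁻¹ * p.Z⁻¹)
        = p.Z * p.X * ((1 + P.V * P.W) * cycDw l * cycDv l') * (p.X⁻¹ * p.Z⁻¹) := by
      rw [hPV, hPW]
      simp only [Matrix.mul_add, Matrix.add_mul, ← Matrix.mul_assoc, Matrix.one_mul,
        Matrix.mul_nonsing_inv_cancel_right _ _ hXd, Matrix.mul_nonsing_inv _ hZd]
    have e' : ∀ M : Matrix (Fin n) (Fin n) ℂ, (p.Z * p.X * M * (p.X⁻¹ * p.Z⁻¹)).trace = M.trace := by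
      intro M
      rw [Matrix.trace_mul_cycle, ← Matrix.mul_assoc, Matrix.nonsing_inv_mul_cancel_right _ _ hZd,
        Matrix.nonsing_inv_mul _ hXd, Matrix.one_mul]
    rw [e, e']
  rw [hsum, vw, vw, wv, wv, hz] at cyc
  rw [v₁, v₂, w₁, w₂] at tad
  have y : ∀ y c d : Matrix (Fin n) (Fin n) ℂ, -(p.X * y * p.X⁻¹) = d →
      (y * c).trace = -(d * (p.X * c * p.X⁻¹)).trace := by
    intro y c d h
    rw [← h, neg_mul, Matrix.trace_neg, neg_neg]
    have : p.X * y * p.X⁻¹ * (p.X * c * p.X⁻¹) = p.X * (y * c) * p.X⁻¹ := by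
      simp only [← mul_assoc, Matrix.nonsing_inv_mul_cancel_right _ _ hXd]
    rw [this, Matrix.trace_mul_cycle, Matrix.nonsing_inv_mul _ hXd, one_mul]
  rw [y _ _ _ s1, y _ _ _ s2] at cyc
  have hd := chainForm_eq hZ (γ₁ := ∑ s, B l₁ s) (γ₂ := ∑ s, B l₂ s) (c₁ := cycFx l₁ P 0)
    (c₂ := cycFx l₂ P 0) (K₁ := p.X * cycFx l₁ P 0 * p.X⁻¹) (K₂ := p.X * cycFx l₂ P 0 * p.X⁻¹)
    rfl rfl
  linear_combination (1/2) * (cyc - tad) - (1/2) * hd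

end
end Comparison

/-! ### Changes of bases and horizontality on the cyclic side -/

section CycGauge

variable {m n : ℕ} [NeZero m]

theorem GL_conj_inv (g : GL (Fin n) ℂ) (M : Matrix (Fin n) (Fin n) ℂ) :
    (g.1 * M * g⁻¹.1)⁻¹ = g.1 * M⁻¹ * g⁻¹.1 := by
  have hg : g.1⁻¹ = g⁻¹.1 := (Matrix.coe_units_inv g).symm
  have hgi : g⁻¹.1⁻¹ = g.1 := by rw [← Matrix.coe_units_inv, inv_inv]
  rw [Matrix.mul_inv_rev, Matrix.mul_inv_rev, hg, hgi, Matrix.mul_assoc]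

theorem cycAct_moment (g : Fin m → GL (Fin n) ℂ) (p : CycData m n) :
    (∀ s, 1 + (cycAct g p).X s * (cycAct g p).Y s
      = (g s).1 * (1 + p.X s * p.Y s) * (g s)⁻¹.1) ∧
    (∀ s, 1 + (cycAct g p).Y s * (cycAct g p).X s
      = (g (s + 1)).1 * (1 + p.Y s * p.X s) * (g (s + 1))⁻¹.1) ∧
    1 + (cycAct g p).V * (cycAct g p).W = (g 0).1 * (1 + p.V * p.W) * (g 0)⁻¹.1 ∧
    (cycAct g p).W * (cycAct g p).V = p.W * p.V := by
  have eX : ∀ s, (cycAct g p).X s = (g s).1 * p.X s * (g (s + 1))⁻¹.1 := fun _ => rfl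
  have eY : ∀ s, (cycAct g p).Y s = (g (s + 1)).1 * p.Y s * (g s)⁻¹.1 := fun _ => rfl
  have eV : (cycAct g p).V = (g 0).1 * p.V := rfl
  have eW : (cycAct g p).W = p.W * (g 0)⁻¹.1 := rfl
  have c' : ∀ s, (g s).1 * (g s)⁻¹.1 = 1 := fun s => (g s).mul_inv
  refine ⟨fun s => ?_, fun s => ?_, ?_, ?_⟩
  · rw [eX, eY]
    simp only [Matrix.mul_add, Matrix.add_mul, Matrix.mul_one, c', Matrix.mul_assoc,
      GL_inv_mul_cancel_left]
  · rw [eX, eY]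
    simp only [Matrix.mul_add, Matrix.add_mul, Matrix.mul_one, c', Matrix.mul_assoc,
      GL_inv_mul_cancel_left]
  · rw [eV, eW]
    simp only [Matrix.mul_add, Matrix.add_mul, Matrix.mul_one, c', Matrix.mul_assoc]
  · rw [eV, eW]
    simp only [Matrix.mul_assoc, GL_inv_mul_cancel_left]

theorem cycAct_mem {q : Fin m → ℂ} (g : Fin m → GL (Fin n) ℂ) {p : CycData m n}
    (hp : p ∈ cycRep m n q) : cycAct g p ∈ cycRep m n q := by
  obtain ⟨h1, h2, h3, h4, h5, h6, hX⟩ := hp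
  obtain ⟨eXY, eYX, eVW, eWV⟩ := cycAct_moment g p
  have c' : ∀ s, (g s).1 * (g s)⁻¹.1 = 1 := fun s => (g s).mul_inv
  refine ⟨fun s => ⟨?_, ?_⟩, ?_, ?_, fun i hi => ?_, ?_, ?_, fun s => ?_⟩
  · rw [eXY]; exact ((g s).isUnit.mul (h1 s).1).mul (g s)⁻¹.isUnit
  · rw [eYX]; exact ((g _).isUnit.mul (h1 s).2).mul (g _)⁻¹.isUnit
  · rw [eVW]; exact ((g 0).isUnit.mul h2).mul (g 0)⁻¹.isUnit
  · rw [eWV]; exact h3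
  · rw [eXY, eYX, GL_conj_inv, sub_add_cancel]
    calc _ = (g i).1 * ((1 + p.Y (i - 1) * p.X (i - 1))⁻¹ * (1 + p.X i * p.Y i)) * (g i)⁻¹.1 := by
          simp only [Matrix.mul_assoc, GL_inv_mul_cancel_left]
      _ = _ := by rw [h4 i hi, mul_smul_comm, smul_mul_assoc, mul_one, c']
  · rw [eXY, eYX, eVW, GL_conj_inv, sub_add_cancel]
    calc _ = (g 0).1 * ((1 + p.Y (0 - 1) * p.X (0 - 1))⁻¹ * (1 + p.X 0 * p.Y 0)
            * (1 + p.V * p.W)) * (g 0)⁻¹.1 := by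
          simp only [Matrix.mul_assoc, GL_inv_mul_cancel_left]
      _ = _ := by rw [h5, mul_smul_comm, smul_mul_assoc, mul_one, c']
  · rw [eWV]; exact h6
  · exact ((g s).isUnit.mul (hX s)).mul (g _)⁻¹.isUnit

/-- The value of `l` on the infinitesimal action of (h_s) is a sum over the vertices of trace
pairings with h_s; families supported at a single vertex separate the conditions. -/
theorem cycHorizontal_of_forall {p : CycData m n} {l : CycData m n →L[ℂ] ℂ}
    (hl : ∀ h : Fin m → Matrix (Fin n) (Fin n) ℂ,
      l (fun s => h s * p.X s - p.X s * h (s + 1), fun s => h (s + 1) * p.Y s - p.Y s * h s,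
        h 0 * p.V, -(p.W * h 0)) = 0) : CycHorizontal p l := by
  have key : ∀ h : Fin m → Matrix (Fin n) (Fin n) ℂ,
      ∑ s, ((cycFx l p s + cycFy l p (s - 1)) * h s).trace + (cycFv l p * h 0).trace = 0 := by
    intro h
    have h1 := hl h
    rw [cycCovector_apply] at h1
    change ∑ s, (cycDx l s * (h s * p.X s - p.X s * h (s + 1))).trace
      + ∑ s, (cycDy l s * (h (s + 1) * p.Y s - p.Y s * h s)).trace
      + (cycDv l * (h 0 * p.V)).trace + (cycDw l * -(p.W * h 0)).trace = 0 at h1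
    have h2 : ∑ s, (cycFy l p (s - 1) * h s).trace = ∑ s, (cycFy l p s * h (s + 1)).trace := by
      rw [← Equiv.sum_comp (Equiv.addRight (1 : Fin m))]
      simp
    have a1 : ∀ s, (cycDx l s * (h s * p.X s - p.X s * h (s + 1))).trace
        = (p.X s * cycDx l s * h s).trace - (cycDx l s * p.X s * h (s + 1)).trace := by
      intro s
      rw [mul_sub, Matrix.trace_sub, ← mul_assoc, ← mul_assoc, Matrix.trace_mul_cycle]
    have a2 : ∀ s, (cycDy l s * (h (s + 1) * p.Y s - p.Y s * h s)).trace
        = (p.Y s * cycDy l s * h (s + 1)).trace - (cycDy l s * p.Y s * h s).trace := by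
      intro s
      rw [mul_sub, Matrix.trace_sub, ← mul_assoc, ← mul_assoc, Matrix.trace_mul_cycle]
    have a3 : (cycDv l * (h 0 * p.V)).trace = (p.V * cycDv l * h 0).trace := by
      rw [← Matrix.mul_assoc, Matrix.trace_mul_cycle]
    have a4 : (cycDw l * -(p.W * h 0)).trace = -(cycDw l * p.W * h 0).trace := by
      rw [Matrix.mul_neg, Matrix.trace_neg, Matrix.mul_assoc]
    simp only [a1, a2, a3, a4, Finset.sum_sub_distrib] at h1
    simp only [add_mul, Matrix.trace_add, Finset.sum_add_distrib, h2]
    simp only [cycFx, cycFy, cycFv, sub_mul, Matrix.trace_sub, Finset.sum_sub_distrib]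
    linear_combination -h1
  refine ⟨fun s hs => Matrix.ext_iff_trace_mul_right.mpr fun M => ?_,
    Matrix.ext_iff_trace_mul_right.mpr fun M => ?_⟩
  · have := key (Pi.single s M)
    rw [Finset.sum_eq_single s (fun r _ hr => by rw [Pi.single_eq_of_ne hr]; simp) (by simp),
      Pi.single_eq_same, Pi.single_eq_of_ne hs.symm] at this
    simpa using this
  · have := key (Pi.single 0 M)
    rw [Finset.sum_eq_single 0 (fun r _ hr => by rw [Pi.single_eq_of_ne hr]; simp) (by simp),
      Pi.single_eq_same, ← Matrix.trace_add, ← add_mul] at this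
    rw [this]; simp

theorem cycHorizontal_of_lift {q : Fin m → ℂ} {f : CycSpace m n q → ℂ} {p : cycRep m n q}
    {F : CycData m n → ℂ} (hF : IsLiftAt f p F) : CycHorizontal p.1 (fderiv ℂ F p.1) := by
  refine cycHorizontal_of_forall fun h => ?_
  rw [isLiftAt_iff] at hF
  have hg : ∀ r, HasDerivAt (fun s : ℂ => 1 + s • h r) (h r) 0 := fun r => hasDerivAt_line 1 (h r)
  have hu0 : ∀ r, IsUnit (1 + (0 : ℂ) • h r) := by simp
  have hgi : ∀ r, HasDerivAt (fun s : ℂ => (1 + s • h r)⁻¹) (-h r) 0 := by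
    intro r
    have := hasDerivAt_matInv (hg r) (hu0 r)
    simpa only [zero_smul, add_zero, inv_one, one_mul, mul_one] using this
  let γ : ℂ → CycData m n := fun s =>
    (fun r => (1 + s • h r) * p.1.X r * (1 + s • h (r + 1))⁻¹,
      fun r => (1 + s • h (r + 1)) * p.1.Y r * (1 + s • h r)⁻¹,
      (1 + s • h 0) * p.1.V, p.1.W * (1 + s • h 0)⁻¹)
  have hγ0 : γ 0 = p.1 := by simp [γ]
  have hconj : ∀ (M : Matrix (Fin n) (Fin n) ℂ) (r r' : Fin m),
      HasDerivAt (fun s : ℂ => (1 + s • h r) * M * (1 + s • h r')⁻¹) (h r * M - M * h r') 0 := by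
    intro M r r'
    have := hasDerivAt_matMul (hasDerivAt_matMul (hg r) (hasDerivAt_const 0 M)) (hgi r')
    simpa [sub_eq_add_neg] using this
  have hγ : HasDerivAt γ (fun s => h s * p.1.X s - p.1.X s * h (s + 1),
      fun s => h (s + 1) * p.1.Y s - p.1.Y s * h s, h 0 * p.1.V, -(p.1.W * h 0)) 0 := by
    refine (hasDerivAt_pi.mpr fun r => hconj _ _ _).prodMk
      ((hasDerivAt_pi.mpr fun r => hconj _ _ _).prodMk (HasDerivAt.prodMk ?_ ?_))
    · have := hasDerivAt_matMul (hg 0) (hasDerivAt_const 0 p.1.V)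
      rw [Matrix.mul_zero, add_zero] at this
      exact this
    · have := hasDerivAt_matMul (hasDerivAt_const 0 p.1.W) (hgi 0)
      rw [Matrix.zero_mul, zero_add, Matrix.mul_neg] at this
      exact this
  refine fderiv_apply_eq hF.1 hγ0 hγ ?_
  refine (hasDerivAt_const (0 : ℂ) (f (Quotient.mk _ p))).congr_of_eventuallyEq ?_
  have hc := hγ.continuousAt
  rw [ContinuousAt, hγ0] at hc
  filter_upwards [hc.eventually hF.2,
    Filter.eventually_all.mpr fun r => eventually_isUnit (hg r).continuousAt (hu0 r)] with s hs hu
  choose g hg' using hu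
  have e : γ s = cycAct g p.1 := by
    have : ∀ r, (g r)⁻¹.1 = (1 + s • h r)⁻¹ := fun r => by rw [← hg', Matrix.coe_units_inv]
    simp only [γ, cycAct, this, hg']
  rw [hs (e ▸ cycAct_mem g p.2)]
  exact congrArg f (Quotient.sound ⟨g⁻¹, by
    change p.1 = cycAct g⁻¹ (γ s)
    rw [e, ← cycAct_mul, inv_mul_cancel, cycAct_one]⟩)

theorem isLiftAt_comp_cycAct {q : Fin m → ℂ} {f : CycSpace m n q → ℂ} {p p' : cycRep m n q}
    (g : Fin m → GL (Fin n) ℂ) (hg : p'.1 = cycAct g p.1) {F : CycData m n → ℂ}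
    (hF : IsLiftAt f p' F) : IsLiftAt f p (F ∘ cycActL g) :=
  isLiftAt_comp ((cycActL g).analyticAt _) hg.symm
    (fun y hy => ⟨cycAct_mem g hy, congrArg f (Quotient.sound ⟨g⁻¹, by
      change y = cycAct g⁻¹ (cycAct g y)
      rw [← cycAct_mul, inv_mul_cancel, cycAct_one]⟩)⟩) hF

theorem fderiv_comp_cycAct {p p' : CycData m n} (g : Fin m → GL (Fin n) ℂ) (hg : p' = cycAct g p)
    {F : CycData m n → ℂ} (hF : AnalyticAt ℂ F p') :
    fderiv ℂ (F ∘ cycActL g) p = (fderiv ℂ F p').comp (cycActL g) := by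
  subst hg
  exact fderiv_comp_clm (cycActL g) hF

theorem exists_cycLift_of_holomorphicAt {q : Fin m → ℂ} {f : CycSpace m n q → ℂ}
    {p : cycRep m n q} (hf : HolomorphicAt f (Quotient.mk _ p)) :
    ∃ F : CycData m n → ℂ, IsLiftAt f p F := by
  obtain ⟨p', hp', F, hF⟩ := hf
  obtain ⟨g, hg⟩ := Quotient.exact hp'.symm
  exact ⟨_, isLiftAt_comp_cycAct g hg hF⟩

end CycGauge

/-! ### The differential of ξ -/

section XiDifferential

variable {m n : ℕ} (q : Fin m → ℂ)

theorem analyticAt_tadZ {p : TadData n} (hX : IsUnit p.X) :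
    AnalyticAt ℂ (fun p : TadData n => p.Z) p :=
  (analyticAt_tadY p).fun_add (analyticAt_matInv (analyticAt_tadX p) hX)

theorem analyticAt_xiData {p : TadData n} (hX : IsUnit p.X) (hZ : IsUnit p.Z) :
    AnalyticAt ℂ (xiData q) p := by
  have aX := analyticAt_tadX p
  have aXi := analyticAt_matInv aX hX
  have aZ := analyticAt_tadZ hX
  have aZi := analyticAt_matInv aZ hZ
  refine AnalyticAt.prod (f := fun p => fun s => xiX p m s) (analyticAt_pi_iff.mpr fun s => ?_)
    (AnalyticAt.prod (f := fun p => fun s => xiZ q p s - (xiX p m s)⁻¹)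
      (analyticAt_pi_iff.mpr fun s => ?_) (AnalyticAt.prod ?_ ?_))
  · unfold xiX
    split_ifs
    · exact aX
    · exact analyticAt_const
  · unfold xiX xiZ
    split_ifs
    · exact (analyticAt_matMul aXi aZ).fun_const_smul.fun_sub aXi
    · exact aZ.fun_const_smul.fun_sub analyticAt_const
  · exact analyticAt_matMul (analyticAt_matMul aXi aZi) (analyticAt_tadV p)
  · exact analyticAt_matMul (analyticAt_matMul (analyticAt_tadW p) aZ) aX

theorem fderiv_xiData {p : TadData n} (hX : IsUnit p.X) (hZ : IsUnit p.Z) (δ : TadData n) :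
    fderiv ℂ (xiData q) p δ = xiDeriv q p δ := by
  refine fderiv_apply_eq (analyticAt_xiData q hX hZ) (γ := fun s => p + s • δ) (by simp)
    (hasDerivAt_line p δ) ?_
  have dX := hasDerivAt_line p.X δ.X
  have dV := hasDerivAt_line p.V δ.V
  have dW := hasDerivAt_line p.W δ.W
  have dXi : HasDerivAt (fun s : ℂ => (p + s • δ).X⁻¹) (-(p.X⁻¹ * δ.X * p.X⁻¹)) 0 := by
    have := hasDerivAt_matInv dX (by simpa using hX)
    simp only [zero_smul, add_zero] at this
    exact this
  have dZ : HasDerivAt (fun s : ℂ => (p + s • δ).Z) (δ.Y - p.X⁻¹ * δ.X * p.X⁻¹) 0 := by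
    rw [sub_eq_add_neg]
    exact (hasDerivAt_line p.Y δ.Y).fun_add dXi
  have dZi : HasDerivAt (fun s : ℂ => (p + s • δ).Z⁻¹)
      (-(p.Z⁻¹ * (δ.Y - p.X⁻¹ * δ.X * p.X⁻¹) * p.Z⁻¹)) 0 := by
    have := hasDerivAt_matInv dZ (by simpa using hZ)
    simp only [zero_smul, add_zero] at this
    exact this
  refine HasDerivAt.prodMk (hasDerivAt_pi.mpr fun s => ?_) (HasDerivAt.prodMk
    (hasDerivAt_pi.mpr fun s => ?_) (HasDerivAt.prodMk ?_ ?_))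
  · unfold xiX
    split_ifs
    · exact dX
    · exact hasDerivAt_const _ _
  · unfold xiX xiZ
    split_ifs
    · have := ((hasDerivAt_matMul dXi dZ).fun_const_smul (tpart q s)).fun_sub dXi
      simp only [zero_smul, add_zero] at this
      convert this using 1
      rw [sub_neg_eq_add, neg_mul, neg_add_eq_sub]
    · have := (dZ.fun_const_smul (tpart q s)).fun_sub (hasDerivAt_const (0 : ℂ)
        ((1 : Matrix (Fin n) (Fin n) ℂ)⁻¹))
      rw [sub_zero] at this
      exact this
  · have := hasDerivAt_matMul (hasDerivAt_matMul dXi dZi) dV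
    simp only [zero_smul, add_zero] at this
    refine HasDerivAt.congr_deriv this ?_
    simp only [neg_mul, mul_neg, Matrix.add_mul, Matrix.neg_mul, mul_assoc]
    abel
  · have := hasDerivAt_matMul (hasDerivAt_matMul dW dZ) dX
    simp only [zero_smul, add_zero] at this
    refine HasDerivAt.congr_deriv this ?_
    simp only [Matrix.add_mul]

end XiDifferential

/-! ### ξ is a Poisson map -/

section XiPoisson

variable {m n : ℕ} [NeZero m] {q : Fin m → ℂ}

theorem isLiftAt_comp_xiData (hq : ∀ i, q i ≠ 0) {f : CycSpace m n q → ℂ}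
    {p : tadRep n (∏ i, q i)} {F : CycData m n → ℂ}
    (hF : IsLiftAt f ⟨xiData q p.1, xiData_mem hq p.2⟩ F) :
    IsLiftAt (f ∘ xi n q hq) p (F ∘ xiData q) := by
  obtain ⟨hX, hZ, -⟩ := tadRep_units p.2
  exact isLiftAt_comp (analyticAt_xiData q hX hZ) rfl (fun y hy => ⟨xiData_mem hq hy, rfl⟩) hF

theorem fderiv_comp_apply {E E' : Type*} [NormedAddCommGroup E] [NormedSpace ℂ E]
    [NormedAddCommGroup E'] [NormedSpace ℂ E'] {F : E' → ℂ} {φ : E → E'} {x : E}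
    (hF : AnalyticAt ℂ F (φ x)) (hφ : AnalyticAt ℂ φ x) (v : E) :
    fderiv ℂ (F ∘ φ) x v = fderiv ℂ F (φ x) (fderiv ℂ φ x v) := by
  rw [fderiv_comp x hF.differentiableAt hφ.differentiableAt, ContinuousLinearMap.comp_apply]

theorem cycBivector_fderiv_comp_act {p p' : CycData m n} (g : Fin m → GL (Fin n) ℂ)
    (hg : p' = cycAct g p) {F G : CycData m n → ℂ} (hF : AnalyticAt ℂ F p')
    (hG : AnalyticAt ℂ G p') :
    cycBivector p (fderiv ℂ (F ∘ cycActL g) p) (fderiv ℂ (G ∘ cycActL g) p)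
      = cycBivector p' (fderiv ℂ F p') (fderiv ℂ G p') := by
  rw [fderiv_comp_cycAct g hg hF, fderiv_comp_cycAct g hg hG, hg]
  exact cycBivector_comp_act g p _ _

theorem cycBivector_xiData_of_lift (hq : ∀ i, q i ≠ 0) {f g : CycSpace m n q → ℂ}
    {p : tadRep n (∏ i, q i)} {F G : CycData m n → ℂ}
    (hF : IsLiftAt f ⟨xiData q p.1, xiData_mem hq p.2⟩ F)
    (hG : IsLiftAt g ⟨xiData q p.1, xiData_mem hq p.2⟩ G) :
    cycBivector (xiData q p.1) (fderiv ℂ F (xiData q p.1)) (fderiv ℂ G (xiData q p.1))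
      = tadBivector p.1 (fderiv ℂ (F ∘ xiData q) p.1) (fderiv ℂ (G ∘ xiData q) p.1) := by
  obtain ⟨k, rfl⟩ : ∃ k, m = k + 1 := Nat.exists_eq_succ_of_ne_zero (NeZero.ne m)
  have ht0 : (∏ i, q i) ≠ 0 := Finset.prod_ne_zero_iff.mpr fun i _ => hq i
  obtain ⟨hX, hZ, hXY, hYX⟩ := tadRep_units p.2
  have hd : ∀ {F : CycData (k + 1) n → ℂ}, AnalyticAt ℂ F (xiData q p.1) →
      ∀ δ, fderiv ℂ (F ∘ xiData q) p.1 δ = fderiv ℂ F (xiData q p.1) (xiDeriv q p.1 δ) := by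
    intro F hF δ
    exact (fderiv_comp_apply hF (analyticAt_xiData q hX hZ) δ).trans
      (congrArg _ (fderiv_xiData q hX hZ δ))
  have eF := hd hF.1
  have eG := hd hG.1
  have cF := cycHorizontal_of_lift hF
  have cG := cycHorizontal_of_lift hG
  have tF := tadHorizontal_of_lift ht0 (isLiftAt_comp_xiData hq hF)
  have tG := tadHorizontal_of_lift ht0 (isLiftAt_comp_xiData hq hG)
  exact cycBivector_xiData hq hX hZ hXY hYX eF eG cF cG tF tG

/-- Any representative can be moved onto the image of ξ, and lifts there pull back to lifts of one
function on the tadpole space. Independence of all choices is thus inherited from the tadpole, and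
smoothness of the cyclic locus is never invoked. -/
theorem cycHasBracketAt (hq : ∀ i, q i ≠ 0) (ht : ∀ k : ℕ, 0 < k → (∏ i, q i) ^ k ≠ 1)
    {f g : CycSpace m n q → ℂ} {p : tadRep n (∏ i, q i)} {F G : CycData m n → ℂ}
    (hF : IsLiftAt f ⟨xiData q p.1, xiData_mem hq p.2⟩ F)
    (hG : IsLiftAt g ⟨xiData q p.1, xiData_mem hq p.2⟩ G) :
    HasBracketAt cycBivector f g (xi n q hq (Quotient.mk _ p))
      (tadBivector p.1 (fderiv ℂ (F ∘ xiData q) p.1) (fderiv ℂ (G ∘ xiData q) p.1)) := by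
  have ht0 : (∏ i, q i) ≠ 0 := Finset.prod_ne_zero_iff.mpr fun i _ => hq i
  refine ⟨⟨_, rfl, F, hF⟩, ⟨_, rfl, G, hG⟩, fun p' hp' F' G' hF' hG' => ?_⟩
  obtain ⟨g', hg'⟩ := Quotient.exact hp'.symm
  have hF'' := isLiftAt_comp_cycAct g' hg' hF'
  have hG'' := isLiftAt_comp_cycAct g' hg' hG'
  have e := cycBivector_xiData_of_lift hq hF'' hG''
  refine (cycBivector_fderiv_comp_act g' hg' hF'.1 hG'.1).symm.trans ?_
  exact e.trans (tadBivector_lift_eq ht0 ht rfl (isLiftAt_comp_xiData hq hF'')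
    (isLiftAt_comp_xiData hq hG'') (isLiftAt_comp_xiData hq hF) (isLiftAt_comp_xiData hq hG))

theorem xi_isPoissonMap (hq : ∀ i, q i ≠ 0) (ht : ∀ k : ℕ, 0 < k → (∏ i, q i) ^ k ≠ 1) :
    IsPoissonMap tadBivector cycBivector (xi n q hq) := by
  have ht0 : (∏ i, q i) ≠ 0 := Finset.prod_ne_zero_iff.mpr fun i _ => hq i
  rintro ⟨p⟩ f g hf hg
  obtain ⟨F, hF⟩ := exists_cycLift_of_holomorphicAt
    (p := ⟨xiData q p.1, xiData_mem hq p.2⟩) hf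
  obtain ⟨G, hG⟩ := exists_cycLift_of_holomorphicAt
    (p := ⟨xiData q p.1, xiData_mem hq p.2⟩) hg
  exact ⟨_, cycHasBracketAt hq ht hF hG,
    tadHasBracketAt ht0 ht (isLiftAt_comp_xiData hq hF) (isLiftAt_comp_xiData hq hG)⟩

/-- Regular functions are holomorphic. -/
theorem holomorphicAt_of_isRegularFunction {f : CycSpace m n q → ℂ}
    (hf : IsRegularFunction (cycRing m n q) f) (c : CycSpace m n q) : HolomorphicAt f c := by
  obtain ⟨p, rfl⟩ := Quotient.exists_rep c
  suffices h : ∀ φ ∈ cycRing m n q, ∃ F : CycData m n → ℂ, AnalyticAt ℂ F p.1 ∧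
      ∀ p' : cycRep m n q, F p'.1 = φ p' by
    obtain ⟨F, h1, h2⟩ := h _ hf
    exact ⟨p, rfl, F, h1, Filter.Eventually.of_forall h2⟩
  obtain ⟨h1, hVW, hWV, -, -, -, hX⟩ := p.2
  have aX : ∀ s, AnalyticAt ℂ (fun p : CycData m n => p.X s) p.1 := fun s =>
    analyticAt_pi_iff.mp analyticAt_fst s
  have aY : ∀ s, AnalyticAt ℂ (fun p : CycData m n => p.Y s) p.1 := fun s =>
    analyticAt_pi_iff.mp (analyticAt_fst.comp analyticAt_snd) s
  have aV : AnalyticAt ℂ (fun p : CycData m n => p.V) p.1 :=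
    analyticAt_fst.comp (analyticAt_snd.comp analyticAt_snd)
  have aW : AnalyticAt ℂ (fun p : CycData m n => p.W) p.1 :=
    analyticAt_snd.comp (analyticAt_snd.comp analyticAt_snd)
  have entry : ∀ {a b : ℕ} (M : CycData m n → Matrix (Fin a) (Fin b) ℂ), AnalyticAt ℂ M p.1 →
      ∀ φ ∈ entries (fun p : cycRep m n q => M p.1), ∃ F : CycData m n → ℂ, AnalyticAt ℂ F p.1 ∧
        ∀ p' : cycRep m n q, F p'.1 = φ p' := by
    rintro a b M hM φ ⟨i, j, rfl⟩
    exact ⟨fun p => M p i j, analyticAt_matrix.mp hM i j, fun _ => rfl⟩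
  intro φ hφ
  refine Algebra.adjoin_induction (p := fun φ _ => ∃ F : CycData m n → ℂ, AnalyticAt ℂ F p.1 ∧
      ∀ p' : cycRep m n q, F p'.1 = φ p') ?_ ?_ ?_ ?_ hφ
  · rintro φ ((((h | h) | h) | h) | h)
    · obtain ⟨s, h⟩ := Set.mem_iUnion.mp h
      obtain ((((h | h) | h) | h) | h) := h
      · exact entry _ (aX s) φ h
      · exact entry _ (aY s) φ h
      · exact entry (fun p => (p.X s)⁻¹) (analyticAt_matInv (aX s) (hX s)) φ h
      · exact entry (fun p => (1 + p.X s * p.Y s)⁻¹) (analyticAt_matInv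
          (analyticAt_const.fun_add (analyticAt_matMul (aX s) (aY s))) (h1 s).1) φ h
      · exact entry (fun p => (1 + p.Y s * p.X s)⁻¹) (analyticAt_matInv
          (analyticAt_const.fun_add (analyticAt_matMul (aY s) (aX s))) (h1 s).2) φ h
    · exact entry _ aV φ h
    · exact entry _ aW φ h
    · exact entry (fun p => (1 + p.V * p.W)⁻¹) (analyticAt_matInv
          (analyticAt_const.fun_add (analyticAt_matMul aV aW)) hVW) φ h
    · exact entry (fun p => (1 + p.W * p.V)⁻¹) (analyticAt_matInv
          (analyticAt_const.fun_add (analyticAt_matMul aW aV)) hWV) φ h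
  · intro c
    exact ⟨fun _ => c, analyticAt_const, fun _ => rfl⟩
  · rintro φ ψ - - ⟨F, hF, eF⟩ ⟨G, hG, eG⟩
    exact ⟨_, hF.fun_add hG, fun p' => congrArg₂ _ (eF p') (eG p')⟩
  · rintro φ ψ - - ⟨F, hF, eF⟩ ⟨G, hG, eG⟩
    exact ⟨_, hF.fun_mul hG, fun p' => congrArg₂ _ (eF p') (eG p')⟩

end XiPoisson

/-! ### The inverse of `ξ` -/

section Eta

variable {m n : ℕ} [NeZero m]

noncomputable section

/-- `X₀ X₁ ⋯ X_{j-1}`, with indices modulo `m`. -/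
def cycProd (p : CycData m n) : ℕ → Matrix (Fin n) (Fin n) ℂ
  | 0 => 1
  | j + 1 => cycProd p j * p.X (Fin.ofNat m j)

/-- `B` in terms of the linear data for the cyclic quiver. -/
def etaZ (q : Fin m → ℂ) (p : CycData m n) : Matrix (Fin n) (Fin n) ℂ :=
  (q 0)⁻¹ • (1 + p.X 0 * p.Y 0)

/-- The inverse of `ξ` on linear data. -/
def etaData (q : Fin m → ℂ) (p : CycData m n) : TadData n :=
  (cycProd p m, etaZ q p - (cycProd p m)⁻¹, etaZ q p * cycProd p m * p.V,
    p.W * (etaZ q p * cycProd p m)⁻¹)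

theorem etaData_Z (q : Fin m → ℂ) (p : CycData m n) : (etaData q p).Z = etaZ q p :=
  sub_add_cancel _ _

theorem isUnit_cycProd {p : CycData m n} (hX : ∀ s, IsUnit (p.X s)) (j : ℕ) :
    IsUnit (cycProd p j) := by
  induction j with
  | zero => exact isUnit_one
  | succ j ih => exact ih.mul (hX _)

theorem ofNat_val (s : Fin m) : Fin.ofNat m s.val = s :=
  Fin.ext (Nat.mod_eq_of_lt s.isLt)

theorem ofNat_succ (j : ℕ) : Fin.ofNat m (j + 1) = Fin.ofNat m j + 1 := by
  apply Fin.ext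
  simp [Fin.val_add, Fin.ofNat]

theorem ofNat_self : Fin.ofNat m m = 0 := by
  apply Fin.ext
  simp [Fin.ofNat]

theorem val_add_one_of_lt {s : Fin m} (hs : ¬ s.val + 1 = m) : (s + 1).val = s.val + 1 := by
  have := s.isLt
  conv_lhs => rw [← ofNat_val s, ← ofNat_succ]
  exact Nat.mod_eq_of_lt (by omega)

theorem add_one_eq_zero {s : Fin m} (hs : s.val + 1 = m) : s + 1 = 0 := by
  conv_lhs => rw [← ofNat_val s, ← ofNat_succ, hs]
  exact ofNat_self

theorem inv_smul_mat {c : ℂ} (hc : c ≠ 0) {M : Matrix (Fin n) (Fin n) ℂ} (hM : IsUnit M) :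
    (c • M)⁻¹ = c⁻¹ • M⁻¹ := by
  apply Matrix.inv_eq_left_inv
  rw [Matrix.smul_mul, Matrix.mul_smul, smul_smul, inv_mul_cancel₀ hc, one_smul,
    Matrix.nonsing_inv_mul _ ((Matrix.isUnit_iff_isUnit_det _).mp hM)]

/-- After a change of bases, linear data for the cyclic quiver are in the image of `ξ`. -/
theorem exists_cycAct_eq_xiData {q : Fin m → ℂ} (hq : ∀ i, q i ≠ 0) {p : CycData m n}
    (hp : p ∈ cycRep m n q) : ∃ g : Fin m → GL (Fin n) ℂ,
      cycAct g p = xiData q (etaData q p) ∧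
      1 + (cycAct g p).V * (cycAct g p).W = 1 + p.V * p.W ∧
      ∀ s, 1 + (cycAct g p).X s * (cycAct g p).Y s = tpart q s • etaZ q p := by
  have hX := hp.2.2.2.2.2.2
  -- g_s = X_0⋯X_{s-1} turns every X_s with s < m - 1 into the identity and collects the whole
  -- product in the last arrow. As g_0 = 1, V and W do not change.
  let g : Fin m → GL (Fin n) ℂ := fun s => (isUnit_cycProd hX s.val).unit
  have hg : ∀ s, (g s).1 = cycProd p s.val := fun s => rfl
  have g0 : g 0 = 1 := Units.ext rfl
  have c' : ∀ s, (g s).1 * (g s)⁻¹.1 = 1 := fun s => (g s).mul_inv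
  have hstep : ∀ s, (g s).1 * p.X s = cycProd p (s.val + 1) := fun s => by
    rw [hg, cycProd, ofNat_val]
  have eX : ∀ s, (cycAct g p).X s = xiX (etaData q p) m s := by
    intro s
    change (g s).1 * p.X s * (g (s + 1))⁻¹.1 = _
    rw [hstep, xiX]
    split_ifs with h
    · rw [add_one_eq_zero h, g0, inv_one, h]
      exact mul_one _
    · rw [← val_add_one_of_lt h, ← hg, c']
  have eV : (cycAct g p).V = p.V := by
    change (g 0).1 * p.V = _
    rw [g0]; exact Matrix.one_mul _
  have eW : (cycAct g p).W = p.W := by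
    change p.W * (g 0)⁻¹.1 = _
    rw [g0, inv_one]; exact Matrix.mul_one _
  obtain ⟨h1, h2, h3, h4, h5, h6, hX'⟩ := cycAct_mem (q := q) g hp
  -- Where X_{s-1} = 1, the matrices 1 + X_{s-1}Y_{s-1} and 1 + Y_{s-1}X_{s-1} coincide, so the
  -- relation at s multiplies the scalar t_{s-1} by q_s.
  have hxy : ∀ j, ∀ s : Fin m, s.val = j →
      1 + (cycAct g p).X s * (cycAct g p).Y s = tpart q s • etaZ q p := by
    intro j
    induction j with
    | zero =>
      intro s hs
      have : s = 0 := Fin.ext (by simpa using hs)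
      subst this
      rw [(cycAct_moment g p).1, g0, inv_one, tpart_zero, etaZ, smul_smul,
        mul_inv_cancel₀ (hq 0), one_smul]
      exact (mul_one _).trans (one_mul _)
    | succ j ih =>
      intro s hs
      have hs0 : s ≠ 0 := by rintro rfl; simp at hs
      have hv := val_sub_one hs0
      have h := ih (s - 1) (by omega)
      have hX1 : (cycAct g p).X (s - 1) = 1 := by
        rw [eX, xiX, if_neg (by have := s.isLt; omega)]
      have hr := h4 s hs0
      have hd := (Matrix.isUnit_iff_isUnit_det _).mp (h1 (s - 1)).2
      have : 1 + (cycAct g p).X s * (cycAct g p).Y s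
          = q s • (1 + (cycAct g p).Y (s - 1) * (cycAct g p).X (s - 1)) := by
        rw [← Matrix.mul_nonsing_inv_cancel_left _
          (1 + (cycAct g p).X s * (cycAct g p).Y s) hd, hr, mul_smul_comm, mul_one]
      rw [this, hX1, mul_one]
      rw [hX1, one_mul] at h
      rw [h, smul_smul, tpart_step q hs0, mul_comm]
  have hxy' : ∀ s, 1 + (cycAct g p).X s * (cycAct g p).Y s = tpart q s • etaZ q p :=
    fun s => hxy _ s rfl
  refine ⟨g, ?_, by rw [eV, eW], hxy'⟩
  have hA : IsUnit (cycProd p m) := isUnit_cycProd hX m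
  have hAd := (Matrix.isUnit_iff_isUnit_det _).mp hA
  have hZ : IsUnit (etaZ q p) := isUnit_smul_mat (inv_ne_zero (hq 0)) (hp.1 0).1
  have hZd := (Matrix.isUnit_iff_isUnit_det _).mp hZ
  refine Prod.ext (funext eX) (Prod.ext (funext fun s => ?_) (Prod.ext ?_ ?_))
  · have hd := (Matrix.isUnit_iff_isUnit_det _).mp (hX' s)
    have e : (cycAct g p).Y s = ((cycAct g p).X s)⁻¹ * (tpart q s • etaZ q p)
        - ((cycAct g p).X s)⁻¹ := by
      rw [← hxy', mul_add, mul_one, Matrix.nonsing_inv_mul_cancel_left _ _ hd]; abel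
    change (cycAct g p).Y s = xiZ q (etaData q p) s - (xiX (etaData q p) m s)⁻¹
    rw [e, eX]
    congr 1
    rw [xiX, xiZ, etaData_Z]
    split_ifs
    · rw [mul_smul_comm]
    · rw [inv_one, one_mul]
  · change (cycAct g p).V = (cycProd p m)⁻¹ * (etaData q p).Z⁻¹ * (etaZ q p * cycProd p m * p.V)
    rw [eV, etaData_Z]
    simp only [Matrix.mul_assoc, Matrix.nonsing_inv_mul_cancel_left _ _ hZd,
      Matrix.nonsing_inv_mul_cancel_left _ _ hAd]
  · change (cycAct g p).W = p.W * (etaZ q p * cycProd p m)⁻¹ * (etaData q p).Z * cycProd p m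
    rw [eW, etaData_Z, Matrix.mul_inv_rev]
    simp only [← Matrix.mul_assoc, Matrix.nonsing_inv_mul_cancel_right _ _ hZd,
      Matrix.nonsing_inv_mul_cancel_right _ _ hAd]

/-- In the gauge of `exists_cycAct_eq_xiData` the relation at 0 says B(1 + VW) = 1 + Y_{m-1}A, while
1 + AY_{m-1} = tB. Multiplying the former by A on the left gives AB(1 + VW) = tBA, and conjugating 1
+ VW by BA turns this into the tadpole relation. -/
theorem etaData_mem {q : Fin m → ℂ} (hq : ∀ i, q i ≠ 0) {p : CycData m n}
    (hp : p ∈ cycRep m n q) : etaData q p ∈ tadRep n (∏ i, q i) := by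
  obtain ⟨g, hg, hVW, hxy⟩ := exists_cycAct_eq_xiData hq hp
  have ht0 : (∏ i, q i) ≠ 0 := Finset.prod_ne_zero_iff.mpr fun i _ => hq i
  have hA : IsUnit (cycProd p m) := isUnit_cycProd hp.2.2.2.2.2.2 m
  have hAd := (Matrix.isUnit_iff_isUnit_det _).mp hA
  have hZ : IsUnit (etaZ q p) := isUnit_smul_mat (inv_ne_zero (hq 0)) (hp.1 0).1
  have hZd := (Matrix.isUnit_iff_isUnit_det _).mp hZ
  obtain ⟨h1, h2, h3, h4, h5, h6, hX'⟩ := cycAct_mem (q := q) g hp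
  have hl := val_zero_sub_one (m := m)
  have hXl : (cycAct g p).X (0 - 1) = cycProd p m := by
    rw [hg]; exact if_pos hl
  have hl2 := hxy (0 - 1)
  rw [hXl, tpart_last] at hl2
  have hd := (Matrix.isUnit_iff_isUnit_det _).mp (h1 (0 - 1)).2
  have r1 : (1 + p.X 0 * p.Y 0) = q 0 • etaZ q p := by
    rw [etaZ, smul_smul, mul_inv_cancel₀ (hq 0), one_smul]
  have r2 : etaZ q p * (1 + p.V * p.W)
      = 1 + (cycAct g p).Y (0 - 1) * cycProd p m := by
    have e := congrArg (fun M => (1 + (cycAct g p).Y (0 - 1) * (cycAct g p).X (0 - 1)) * M) h5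
    simp only [mul_assoc] at e
    rw [Matrix.mul_nonsing_inv_cancel_left _ _ hd, hVW, hxy 0, tpart_zero, smul_mul_assoc,
      mul_smul_comm, mul_one, hXl] at e
    exact smul_right_injective _ (hq 0) e
  have r3 : cycProd p m * (1 + (cycAct g p).Y (0 - 1) * cycProd p m)
      = (∏ i, q i) • (etaZ q p * cycProd p m) := by
    rw [← smul_mul_assoc, ← hl2]; noncomm_ring
  have rel : cycProd p m * etaZ q p * (1 + p.V * p.W)
      = (∏ i, q i) • (etaZ q p * cycProd p m) := by rw [mul_assoc, r2, r3]
  have hXZ : 1 + (etaData q p).X * (etaData q p).Y = cycProd p m * etaZ q p := by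
    change 1 + cycProd p m * (etaZ q p - (cycProd p m)⁻¹) = _
    rw [mul_sub, Matrix.mul_nonsing_inv _ hAd]; abel
  have hZX : 1 + (etaData q p).Y * (etaData q p).X = etaZ q p * cycProd p m := by
    change 1 + (etaZ q p - (cycProd p m)⁻¹) * cycProd p m = _
    rw [sub_mul, Matrix.nonsing_inv_mul _ hAd]; abel
  refine mem_tadRep_of_moment ht0 ?_ ?_ hA ?_
  · rw [hXZ]; exact hA.mul hZ
  · rw [hZX]; exact hZ.mul hA
  · rw [tadMoment, hXZ, hZX, sub_eq_zero]
    have hK := (Matrix.isUnit_iff_isUnit_det _).mp (hZ.mul hA)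
    have hL := (Matrix.isUnit_iff_isUnit_det _).mp (hA.mul hZ)
    have e : 1 + (etaData q p).V * (etaData q p).W
        = etaZ q p * cycProd p m * (1 + p.V * p.W) * (etaZ q p * cycProd p m)⁻¹ := by
      change 1 + etaZ q p * cycProd p m * p.V * (p.W * (etaZ q p * cycProd p m)⁻¹) = _
      rw [mul_add, add_mul, mul_one, Matrix.mul_nonsing_inv _ hK]
      simp only [Matrix.mul_assoc]
    have e2 : 1 + p.V * p.W
        = (∏ i, q i) • ((cycProd p m * etaZ q p)⁻¹ * (etaZ q p * cycProd p m)) := by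
      rw [← mul_smul_comm, ← rel, Matrix.nonsing_inv_mul_cancel_left _ _ hL]
    rw [e, e2]
    simp only [mul_smul_comm, smul_mul_assoc]
    rw [← mul_assoc (etaZ q p * cycProd p m) _⁻¹, Matrix.mul_nonsing_inv_cancel_right _ _ hK,
      Matrix.nonsing_inv_mul_cancel_right _ _ hL]

theorem cycProd_act (g : Fin m → GL (Fin n) ℂ) (p : CycData m n) (j : ℕ) :
    cycProd (cycAct g p) j = (g 0).1 * cycProd p j * (g (Fin.ofNat m j))⁻¹.1 := by
  induction j with
  | zero =>
    have : Fin.ofNat m 0 = 0 := Fin.ext (by simp)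
    rw [cycProd, cycProd, this, mul_one]
    exact ((g 0).mul_inv).symm
  | succ j ih =>
    rw [cycProd, ih, cycProd, ofNat_succ]
    change (g 0).1 * cycProd p j * (g (Fin.ofNat m j))⁻¹.1
      * ((g (Fin.ofNat m j)).1 * p.X (Fin.ofNat m j) * (g (Fin.ofNat m j + 1))⁻¹.1) = _
    simp only [mul_assoc, GL_inv_mul_cancel_left]

/-- Around the closed cycle the intermediate changes of bases cancel, and only the one at the vertex
0 is felt. -/
theorem etaData_act (q : Fin m → ℂ) (g : Fin m → GL (Fin n) ℂ) (p : CycData m n) :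
    etaData q (cycAct g p) = tadAct (g 0) (etaData q p) := by
  have eA : cycProd (cycAct g p) m = (g 0).1 * cycProd p m * (g 0)⁻¹.1 := by
    rw [cycProd_act, ofNat_self]
  have eZ : etaZ q (cycAct g p) = (g 0).1 * etaZ q p * (g 0)⁻¹.1 := by
    rw [etaZ, (cycAct_moment g p).1, etaZ, mul_smul_comm, smul_mul_assoc]
  have eZA : etaZ q (cycAct g p) * cycProd (cycAct g p) m
      = (g 0).1 * (etaZ q p * cycProd p m) * (g 0)⁻¹.1 := by
    rw [eZ, eA]
    simp only [mul_assoc, GL_inv_mul_cancel_left]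
  refine Prod.ext eA (Prod.ext ?_ (Prod.ext ?_ ?_))
  · change etaZ q (cycAct g p) - (cycProd (cycAct g p) m)⁻¹
      = (g 0).1 * (etaZ q p - (cycProd p m)⁻¹) * (g 0)⁻¹.1
    rw [eZ, eA, GL_conj_inv, mul_sub, sub_mul]
  · change etaZ q (cycAct g p) * cycProd (cycAct g p) m * ((g 0).1 * p.V)
      = (g 0).1 * (etaZ q p * cycProd p m * p.V)
    rw [eZA]
    simp only [Matrix.mul_assoc, GL_inv_mul_cancel_left]
  · change p.W * (g 0)⁻¹.1 * (etaZ q (cycAct g p) * cycProd (cycAct g p) m)⁻¹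
      = p.W * (etaZ q p * cycProd p m)⁻¹ * (g 0)⁻¹.1
    rw [eZA, GL_conj_inv]
    simp only [Matrix.mul_assoc, GL_inv_mul_cancel_left]

theorem etaData_xiData {q : Fin m → ℂ} (hq : ∀ i, q i ≠ 0) {p : TadData n}
    (hX : IsUnit p.X) (hZ : IsUnit p.Z) : etaData q (xiData q p) = p := by
  have hXd := (Matrix.isUnit_iff_isUnit_det _).mp hX
  have hZd := (Matrix.isUnit_iff_isUnit_det _).mp hZ
  have hP : ∀ j, j < m → cycProd (xiData q p) j = 1 := by
    intro j
    induction j with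
    | zero => intro _; rfl
    | succ j ih =>
      intro hj
      rw [cycProd, ih (by omega), one_mul]
      refine if_neg ?_
      have : (Fin.ofNat m j).val = j := Nat.mod_eq_of_lt (by omega)
      omega
  have hA : cycProd (xiData q p) m = p.X := by
    obtain ⟨k, hk⟩ : ∃ k, m = k + 1 := Nat.exists_eq_succ_of_ne_zero (NeZero.ne m)
    have h : cycProd (xiData q p) (k + 1) = p.X := by
      rw [cycProd, hP k (by omega), one_mul]
      refine if_pos ?_
      have : (Fin.ofNat m k).val = k := Nat.mod_eq_of_lt (by omega)
      omega
    rwa [← hk] at h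
  have hB : etaZ q (xiData q p) = p.Z := by
    have hxX : IsUnit (xiX p m 0) := by
      unfold xiX
      split_ifs
      exacts [hX, isUnit_one]
    have e : 1 + (xiData q p).X 0 * (xiData q p).Y 0 = xiX p m 0 * xiZ q p 0 := by
      change 1 + xiX p m 0 * (xiZ q p 0 - (xiX p m 0)⁻¹) = _
      rw [mul_sub, Matrix.mul_nonsing_inv _ ((Matrix.isUnit_iff_isUnit_det _).mp hxX)]
      abel
    have e2 : xiX p m 0 * xiZ q p 0 = q 0 • p.Z := by
      rw [xiX, xiZ, tpart_zero]
      split_ifs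
      · rw [mul_smul_comm, Matrix.mul_nonsing_inv_cancel_left _ _ hXd]
      · rw [one_mul]
    rw [etaZ, e, e2, smul_smul, inv_mul_cancel₀ (hq 0), one_smul]
  refine Prod.ext hA (Prod.ext ?_ (Prod.ext ?_ ?_))
  · change etaZ q (xiData q p) - (cycProd (xiData q p) m)⁻¹ = p.Y
    rw [hA, hB]
    exact add_sub_cancel_right _ _
  · change etaZ q (xiData q p) * cycProd (xiData q p) m * (p.X⁻¹ * p.Z⁻¹ * p.V) = p.V
    rw [hA, hB]
    simp only [Matrix.mul_assoc, Matrix.mul_nonsing_inv_cancel_left _ _ hXd,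
      Matrix.mul_nonsing_inv_cancel_left _ _ hZd]
  · change p.W * p.Z * p.X * (etaZ q (xiData q p) * cycProd (xiData q p) m)⁻¹ = p.W
    rw [hA, hB, Matrix.mul_inv_rev]
    simp only [← Matrix.mul_assoc, Matrix.mul_nonsing_inv_cancel_right _ _ hXd,
      Matrix.mul_nonsing_inv_cancel_right _ _ hZd]

/-- The inverse of `ξ` on isomorphism classes. -/
def eta (n : ℕ) (q : Fin m → ℂ) (hq : ∀ i, q i ≠ 0) :
    CycSpace m n q → TadSpace n (∏ i, q i) :=
  Quotient.map (fun p => ⟨etaData q p.1, etaData_mem hq p.2⟩) (by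
    rintro p p' ⟨g, hg⟩
    exact ⟨g 0, by
      change etaData q p'.1 = _
      rw [hg, etaData_act]⟩)

theorem eta_xi (q : Fin m → ℂ) (hq : ∀ i, q i ≠ 0) (c : TadSpace n (∏ i, q i)) :
    eta n q hq (xi n q hq c) = c := by
  obtain ⟨p, rfl⟩ := Quotient.exists_rep c
  obtain ⟨hX, hZ, -⟩ := tadRep_units p.2
  exact congrArg _ (Subtype.ext (etaData_xiData hq hX hZ))

theorem xi_eta (q : Fin m → ℂ) (hq : ∀ i, q i ≠ 0) (c : CycSpace m n q) :
    xi n q hq (eta n q hq c) = c := by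
  obtain ⟨p, rfl⟩ := Quotient.exists_rep c
  obtain ⟨g, hg, -⟩ := exists_cycAct_eq_xiData hq p.2
  refine Eq.symm (Quotient.sound ⟨g, ?_⟩)
  exact hg.symm

theorem xi_bijective (q : Fin m → ℂ) (hq : ∀ i, q i ≠ 0) : Function.Bijective (xi n q hq) :=
  Function.bijective_iff_has_inverse.mpr ⟨eta n q hq, eta_xi q hq, xi_eta q hq⟩

theorem analyticAt_etaData (q : Fin m → ℂ) (hq : ∀ i, q i ≠ 0) {p : CycData m n}
    (hp : p ∈ cycRep m n q) : AnalyticAt ℂ (etaData q) p := by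
  have aX : ∀ s, AnalyticAt ℂ (fun p : CycData m n => p.X s) p := fun s =>
    analyticAt_pi_iff.mp analyticAt_fst s
  have aY : ∀ s, AnalyticAt ℂ (fun p : CycData m n => p.Y s) p := fun s =>
    analyticAt_pi_iff.mp (analyticAt_fst.comp analyticAt_snd) s
  have aV : AnalyticAt ℂ (fun p : CycData m n => p.V) p :=
    analyticAt_fst.comp (analyticAt_snd.comp analyticAt_snd)
  have aW : AnalyticAt ℂ (fun p : CycData m n => p.W) p :=
    analyticAt_snd.comp (analyticAt_snd.comp analyticAt_snd)
  have aA : ∀ j, AnalyticAt ℂ (fun p : CycData m n => cycProd p j) p := by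
    intro j
    induction j with
    | zero => exact analyticAt_const
    | succ j ih => exact analyticAt_matMul ih (aX _)
  have aZ : AnalyticAt ℂ (fun p : CycData m n => etaZ q p) p :=
    (analyticAt_const.fun_add (analyticAt_matMul (aX 0) (aY 0))).fun_const_smul
  have hA : IsUnit (cycProd p m) := isUnit_cycProd hp.2.2.2.2.2.2 m
  have hZ : IsUnit (etaZ q p) := isUnit_smul_mat (inv_ne_zero (hq 0)) (hp.1 0).1
  exact (aA m).prod ((aZ.fun_sub (analyticAt_matInv (aA m) hA)).prod
    ((analyticAt_matMul (analyticAt_matMul aZ (aA m)) aV).prod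
      (analyticAt_matMul aW (analyticAt_matInv (analyticAt_matMul aZ (aA m)) (hZ.mul hA)))))

/-- Continuity of the inverse lets statements that hold near a point of the tadpole space be
transported to the cyclic space. -/
theorem continuous_eta (q : Fin m → ℂ) (hq : ∀ i, q i ≠ 0) : Continuous (eta n q hq) := by
  refine Continuous.quotient_map' (Continuous.subtype_mk ?_ _) _
  exact continuous_iff_continuousAt.mpr fun p =>
    (analyticAt_etaData q hq p.2).continuousAt.comp continuous_subtype_val.continuousAt

end

end Eta

/-! ### Comparison of the regular functions -/

section Regular

/-- The entries of the matrix-valued function `M` belong to `R`. -/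
def IsRegularMatrix {L : Type*} {a b : ℕ} (R : Subalgebra ℂ (L → ℂ))
    (M : L → Matrix (Fin a) (Fin b) ℂ) : Prop :=
  ∀ i j, (fun p => M p i j) ∈ R

namespace IsRegularMatrix

variable {L : Type*} {a b c : ℕ} {R : Subalgebra ℂ (L → ℂ)}

theorem mul {M : L → Matrix (Fin a) (Fin b) ℂ} {N : L → Matrix (Fin b) (Fin c) ℂ}
    (hM : IsRegularMatrix R M) (hN : IsRegularMatrix R N) :
    IsRegularMatrix R (fun p => M p * N p) := by
  intro i j
  have : (fun p => (M p * N p) i j) = ∑ k, (fun p => M p i k) * (fun p => N p k j) := by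
    ext p; simp [Matrix.mul_apply]
  rw [this]
  exact sum_mem fun k _ => mul_mem (hM i k) (hN k j)

theorem add {M N : L → Matrix (Fin a) (Fin b) ℂ} (hM : IsRegularMatrix R M)
    (hN : IsRegularMatrix R N) : IsRegularMatrix R (fun p => M p + N p) :=
  fun i j => add_mem (hM i j) (hN i j)

theorem sub {M N : L → Matrix (Fin a) (Fin b) ℂ} (hM : IsRegularMatrix R M)
    (hN : IsRegularMatrix R N) : IsRegularMatrix R (fun p => M p - N p) :=
  fun i j => sub_mem (hM i j) (hN i j)

theorem smul {M : L → Matrix (Fin a) (Fin b) ℂ} (hM : IsRegularMatrix R M) (k : ℂ) :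
    IsRegularMatrix R (fun p => k • M p) :=
  fun i j => R.smul_mem (hM i j) k

theorem const (M : Matrix (Fin a) (Fin b) ℂ) : IsRegularMatrix R (fun _ => M) :=
  fun i j => R.algebraMap_mem (M i j)

end IsRegularMatrix

/-- If the entries of the generators of a coordinate ring pull back to `R`, so do all elements. -/
theorem pullback_mem_of_adjoin {L L' : Type*} {S : Set (L' → ℂ)} {R : Subalgebra ℂ (L → ℂ)}
    (φ : L → L') (h : ∀ f ∈ S, f ∘ φ ∈ R) {f : L' → ℂ} (hf : f ∈ Algebra.adjoin ℂ S) :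
    f ∘ φ ∈ R := by
  refine Algebra.adjoin_induction (p := fun f _ => f ∘ φ ∈ R) h ?_ ?_ ?_ hf
  · intro c; exact R.algebraMap_mem c
  · intro f g _ _ hf hg; exact add_mem hf hg
  · intro f g _ _ hf hg; exact mul_mem hf hg

theorem entries_pullback {L L' : Type*} {R : Subalgebra ℂ (L → ℂ)} (φ : L → L') {a b : ℕ}
    (M : L' → Matrix (Fin a) (Fin b) ℂ) {N : L → Matrix (Fin a) (Fin b) ℂ}
    (h : IsRegularMatrix R N) (e : ∀ p, M (φ p) = N p) {f : L' → ℂ}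
    (hf : ∃ i j, f = fun p => M p i j) : f ∘ φ ∈ R := by
  obtain ⟨i, j, rfl⟩ := hf
  have : (fun p => M p i j) ∘ φ = fun p => N p i j := funext fun p => by
    rw [← e]; rfl
  rw [this]
  exact h i j

section Tad

variable {n : ℕ} {t : ℂ}

theorem tadRing_generators :
    IsRegularMatrix (tadRing n t) (fun p => p.1.X) ∧
    IsRegularMatrix (tadRing n t) (fun p => p.1.Y) ∧
    IsRegularMatrix (tadRing n t) (fun p => p.1.V) ∧
    IsRegularMatrix (tadRing n t) (fun p => p.1.W) ∧
    IsRegularMatrix (tadRing n t) (fun p => p.1.X⁻¹) ∧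
    IsRegularMatrix (tadRing n t) (fun p => (1 + p.1.X * p.1.Y)⁻¹) ∧
    IsRegularMatrix (tadRing n t) (fun p => (1 + p.1.V * p.1.W)⁻¹) := by
  refine ⟨?_, ?_, ?_, ?_, ?_, ?_, ?_⟩ <;> refine fun i j => Algebra.subset_adjoin ?_
  · exact .inl (.inl (.inl (.inl (.inl (.inl (.inl (.inl ⟨i, j, rfl⟩)))))))
  · exact .inl (.inl (.inl (.inl (.inl (.inl (.inl (.inr ⟨i, j, rfl⟩)))))))
  · exact .inl (.inl (.inl (.inl (.inl (.inl (.inr ⟨i, j, rfl⟩))))))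
  · exact .inl (.inl (.inl (.inl (.inl (.inr ⟨i, j, rfl⟩)))))
  · exact .inl (.inl (.inl (.inl (.inr ⟨i, j, rfl⟩))))
  · exact .inl (.inl (.inl (.inr ⟨i, j, rfl⟩)))
  · exact .inl (.inr ⟨i, j, rfl⟩)

end Tad

variable {m n : ℕ} [NeZero m] {q : Fin m → ℂ}

theorem cycRing_generators :
    (∀ s, IsRegularMatrix (cycRing m n q) (fun p => p.1.X s) ∧
      IsRegularMatrix (cycRing m n q) (fun p => p.1.Y s) ∧
      IsRegularMatrix (cycRing m n q) (fun p => (p.1.X s)⁻¹) ∧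
      IsRegularMatrix (cycRing m n q) (fun p => (1 + p.1.X s * p.1.Y s)⁻¹)) ∧
    IsRegularMatrix (cycRing m n q) (fun p => p.1.V) ∧
    IsRegularMatrix (cycRing m n q) (fun p => p.1.W) ∧
    IsRegularMatrix (cycRing m n q) (fun p => (1 + p.1.V * p.1.W)⁻¹) := by
  refine ⟨fun s => ⟨?_, ?_, ?_, ?_⟩, ?_, ?_, ?_⟩ <;> refine fun i j => Algebra.subset_adjoin ?_
  · exact .inl (.inl (.inl (.inl (Set.mem_iUnion.mpr
      ⟨s, .inl (.inl (.inl (.inl ⟨i, j, rfl⟩)))⟩))))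
  · exact .inl (.inl (.inl (.inl (Set.mem_iUnion.mpr
      ⟨s, .inl (.inl (.inl (.inr ⟨i, j, rfl⟩)))⟩))))
  · exact .inl (.inl (.inl (.inl (Set.mem_iUnion.mpr ⟨s, .inl (.inl (.inr ⟨i, j, rfl⟩))⟩))))
  · exact .inl (.inl (.inl (.inl (Set.mem_iUnion.mpr ⟨s, .inl (.inr ⟨i, j, rfl⟩)⟩))))
  · exact .inl (.inl (.inl (.inr ⟨i, j, rfl⟩)))
  · exact .inl (.inl (.inr ⟨i, j, rfl⟩))
  · exact .inl (.inr ⟨i, j, rfl⟩)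

theorem one_add_conj_inv {a b : ℕ} {K : Matrix (Fin a) (Fin a) ℂ} (hK : IsUnit K)
    (V : Matrix (Fin a) (Fin b) ℂ) (W : Matrix (Fin b) (Fin a) ℂ) :
    (1 + K * V * (W * K⁻¹))⁻¹ = K * (1 + V * W)⁻¹ * K⁻¹ := by
  have hd := (Matrix.isUnit_iff_isUnit_det _).mp hK
  have : 1 + K * V * (W * K⁻¹) = K * (1 + V * W) * K⁻¹ := by
    rw [mul_add, add_mul, mul_one, Matrix.mul_nonsing_inv _ hd]
    simp only [Matrix.mul_assoc]
  rw [this, Matrix.mul_inv_rev, Matrix.mul_inv_rev, Matrix.nonsing_inv_nonsing_inv _ hd,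
    Matrix.mul_assoc]

/-- It suffices to treat the generators. The inverse Z⁻¹ = (1 + XY)⁻¹X is regular, the inverses at
each arrow are products of regular ones, and (1 + WV)⁻¹ is constant on the locus. -/
theorem regular_comp_xi (hq : ∀ i, q i ≠ 0) {f : CycSpace m n q → ℂ}
    (hf : IsRegularFunction (cycRing m n q) f) :
    IsRegularFunction (tadRing n (∏ i, q i)) (f ∘ xi n q hq) := by
  obtain ⟨rX, rY, rV, rW, rXi, rXY, rVW⟩ := tadRing_generators (n := n) (t := ∏ i, q i)
  have ht := fun s => tpart_ne_zero hq s
  have rZ : IsRegularMatrix (tadRing n (∏ i, q i)) (fun p => p.1.Z) := rY.add rXi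
  have rZi : IsRegularMatrix (tadRing n (∏ i, q i)) (fun p => p.1.Z⁻¹) := by
    have h := rXY.mul rX
    have e : ∀ p : tadRep n (∏ i, q i), (1 + p.1.X * p.1.Y)⁻¹ * p.1.X = p.1.Z⁻¹ := by
      intro p
      obtain ⟨hX, hZ, e, -⟩ := tadRep_units p.2
      rw [e, Matrix.mul_inv_rev, Matrix.nonsing_inv_mul_cancel_right _ _
        ((Matrix.isUnit_iff_isUnit_det _).mp hX)]
    simpa only [e] using h
  have rx : ∀ s, IsRegularMatrix (tadRing n (∏ i, q i)) (fun p => xiX p.1 m s) := by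
    intro s
    unfold xiX
    split_ifs
    exacts [rX, IsRegularMatrix.const 1]
  have rxi : ∀ s, IsRegularMatrix (tadRing n (∏ i, q i)) (fun p => (xiX p.1 m s)⁻¹) := by
    intro s
    unfold xiX
    split_ifs
    exacts [rXi, IsRegularMatrix.const 1⁻¹]
  have rz : ∀ s, IsRegularMatrix (tadRing n (∏ i, q i)) (fun p => xiZ q p.1 s) := by
    intro s
    unfold xiZ
    split_ifs
    exacts [(rXi.mul rZ).smul _, rZ.smul _]
  have rzi : ∀ s, IsRegularMatrix (tadRing n (∏ i, q i)) (fun p => (xiZ q p.1 s)⁻¹) := by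
    intro s
    have e : ∀ p : tadRep n (∏ i, q i), (xiZ q p.1 s)⁻¹ = if s.val + 1 = m then
        (tpart q s)⁻¹ • (p.1.Z⁻¹ * p.1.X) else (tpart q s)⁻¹ • p.1.Z⁻¹ := by
      intro p
      obtain ⟨hX, hZ, -⟩ := tadRep_units p.2
      unfold xiZ
      split_ifs
      · rw [inv_smul_mat (ht s) ((Matrix.isUnit_nonsing_inv_iff.mpr hX).mul hZ),
          Matrix.mul_inv_rev, Matrix.nonsing_inv_nonsing_inv _
            ((Matrix.isUnit_iff_isUnit_det _).mp hX)]
      · rw [inv_smul_mat (ht s) hZ]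
    simp only [e]
    split_ifs
    exacts [(rZi.mul rX).smul _, rZi.smul _]
  have units : ∀ (p : tadRep n (∏ i, q i)) (s : Fin m), IsUnit (xiX p.1 m s) := by
    intro p s
    obtain ⟨hX, -⟩ := tadRep_units p.2
    unfold xiX
    split_ifs
    exacts [hX, isUnit_one]
  have exy : ∀ (p : tadRep n (∏ i, q i)) (s : Fin m),
      (1 + (xiData q p.1).X s * (xiData q p.1).Y s)⁻¹ = (xiZ q p.1 s)⁻¹ * (xiX p.1 m s)⁻¹ := by
    intro p s
    rw [← Matrix.mul_inv_rev]
    congr 1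
    change 1 + xiX p.1 m s * (xiZ q p.1 s - (xiX p.1 m s)⁻¹) = _
    rw [mul_sub, Matrix.mul_nonsing_inv _ ((Matrix.isUnit_iff_isUnit_det _).mp (units p s))]
    abel
  have eyx : ∀ (p : tadRep n (∏ i, q i)) (s : Fin m),
      (1 + (xiData q p.1).Y s * (xiData q p.1).X s)⁻¹ = (xiX p.1 m s)⁻¹ * (xiZ q p.1 s)⁻¹ := by
    intro p s
    rw [← Matrix.mul_inv_rev]
    congr 1
    change 1 + (xiZ q p.1 s - (xiX p.1 m s)⁻¹) * xiX p.1 m s = _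
    rw [sub_mul, Matrix.nonsing_inv_mul _ ((Matrix.isUnit_iff_isUnit_det _).mp (units p s))]
    abel
  have evw : ∀ p : tadRep n (∏ i, q i), (1 + (xiData q p.1).V * (xiData q p.1).W)⁻¹
      = p.1.X⁻¹ * p.1.Z⁻¹ * (1 + p.1.V * p.1.W)⁻¹ * (p.1.Z * p.1.X) := by
    intro p
    obtain ⟨hX, hZ, -⟩ := tadRep_units p.2
    have hd := (Matrix.isUnit_iff_isUnit_det _).mp (hZ.mul hX)
    have e := one_add_conj_inv (Matrix.isUnit_nonsing_inv_iff.mpr (hZ.mul hX)) p.1.V p.1.W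
    rw [Matrix.nonsing_inv_nonsing_inv _ hd, Matrix.mul_inv_rev] at e
    rw [← e, ← Matrix.mul_assoc p.1.W]
    rfl
  have ex : ∀ (p : tadRep n (∏ i, q i)) (s : Fin m), (xiData q p.1).X s = xiX p.1 m s :=
    fun _ _ => rfl
  have ewv : ∀ p : tadRep n (∏ i, q i), (1 + (xiData q p.1).W * (xiData q p.1).V)⁻¹
      = ((∏ i, q i) ^ n)⁻¹ • 1 := fun p => (xiData_mem hq p.2).2.2.2.2.2.1
  let φ : tadRep n (∏ i, q i) → cycRep m n q := fun p => ⟨xiData q p.1, xiData_mem hq p.2⟩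
  refine pullback_mem_of_adjoin φ ?_ hf
  rintro f ((((h | h) | h) | h) | h)
  · obtain ⟨s, h⟩ := Set.mem_iUnion.mp h
    obtain ((((h | h) | h) | h) | h) := h
    · exact entries_pullback φ (fun p => p.1.X s) (rx s) (fun p => ex p s) h
    · exact entries_pullback φ (fun p => p.1.Y s) ((rz s).sub (rxi s)) (fun p => rfl) h
    · exact entries_pullback φ (fun p => (p.1.X s)⁻¹) (rxi s)
        (fun p => congrArg (fun M => M⁻¹) (ex p s)) h
    · exact entries_pullback φ (fun p => (1 + p.1.X s * p.1.Y s)⁻¹) ((rzi s).mul (rxi s))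
        (fun p => exy p s) h
    · exact entries_pullback φ (fun p => (1 + p.1.Y s * p.1.X s)⁻¹) ((rxi s).mul (rzi s))
        (fun p => eyx p s) h
  · exact entries_pullback φ (fun p => p.1.V) ((rXi.mul rZi).mul rV) (fun p => rfl) h
  · exact entries_pullback φ (fun p => p.1.W) ((rW.mul rZ).mul rX) (fun p => rfl) h
  · exact entries_pullback φ (fun p => (1 + p.1.V * p.1.W)⁻¹)
      (((rXi.mul rZi).mul rVW).mul (rZ.mul rX)) evw h
  · exact entries_pullback φ (fun p => (1 + p.1.W * p.1.V)⁻¹) (IsRegularMatrix.const _) ewv h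

theorem regular_of_comp_xi (hq : ∀ i, q i ≠ 0) {f : CycSpace m n q → ℂ}
    (hf : IsRegularFunction (tadRing n (∏ i, q i)) (f ∘ xi n q hq)) :
    IsRegularFunction (cycRing m n q) f := by
  obtain ⟨rs, rV, rW, rVW⟩ := cycRing_generators (m := m) (n := n) (q := q)
  have uA : ∀ p : cycRep m n q, IsUnit (cycProd p.1 m) := fun p =>
    isUnit_cycProd p.2.2.2.2.2.2.2 m
  have uZ : ∀ p : cycRep m n q, IsUnit (etaZ q p.1) := fun p =>
    isUnit_smul_mat (inv_ne_zero (hq 0)) (p.2.1 0).1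
  have rA : ∀ j, IsRegularMatrix (cycRing m n q) (fun p => cycProd p.1 j) := by
    intro j
    induction j with
    | zero => exact IsRegularMatrix.const 1
    | succ j ih => exact ih.mul (rs _).1
  have rAi : ∀ j, IsRegularMatrix (cycRing m n q) (fun p => (cycProd p.1 j)⁻¹) := by
    intro j
    induction j with
    | zero => exact IsRegularMatrix.const 1⁻¹
    | succ j ih =>
      simp only [cycProd, Matrix.mul_inv_rev]
      exact (rs _).2.2.1.mul ih
  have rZ : IsRegularMatrix (cycRing m n q) (fun p => etaZ q p.1) :=
    ((IsRegularMatrix.const 1).add ((rs 0).1.mul (rs 0).2.1)).smul _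
  have rZi : IsRegularMatrix (cycRing m n q) (fun p => (etaZ q p.1)⁻¹) := by
    have e : ∀ p : cycRep m n q, (etaZ q p.1)⁻¹ = q 0 • (1 + p.1.X 0 * p.1.Y 0)⁻¹ := by
      intro p
      rw [etaZ, inv_smul_mat (inv_ne_zero (hq 0)) (p.2.1 0).1, inv_inv]
    simpa only [e] using (rs 0).2.2.2.smul (q 0)
  have exy : ∀ p : cycRep m n q, (1 + (etaData q p.1).X * (etaData q p.1).Y)⁻¹
      = (etaZ q p.1)⁻¹ * (cycProd p.1 m)⁻¹ := by
    intro p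
    rw [(tadRep_units (etaData_mem hq p.2)).2.2.1, etaData_Z, Matrix.mul_inv_rev]
    rfl
  have eyx : ∀ p : cycRep m n q, (1 + (etaData q p.1).Y * (etaData q p.1).X)⁻¹
      = (cycProd p.1 m)⁻¹ * (etaZ q p.1)⁻¹ := by
    intro p
    rw [(tadRep_units (etaData_mem hq p.2)).2.2.2, etaData_Z, Matrix.mul_inv_rev]
    rfl
  have evw : ∀ p : cycRep m n q, (1 + (etaData q p.1).V * (etaData q p.1).W)⁻¹
      = etaZ q p.1 * cycProd p.1 m * (1 + p.1.V * p.1.W)⁻¹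
        * ((cycProd p.1 m)⁻¹ * (etaZ q p.1)⁻¹) := by
    intro p
    rw [← Matrix.mul_inv_rev]
    exact one_add_conj_inv ((uZ p).mul (uA p)) p.1.V p.1.W
  have ew : ∀ p : cycRep m n q, (etaData q p.1).W
      = p.1.W * ((cycProd p.1 m)⁻¹ * (etaZ q p.1)⁻¹) := by
    intro p; rw [← Matrix.mul_inv_rev]; rfl
  have ex : ∀ p : cycRep m n q, (etaData q p.1).X = cycProd p.1 m := fun _ => rfl
  have ewv : ∀ p : cycRep m n q, (1 + (etaData q p.1).W * (etaData q p.1).V)⁻¹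
      = ((∏ i, q i) ^ n)⁻¹ • 1 := fun p => (etaData_mem hq p.2).2.2.2.2.2.1
  let φ : cycRep m n q → tadRep n (∏ i, q i) := fun p => ⟨etaData q p.1, etaData_mem hq p.2⟩
  have h : (fun p => (f ∘ xi n q hq) (Quotient.mk _ p)) ∘ φ ∈ cycRing m n q := by
    refine pullback_mem_of_adjoin φ ?_ hf
    rintro f ((((((((h | h) | h) | h) | h) | h) | h) | h) | h)
    · exact entries_pullback φ (fun p => p.1.X) (rA m) ex h
    · exact entries_pullback φ (fun p => p.1.Y) (rZ.sub (rAi m)) (fun p => rfl) h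
    · exact entries_pullback φ (fun p => p.1.V) ((rZ.mul (rA m)).mul rV) (fun p => rfl) h
    · exact entries_pullback φ (fun p => p.1.W) (rW.mul ((rAi m).mul rZi)) ew h
    · exact entries_pullback φ (fun p => p.1.X⁻¹) (rAi m)
        (fun p => congrArg (fun M => M⁻¹) (ex p)) h
    · exact entries_pullback φ (fun p => (1 + p.1.X * p.1.Y)⁻¹) (rZi.mul (rAi m)) exy h
    · exact entries_pullback φ (fun p => (1 + p.1.Y * p.1.X)⁻¹) ((rAi m).mul rZi) eyx h
    · exact entries_pullback φ (fun p => (1 + p.1.V * p.1.W)⁻¹)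
        (((rZ.mul (rA m)).mul rVW).mul ((rAi m).mul rZi)) evw h
    · exact entries_pullback φ (fun p => (1 + p.1.W * p.1.V)⁻¹) (IsRegularMatrix.const _) ewv h
  -- The pull-back along η shows that f ∘ ξ ∘ η is regular, and ξ ∘ η is the identity on classes.
  have e : ∀ p : cycRep m n q, f (xi n q hq (Quotient.mk _ ⟨etaData q p.1, etaData_mem hq p.2⟩))
      = f (Quotient.mk _ p) := fun p => congrArg f (xi_eta q hq (Quotient.mk _ p))
  have e2 : (fun p : cycRep m n q => f (Quotient.mk _ p)) = fun p : cycRep m n q =>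
      f (xi n q hq (Quotient.mk _ ⟨etaData q p.1, etaData_mem hq p.2⟩)) := funext fun p => (e p).symm
  unfold IsRegularFunction
  rw [e2]
  exact h

end Regular

/-! ### The data with diagonal `A` -/

section Chart

variable {n : ℕ} {t : ℂ}

noncomputable section

/-- The factor `∏_{k ≠ j} (1 - t xⱼ/xₖ) / (1 - xⱼ/xₖ)` in the Lax matrix. -/
def laxWeight (t : ℂ) (x : Fin n → ℂ) (j : Fin n) : ℂ :=
  ∏ k ∈ Finset.univ.erase j, (1 - t * x j / x k) / (1 - x j / x k)

theorem mul_sub_ne_zero (ht1 : t ≠ 1) {u : (Fin n → ℂ) × (Fin n → ℂ)} (hu : u ∈ coordDomain n t)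
    (i j : Fin n) : t * u.1 j - u.1 i ≠ 0 := by
  by_cases h : i = j
  · subst h
    have : t * u.1 i - u.1 i = (t - 1) * u.1 i := by ring
    rw [this]
    exact mul_ne_zero (sub_ne_zero.mpr ht1) (hu.1 i)
  · exact sub_ne_zero.mpr (hu.2.2 i j h).2.symm

theorem laxWeight_ne_zero {u : (Fin n → ℂ) × (Fin n → ℂ)} (hu : u ∈ coordDomain n t)
    (j : Fin n) : laxWeight t u.1 j ≠ 0 := by
  refine Finset.prod_ne_zero_iff.mpr fun k hk => ?_
  have hk := Finset.ne_of_mem_erase hk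
  have h0 := hu.1 k
  refine div_ne_zero ?_ ?_
  · rw [sub_ne_zero, ne_comm, Ne, div_eq_one_iff_eq h0]
    exact (hu.2.2 k j hk).2.symm
  · rw [sub_ne_zero, ne_comm, Ne, div_eq_one_iff_eq h0]
    exact (hu.2.2 k j hk).1.symm

/-- The row `ρ` in `t B A - A B = (1, …, 1)ᵀ ρ`. -/
def laxRow (t : ℂ) (u : (Fin n → ℂ) × (Fin n → ℂ)) (j : Fin n) : ℂ :=
  u.2 j * laxWeight t u.1 j * ((t - 1) * u.1 j)

theorem laxRow_ne_zero (ht1 : t ≠ 1) {u : (Fin n → ℂ) × (Fin n → ℂ)} (hu : u ∈ coordDomain n t)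
    (j : Fin n) : laxRow t u j ≠ 0 :=
  mul_ne_zero (mul_ne_zero (hu.2.1 j) (laxWeight_ne_zero hu j))
    (mul_ne_zero (sub_ne_zero.mpr ht1) (hu.1 j))

/-- Cauchy form: clearing x_j from the denominator separates a column factor ρ_j from 1/(t x_j -
x_i). The nonvanishing of these denominators is where t ≠ 1 and x_i ≠ t x_j enter. -/
theorem laxMatrix_apply (ht1 : t ≠ 1) {u : (Fin n → ℂ) × (Fin n → ℂ)} (hu : u ∈ coordDomain n t)
    (i j : Fin n) : laxMatrix t u i j = laxRow t u j / (t * u.1 j - u.1 i) := by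
  have h := mul_sub_ne_zero ht1 hu i j
  have hj := hu.1 j
  have e : t - u.1 i / u.1 j = (t * u.1 j - u.1 i) / u.1 j := by field_simp
  change u.2 j * ((t - 1) / (t - u.1 i / u.1 j)) * laxWeight t u.1 j = _
  rw [e, laxRow]
  field_simp

theorem laxMatrix_diag (ht1 : t ≠ 1) {u : (Fin n → ℂ) × (Fin n → ℂ)} (hu : u ∈ coordDomain n t)
    (j : Fin n) : laxMatrix t u j j = u.2 j * laxWeight t u.1 j := by
  have h := mul_sub_ne_zero ht1 hu j j
  rw [laxMatrix_apply ht1 hu, div_eq_iff h, laxRow]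
  ring

theorem of_one_mul_apply {a b : ℕ} (R : Matrix (Fin 1) (Fin b) ℂ) (i : Fin a) (j : Fin b) :
    (Matrix.of (fun (_ : Fin a) (_ : Fin 1) => (1 : ℂ)) * R) i j = R 0 j := by
  rw [Matrix.mul_apply, Fintype.sum_unique, Matrix.of_apply, one_mul]
  rfl

theorem laxMatrix_commutator (ht1 : t ≠ 1) {u : (Fin n → ℂ) × (Fin n → ℂ)}
    (hu : u ∈ coordDomain n t) :
    t • (laxMatrix t u * Matrix.diagonal u.1) - Matrix.diagonal u.1 * laxMatrix t u
      = Matrix.of (fun (_ : Fin n) (_ : Fin 1) => (1 : ℂ))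
        * Matrix.of (fun (_ : Fin 1) j => laxRow t u j) := by
  ext i j
  have h := mul_sub_ne_zero ht1 hu i j
  rw [of_one_mul_apply, Matrix.sub_apply, Matrix.smul_apply, Matrix.mul_diagonal,
    Matrix.diagonal_mul, laxMatrix_apply ht1 hu, smul_eq_mul, Matrix.of_apply]
  field_simp

-- A kernel vector v gives the polynomial ∑ ρ_j v_j ∏_{k≠j} (t x_k - X), of degree less than n and
-- vanishing at the n distinct points x_i. It is therefore zero, and its value at t x_j isolates
-- v_j.
open Polynomial in
theorem isUnit_laxMatrix (ht0 : t ≠ 0) (ht1 : t ≠ 1) {u : (Fin n → ℂ) × (Fin n → ℂ)}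
    (hu : u ∈ coordDomain n t) : IsUnit (laxMatrix t u) := by
  rw [Matrix.isUnit_iff_isUnit_det, isUnit_iff_ne_zero]
  intro hdet
  obtain ⟨v, hv0, hv⟩ := Matrix.exists_mulVec_eq_zero_iff.mpr hdet
  refine hv0 (funext fun j => ?_)
  let P : ℂ[X] := ∑ j, C (laxRow t u j * v j) *
    ∏ k ∈ Finset.univ.erase j, (C (t * u.1 k) - X)
  have hdeg : P.degree < (n : ℕ) := by
    rw [← mem_degreeLT]
    refine Submodule.sum_mem _ fun j _ => ?_
    rw [← smul_eq_C_mul]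
    refine Submodule.smul_mem _ _ (mem_degreeLT.mpr ?_)
    have hn : 0 < n := j.pos
    refine (degree_prod_le _ _).trans_lt ?_
    have h1 : ∀ k ∈ Finset.univ.erase j, (C (t * u.1 k) - X).degree ≤ (1 : WithBot ℕ) :=
      fun k _ => (degree_sub_le _ _).trans (max_le (degree_C_le.trans zero_le_one) degree_X_le)
    refine (Finset.sum_le_sum h1).trans_lt ?_
    rw [Finset.sum_const, Finset.card_erase_of_mem (Finset.mem_univ j), Finset.card_univ,
      Fintype.card_fin, nsmul_one]
    exact_mod_cast Nat.sub_lt hn one_pos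
  have hroot : ∀ i, P.eval (u.1 i) = 0 := by
    intro i
    have hi : ∑ j, laxRow t u j / (t * u.1 j - u.1 i) * v j = 0 := by
      have := congrFun hv i
      simpa only [Matrix.mulVec, dotProduct, laxMatrix_apply ht1 hu, Pi.zero_apply] using this
    have : P.eval (u.1 i) = (∏ k, (t * u.1 k - u.1 i)) *
        ∑ j, laxRow t u j / (t * u.1 j - u.1 i) * v j := by
      simp only [P, eval_finsetSum, eval_mul, eval_C, eval_prod, eval_sub, eval_X]
      rw [Finset.mul_sum]
      refine Finset.sum_congr rfl fun j _ => ?_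
      have h := mul_sub_ne_zero ht1 hu i j
      rw [← Finset.mul_prod_erase _ _ (Finset.mem_univ j)]
      field_simp
    rw [this, hi, mul_zero]
  have hinj : Function.Injective u.1 := fun i j h => by
    by_contra hij
    exact (hu.2.2 i j hij).1 h
  have hP : P = 0 := Polynomial.eq_zero_of_degree_lt_of_eval_index_eq_zero Finset.univ
    (v := u.1) hinj.injOn (by rw [Finset.card_univ, Fintype.card_fin]; exact hdeg)
    (fun i _ => hroot i)
  have hj : P.eval (t * u.1 j) = 0 := by rw [hP, eval_zero]
  simp only [P, eval_finsetSum, eval_mul, eval_C, eval_prod, eval_sub, eval_X] at hj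
  rw [Finset.sum_eq_single j (fun i _ hij => by
      rw [Finset.prod_eq_zero (Finset.mem_erase.mpr ⟨hij.symm, Finset.mem_univ j⟩) (sub_self _),
        mul_zero]) (by simp)] at hj
  rcases mul_eq_zero.mp hj with h | h
  · exact (mul_eq_zero.mp h).resolve_left (laxRow_ne_zero ht1 hu j)
  · exfalso
    refine Finset.prod_ne_zero_iff.mpr (fun k hk => ?_) h
    rw [← mul_sub]
    exact mul_ne_zero ht0 (sub_ne_zero.mpr fun e => Finset.ne_of_mem_erase hk (hinj e))

/-- Linear data with `A = diag x`, `B` the Lax matrix and `V = (1, …, 1)ᵀ`. -/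
def chartData (t : ℂ) (u : (Fin n → ℂ) × (Fin n → ℂ)) : TadData n :=
  (Matrix.diagonal u.1, laxMatrix t u - (Matrix.diagonal u.1)⁻¹, Matrix.of fun _ _ => 1,
    Matrix.of (fun (_ : Fin 1) j => laxRow t u j) * (Matrix.diagonal u.1 * laxMatrix t u)⁻¹)

theorem chartData_Z (t : ℂ) (u : (Fin n → ℂ) × (Fin n → ℂ)) :
    (chartData t u).Z = laxMatrix t u :=
  sub_add_cancel _ _

theorem isUnit_diagonal {x : Fin n → ℂ} (hx : ∀ i, x i ≠ 0) : IsUnit (Matrix.diagonal x) := by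
  rw [Matrix.isUnit_iff_isUnit_det, Matrix.det_diagonal, isUnit_iff_ne_zero]
  exact Finset.prod_ne_zero_iff.mpr fun i _ => hx i

/-- The row W = ρ(AB)⁻¹ is chosen so that VWAB is the rank-one matrix tBA - AB of
`laxMatrix_commutator`, which is the moment relation. -/
theorem chartData_mem (ht0 : t ≠ 0) (ht1 : t ≠ 1) {u : (Fin n → ℂ) × (Fin n → ℂ)}
    (hu : u ∈ coordDomain n t) : chartData t u ∈ tadRep n t := by
  have hA := isUnit_diagonal hu.1
  have hAd := (Matrix.isUnit_iff_isUnit_det _).mp hA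
  have hB := isUnit_laxMatrix ht0 ht1 hu
  have hL := (Matrix.isUnit_iff_isUnit_det _).mp (hA.mul hB)
  have hXZ : 1 + (chartData t u).X * (chartData t u).Y
      = Matrix.diagonal u.1 * laxMatrix t u := by
    change 1 + Matrix.diagonal u.1 * (laxMatrix t u - (Matrix.diagonal u.1)⁻¹) = _
    rw [mul_sub, Matrix.mul_nonsing_inv _ hAd]; abel
  have hZX : 1 + (chartData t u).Y * (chartData t u).X
      = laxMatrix t u * Matrix.diagonal u.1 := by
    change 1 + (laxMatrix t u - (Matrix.diagonal u.1)⁻¹) * Matrix.diagonal u.1 = _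
    rw [sub_mul, Matrix.nonsing_inv_mul _ hAd]; abel
  refine mem_tadRep_of_moment ht0 ?_ ?_ hA ?_
  · rw [hXZ]; exact hA.mul hB
  · rw [hZX]; exact hB.mul hA
  · rw [tadMoment, hXZ, hZX, sub_eq_zero, add_mul, one_mul]
    change _ + Matrix.of (fun (_ : Fin n) (_ : Fin 1) => (1 : ℂ)) *
      (Matrix.of (fun (_ : Fin 1) j => laxRow t u j)
        * (Matrix.diagonal u.1 * laxMatrix t u)⁻¹) * _ = _
    rw [← Matrix.mul_assoc (Matrix.of fun (_ : Fin n) (_ : Fin 1) => (1 : ℂ)), ← laxMatrix_commutator ht1 hu,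
      Matrix.nonsing_inv_mul_cancel_right _ _ hL]
    abel

theorem tadRep_VW {p : TadData n} (hp : p ∈ tadRep n t) :
    p.V * (p.W * (p.X * p.Z)) = t • (p.Z * p.X) - p.X * p.Z := by
  have h := tadRep_relation hp
  obtain ⟨-, -, h1, h2⟩ := tadRep_units hp
  rw [h1, h2, add_mul, one_mul, Matrix.mul_assoc] at h
  exact eq_sub_of_add_eq' h

/-- The data over a point of the chart are unique up to scaling. -/
theorem exists_scaling (hn : 0 < n) (ht1 : t ≠ 1) {u : (Fin n → ℂ) × (Fin n → ℂ)}
    (hu : u ∈ coordDomain n t) {p p' : TadData n} (hp : p ∈ tadRep n t) (hp' : p' ∈ tadRep n t)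
    (hX : p.X = Matrix.diagonal u.1) (hZ : p.Z = laxMatrix t u) (hV : p.V = Matrix.of fun _ _ => 1)
    (hX' : p'.X = Matrix.diagonal u.1) (hZ' : p'.Z = laxMatrix t u) :
    ∃ c : ℂ, c ≠ 0 ∧ p'.V = c • p.V ∧ p'.W = c⁻¹ • p.W := by
  obtain ⟨uX, uZ, -⟩ := tadRep_units hp
  have hL := (Matrix.isUnit_iff_isUnit_det _).mp (uX.mul uZ)
  have e1 := tadRep_VW hp
  have e2 := tadRep_VW hp'
  rw [hX', hZ', ← hX, ← hZ, ← e1] at e2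
  have e3 : p'.V * p'.W = p.V * p.W := by
    have := congrArg (fun M => M * (p.X * p.Z)⁻¹) e2
    simpa only [← Matrix.mul_assoc p.V, ← Matrix.mul_assoc p'.V,
      Matrix.mul_nonsing_inv_cancel_right _ _ hL] using this
  have e4 : ∀ i j, p'.V i 0 * p'.W 0 j = p.W 0 j := by
    intro i j
    have := congrFun (congrFun e3 i) j
    simpa [Matrix.mul_apply, hV] using this
  -- If W were zero, then tBA - AB = 0, contrary to ρ_j ≠ 0; at least one index is needed here. An
  -- entry of W that does not vanish then fixes the scalar.
  have hne : ∃ j, p.W 0 j ≠ 0 := by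
    by_contra h
    push Not at h
    have hW : p.W = 0 := by ext i j; rw [Subsingleton.elim i 0]; exact h j
    rw [hW, Matrix.zero_mul, Matrix.mul_zero, hX, hZ, laxMatrix_commutator ht1 hu] at e1
    have := congrFun (congrFun e1 ⟨0, hn⟩) ⟨0, hn⟩
    rw [of_one_mul_apply, Matrix.of_apply] at this
    exact laxRow_ne_zero ht1 hu _ this.symm
  obtain ⟨j, hj⟩ := hne
  have hj' : p'.W 0 j ≠ 0 := fun h => hj (by rw [← e4 j j, h, mul_zero])
  have hc : p.W 0 j / p'.W 0 j ≠ 0 := div_ne_zero hj hj'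
  have hV' : ∀ i, p'.V i 0 = p.W 0 j / p'.W 0 j := fun i => by
    rw [eq_div_iff hj', e4]
  refine ⟨p.W 0 j / p'.W 0 j, hc, ?_, ?_⟩
  · ext i k
    rw [Subsingleton.elim k 0, Matrix.smul_apply, hV, hV' i]
    simp
  · ext k i
    rw [Subsingleton.elim k 0, Matrix.smul_apply, smul_eq_mul, eq_inv_mul_iff_mul_eq₀ hc,
      ← hV' j, e4]

/-- Linear data with `X` diagonal and `V = (1, …, 1)ᵀ` belong to the chart. -/
theorem eq_chartData (ht1 : t ≠ 1) {p : TadData n} (hp : p ∈ tadRep n t)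
    {u : (Fin n → ℂ) × (Fin n → ℂ)} (hu : u ∈ coordDomain n t) (hX : p.X = Matrix.diagonal u.1)
    (hV : p.V = Matrix.of fun _ _ => 1)
    (hZ : ∀ j, p.Z j j = u.2 j * laxWeight t u.1 j) : p = chartData t u := by
  obtain ⟨uX, uZ, -⟩ := tadRep_units hp
  have hL := (Matrix.isUnit_iff_isUnit_det _).mp (uX.mul uZ)
  have e1 := tadRep_VW hp
  -- The left side does not depend on i. Hence the diagonal entry of a column of Z determines ρ_j,
  -- and with it the whole column.
  have e2 : ∀ i j, (p.W * (p.X * p.Z)) 0 j = p.Z i j * (t * u.1 j - u.1 i) := by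
    intro i j
    have := congrFun (congrFun e1 i) j
    rw [hV, of_one_mul_apply, Matrix.sub_apply, Matrix.smul_apply] at this
    rw [this, hX, Matrix.mul_diagonal, Matrix.diagonal_mul, smul_eq_mul]
    ring
  have e3 : ∀ j, (p.W * (p.X * p.Z)) 0 j = laxRow t u j := by
    intro j
    rw [e2 j j, hZ, laxRow]
    ring
  have e4 : p.Z = laxMatrix t u := by
    ext i j
    rw [laxMatrix_apply ht1 hu, eq_div_iff (mul_sub_ne_zero ht1 hu i j), ← e2, e3]
  refine Prod.ext hX (Prod.ext ?_ (Prod.ext hV ?_))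
  · change p.Y = laxMatrix t u - (Matrix.diagonal u.1)⁻¹
    rw [← e4, ← hX, TadData.Z, add_sub_cancel_right]
  · change p.W = Matrix.of (fun (_ : Fin 1) j => laxRow t u j)
      * (Matrix.diagonal u.1 * laxMatrix t u)⁻¹
    have : Matrix.of (fun (_ : Fin 1) j => laxRow t u j) = p.W * (p.X * p.Z) := by
      ext k j
      rw [Subsingleton.elim k 0, e3, Matrix.of_apply]
    rw [this, ← hX, ← e4, Matrix.mul_nonsing_inv_cancel_right _ _ hL]

/-- The choice x_i = t^{2i} works since even exponents never differ by one. A point of the domain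
serves as the default for the chart outside its domain. -/
theorem coordDomain_nonempty (n : ℕ) (ht0 : t ≠ 0) (ht : ∀ k : ℕ, 0 < k → t ^ k ≠ 1) :
    (coordDomain n t).Nonempty := by
  have inj : Function.Injective fun k : ℕ => t ^ k := by
    have key : ∀ a b : ℕ, a < b → t ^ a ≠ t ^ b := by
      intro a b hab h
      refine ht (b - a) (by omega) (mul_left_cancel₀ (pow_ne_zero a ht0) ?_)
      rw [← pow_add, mul_one, h]
      congr 1
      omega
    intro a b h
    rcases lt_trichotomy a b with hab | hab | hab
    · exact absurd h (key a b hab)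
    · exact hab
    · exact absurd h.symm (key b a hab)
  refine ⟨(fun i => t ^ (2 * i.val), fun _ => 1), fun i => pow_ne_zero _ ht0,
    fun _ => one_ne_zero, fun i j hij => ⟨fun h => ?_, fun h => ?_⟩⟩
  · have := inj h
    exact hij (Fin.ext (by omega))
  · have := @inj (2 * i.val) (2 * j.val + 1) (by change t ^ _ = t ^ _; rw [pow_succ']; exact h)
    omega

theorem isOpen_coordDomain (n : ℕ) (t : ℂ) : IsOpen (coordDomain n t) := by
  have h1 : ∀ i : Fin n, Continuous fun u : (Fin n → ℂ) × (Fin n → ℂ) => u.1 i := fun i =>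
    (continuous_apply i).comp continuous_fst
  have h2 : ∀ i : Fin n, Continuous fun u : (Fin n → ℂ) × (Fin n → ℂ) => u.2 i := fun i =>
    (continuous_apply i).comp continuous_snd
  simp only [coordDomain, Set.ofPred_and, Set.ofPred_forall]
  refine (isOpen_iInter_of_finite fun i => isOpen_ne_fun (h1 i) continuous_const).inter
    ((isOpen_iInter_of_finite fun i => isOpen_ne_fun (h2 i) continuous_const).inter
      (isOpen_iInter_of_finite fun i => isOpen_iInter_of_finite fun j =>
        isOpen_iInter_of_finite fun _ => (isOpen_ne_fun (h1 i) (h1 j)).inter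
          (isOpen_ne_fun (h1 i) (continuous_const.mul (h1 j)))))

theorem analyticAt_laxWeight {x : Fin n → ℂ} (hx : ∀ i, x i ≠ 0)
    (hx' : ∀ i j, i ≠ j → x i ≠ x j) (j : Fin n) : AnalyticAt ℂ (fun x => laxWeight t x j) x := by
  have h1 : ∀ i : Fin n, AnalyticAt ℂ (fun x : Fin n → ℂ => x i) x := fun i =>
    (ContinuousLinearMap.proj (R := ℂ) (φ := fun _ : Fin n => ℂ) i).analyticAt x
  refine Finset.analyticAt_fun_prod _ fun k hk => ?_
  refine (analyticAt_const.fun_sub ((analyticAt_const.fun_mul (h1 j)).fun_div (h1 k) (hx k))).fun_div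
    (analyticAt_const.fun_sub ((h1 j).fun_div (h1 k) (hx k))) ?_
  rw [sub_ne_zero, ne_comm, Ne, div_eq_one_iff_eq (hx k)]
  exact (hx' k j (Finset.ne_of_mem_erase hk)).symm

theorem analyticAt_chartData (ht0 : t ≠ 0) (ht1 : t ≠ 1) {u : (Fin n → ℂ) × (Fin n → ℂ)}
    (hu : u ∈ coordDomain n t) : AnalyticAt ℂ (chartData t) u := by
  have h1 : ∀ i : Fin n, AnalyticAt ℂ (fun u : (Fin n → ℂ) × (Fin n → ℂ) => u.1 i) u := fun i =>
    analyticAt_pi_iff.mp analyticAt_fst i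
  have h2 : ∀ i : Fin n, AnalyticAt ℂ (fun u : (Fin n → ℂ) × (Fin n → ℂ) => u.2 i) u := fun i =>
    analyticAt_pi_iff.mp analyticAt_snd i
  have aw : ∀ j, AnalyticAt ℂ (fun u : (Fin n → ℂ) × (Fin n → ℂ) => laxWeight t u.1 j) u := fun j =>
    (analyticAt_laxWeight hu.1 (fun i j hij => (hu.2.2 i j hij).1) j).comp analyticAt_fst
  have aX : AnalyticAt ℂ (fun u : (Fin n → ℂ) × (Fin n → ℂ) => Matrix.diagonal u.1) u := by
    refine analyticAt_matrix.mpr fun i j => ?_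
    by_cases h : i = j
    · subst h; simpa using h1 i
    · simpa [Matrix.diagonal_apply_ne _ h] using analyticAt_const
  have aZ : AnalyticAt ℂ (fun u : (Fin n → ℂ) × (Fin n → ℂ) => laxMatrix t u) u := by
    refine analyticAt_matrix.mpr fun i j => ?_
    have hj := hu.1 j
    refine ((h2 j).fun_mul (analyticAt_const.fun_div
      (analyticAt_const.fun_sub ((h1 i).fun_div (h1 j) hj)) ?_)).fun_mul (aw j)
    have := mul_sub_ne_zero ht1 hu i j
    intro h
    apply this
    field_simp at h
    linear_combination h
  have aR : AnalyticAt ℂ (fun u : (Fin n → ℂ) × (Fin n → ℂ) =>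
      Matrix.of (fun (_ : Fin 1) j => laxRow t u j)) u :=
    analyticAt_matrix.mpr fun i j => ((h2 j).fun_mul (aw j)).fun_mul (analyticAt_const.fun_mul (h1 j))
  have hA := isUnit_diagonal hu.1
  exact aX.prod ((aZ.fun_sub (analyticAt_matInv aX hA)).prod (analyticAt_const.prod
    (analyticAt_matMul aR (analyticAt_matInv (analyticAt_matMul aX aZ)
      (hA.mul (isUnit_laxMatrix ht0 ht1 hu))))))

end

end Chart

/-! ### Local coordinates on the data -/

section LocalCoordinates

theorem hasDerivAt_fst_comp {E F : Type*} [NormedAddCommGroup E] [NormedSpace ℂ E]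
    [NormedAddCommGroup F] [NormedSpace ℂ F] {f : ℂ → E × F} {v : E × F} {s : ℂ}
    (h : HasDerivAt f v s) : HasDerivAt (fun z => (f z).1) v.1 s :=
  HasFDerivAt.comp_hasDerivAt (l := Prod.fst) (l' := ContinuousLinearMap.fst ℂ E F) s
    hasFDerivAt_fst h

theorem hasDerivAt_snd_comp {E F : Type*} [NormedAddCommGroup E] [NormedSpace ℂ E]
    [NormedAddCommGroup F] [NormedSpace ℂ F] {f : ℂ → E × F} {v : E × F} {s : ℂ}
    (h : HasDerivAt f v s) : HasDerivAt (fun z => (f z).2) v.2 s :=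
  HasFDerivAt.comp_hasDerivAt (l := Prod.snd) (l' := ContinuousLinearMap.snd ℂ E F) s
    hasFDerivAt_snd h

theorem hasDerivAt_comp_of_analyticAt {E F : Type*} [NormedAddCommGroup E] [NormedSpace ℂ E]
    [NormedAddCommGroup F] [NormedSpace ℂ F] {g : E → F} {γ : ℂ → E} {a v : E} {s : ℂ}
    (hg : AnalyticAt ℂ g a) (hγ : HasDerivAt γ v s) (h : γ s = a) :
    HasDerivAt (fun z => g (γ z)) (fderiv ℂ g a v) s := by
  subst h
  exact hg.differentiableAt.hasFDerivAt.comp_hasDerivAt s hγ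

theorem analyticAt_comp_of_eq {E F G : Type*} [NormedAddCommGroup E] [NormedSpace ℂ E]
    [NormedAddCommGroup F] [NormedSpace ℂ F] [NormedAddCommGroup G] [NormedSpace ℂ G]
    {g : F → G} {f : E → F} {a : E} {b : F} (hg : AnalyticAt ℂ g b) (hf : AnalyticAt ℂ f a)
    (h : f a = b) : AnalyticAt ℂ (fun z => g (f z)) a := by
  subst h
  exact hg.comp hf

theorem exists_analytic_localInverse {E : Type*} [NormedAddCommGroup E] [NormedSpace ℂ E]
    [FiniteDimensional ℂ E] {T : E → E} {a : E} (hT : AnalyticAt ℂ T a)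
    (hinj : ∀ v, fderiv ℂ T a v = 0 → v = 0) :
    ∃ Ψ : E → E, AnalyticAt ℂ Ψ (T a) ∧ Ψ (T a) = a ∧ (∀ᶠ y in 𝓝 (T a), T (Ψ y) = y) ∧
      ∀ v, fderiv ℂ T a (fderiv ℂ Ψ (T a) v) = v := by
  have : CompleteSpace E := FiniteDimensional.complete ℂ E
  have hi : Function.Injective (fderiv ℂ T a).toLinearMap :=
    (injective_iff_map_eq_zero (fderiv ℂ T a).toLinearMap).mpr hinj
  let e : E ≃L[ℂ] E :=
    (LinearEquiv.ofInjectiveEndo (fderiv ℂ T a).toLinearMap hi).toContinuousLinearEquiv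
  have he : HasFDerivAt T (e : E →L[ℂ] E) a := by
    have : (e : E →L[ℂ] E) = fderiv ℂ T a := ContinuousLinearMap.ext fun v => rfl
    rw [this]
    exact hT.differentiableAt.hasFDerivAt
  -- The top element of `WithTop ℕ∞` is the analytic class, so the inverse function theorem yields
  -- an analytic inverse.
  have hc : ContDiffAt ℂ ⊤ T a := hT.contDiffAt
  have hn : (⊤ : WithTop ℕ∞) ≠ 0 := WithTop.top_ne_zero
  have hΨ : AnalyticAt ℂ (hc.localInverse he hn) (T a) := (hc.to_localInverse he hn).analyticAt
  have h0 := hc.localInverse_apply_image he hn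
  have hr : ∀ᶠ y in 𝓝 (T a), T (hc.localInverse he hn y) = y :=
    (hc.hasStrictFDerivAt' he hn).eventually_right_inverse
  refine ⟨hc.localInverse he hn, hΨ, h0, hr, fun v => ?_⟩
  have h1 : HasFDerivAt T (fderiv ℂ T a) (hc.localInverse he hn (T a)) := by
    rw [h0]; exact hT.differentiableAt.hasFDerivAt
  have h2 := h1.comp (T a) hΨ.differentiableAt.hasFDerivAt
  have h3 : HasFDerivAt (T ∘ hc.localInverse he hn) (ContinuousLinearMap.id ℂ E) (T a) :=
    (hasFDerivAt_id (T a)).congr_of_eventuallyEq hr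
  exact congrArg (fun A : E →L[ℂ] E => A v) (h2.unique h3)

variable {n : ℕ} {t : ℂ}

noncomputable section

/-- Conjugation of a diagonal matrix, together with the image of `(1, …, 1)`. -/
def diagConj (z : Matrix (Fin n) (Fin n) ℂ × (Fin n → ℂ)) :
    Matrix (Fin n) (Fin n) ℂ × (Fin n → ℂ) :=
  (z.1 * Matrix.diagonal z.2 * z.1⁻¹, fun i => ∑ j, z.1 i j)

theorem analyticAt_diagonal {E : Type*} [NormedAddCommGroup E] [NormedSpace ℂ E]
    {f : E → Fin n → ℂ} {x : E} (hf : AnalyticAt ℂ f x) :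
    AnalyticAt ℂ (fun y => Matrix.diagonal (f y)) x := by
  refine analyticAt_matrix.mpr fun i j => ?_
  by_cases h : i = j
  · subst h; simpa using analyticAt_pi_iff.mp hf i
  · simpa [Matrix.diagonal_apply_ne _ h] using analyticAt_const

theorem analyticAt_diagConj (x : Fin n → ℂ) :
    AnalyticAt ℂ (diagConj (n := n)) (1, x) := by
  have a1 : AnalyticAt ℂ (fun z : Matrix (Fin n) (Fin n) ℂ × (Fin n → ℂ) => z.1) (1, x) :=
    analyticAt_fst
  refine (analyticAt_matMul (analyticAt_matMul a1 (analyticAt_diagonal analyticAt_snd))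
    (analyticAt_matInv a1 isUnit_one)).prod (analyticAt_pi_iff.mpr fun i => ?_)
  exact Finset.analyticAt_fun_sum _ fun j _ => analyticAt_matrix.mp a1 i j

theorem fderiv_diagConj (x : Fin n → ℂ) (v : Matrix (Fin n) (Fin n) ℂ × (Fin n → ℂ)) :
    fderiv ℂ (diagConj (n := n)) (1, x) v
      = (v.1 * Matrix.diagonal x - Matrix.diagonal x * v.1 + Matrix.diagonal v.2,
        fun i => ∑ j, v.1 i j) := by
  refine fderiv_apply_eq (analyticAt_diagConj x) (γ := fun s => (1, x) + s • v) (by simp)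
    (hasDerivAt_line _ v) ?_
  have hg : HasDerivAt (fun s : ℂ => 1 + s • v.1) v.1 0 := hasDerivAt_line 1 v.1
  have hgi := hasDerivAt_matInv hg (by simp)
  have hD : HasDerivAt (fun s : ℂ => Matrix.diagonal (x + s • v.2)) (Matrix.diagonal v.2) 0 := by
    refine hasDerivAt_matrix.mpr fun i j => ?_
    by_cases h : i = j
    · subst h
      have := hasDerivAt_pi.mp (hasDerivAt_line x v.2) i
      simpa using this
    · simpa [Matrix.diagonal_apply_ne _ h] using hasDerivAt_const _ _
  refine HasDerivAt.prodMk ?_ (hasDerivAt_pi.mpr fun i => ?_)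
  · have := hasDerivAt_matMul (hasDerivAt_matMul hg hD) hgi
    simp only [zero_smul, add_zero, inv_one, one_mul, mul_one] at this
    refine HasDerivAt.congr_deriv this ?_
    rw [mul_neg]; abel
  · exact HasDerivAt.fun_sum fun j _ => hasDerivAt_matrix.mp hg i j

/-- The commutator with a diagonal matrix with distinct entries detects the off-diagonal part of v.
The row sums, coming from the image of (1, …, 1), then detect its diagonal, which is the direction
of the torus centralising diag x. -/
theorem fderiv_diagConj_injective {x : Fin n → ℂ} (hx : ∀ i j, i ≠ j → x i ≠ x j)
    (v : Matrix (Fin n) (Fin n) ℂ × (Fin n → ℂ))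
    (hv : fderiv ℂ (diagConj (n := n)) (1, x) v = 0) : v = 0 := by
  rw [fderiv_diagConj] at hv
  have h1 := congrArg Prod.fst hv
  have h2 := congrArg Prod.snd hv
  have off : ∀ i j, i ≠ j → v.1 i j = 0 := by
    intro i j hij
    have := congrFun (congrFun h1 i) j
    simp only [Matrix.add_apply, Matrix.sub_apply, Matrix.mul_diagonal, Matrix.diagonal_mul,
      Matrix.diagonal_apply_ne _ hij, Prod.fst_zero, Matrix.zero_apply, add_zero] at this
    have h3 : v.1 i j * (x j - x i) = 0 := by linear_combination this
    exact (mul_eq_zero.mp h3).resolve_right (sub_ne_zero.mpr (hx j i hij.symm))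
  have diag : ∀ i, v.1 i i = 0 := by
    intro i
    have : ∑ j, v.1 i j = 0 := congrFun h2 i
    rwa [Finset.sum_eq_single i (fun j _ hj => off i j hj.symm) (by simp)] at this
  refine Prod.ext (Matrix.ext fun i j => ?_) (funext fun i => ?_)
  · by_cases h : i = j
    · subst h; exact diag i
    · exact off i j h
  · have := congrFun (congrFun h1 i) i
    simp only [Matrix.add_apply, Matrix.sub_apply, Matrix.mul_diagonal, Matrix.diagonal_mul,
      Matrix.diagonal_apply_eq, Prod.fst_zero, Matrix.zero_apply] at this
    simp only [Prod.snd_zero, Pi.zero_apply]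
    linear_combination this

/-- The gradient with respect to `X` of the `j`-th diagonal entry of `g⁻¹ Z g`, where `g`
diagonalises `X`. -/
def eigenGradient (x : Fin n → ℂ) (Z : Matrix (Fin n) (Fin n) ℂ) (j : Fin n) :
    Matrix (Fin n) (Fin n) ℂ :=
  Matrix.of fun k l => (if k = j then Z j l / (x j - x l) else 0)
    + (if l = j then Z k j / (x j - x k) else 0)

theorem eigenGradient_trace (x : Fin n → ℂ) (Z M : Matrix (Fin n) (Fin n) ℂ) (j : Fin n) :
    (eigenGradient x Z j * M).trace
      = ∑ k, (Z j k / (x j - x k) * M k j + Z k j / (x j - x k) * M j k) := by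
  simp only [Matrix.trace, Matrix.diag, Matrix.mul_apply, eigenGradient, Matrix.of_apply, add_mul,
    ite_mul, zero_mul, Finset.sum_add_distrib]
  congr 1
  · rw [Finset.sum_comm]
    simp
  · simp

/-- Near the chart point, solve g diag(x) g⁻¹ = X and g(1, …, 1)ᵀ = V for (g, x), and let σ_j be the
diagonal entry of g⁻¹Zg divided by the weight. This makes sense off the locus; on the locus
`eq_chartData` identifies the result. The differentials contain no δV, because V only affects g by a
torus factor, invisible to diagonal entries. -/
theorem exists_localCoordinates (ht0 : t ≠ 0) (ht1 : t ≠ 1) {u : (Fin n → ℂ) × (Fin n → ℂ)}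
    (hu : u ∈ coordDomain n t) :
    ∃ F : TadData n → (Fin n → ℂ) × (Fin n → ℂ), AnalyticAt ℂ F (chartData t u) ∧
      F (chartData t u) = u ∧
      (∀ᶠ p in 𝓝 (chartData t u), p ∈ tadRep n t →
        F p ∈ coordDomain n t ∧ ∃ g, p = tadAct g (chartData t (F p))) ∧
      (∀ i δ, fderiv ℂ (fun p => (F p).1 i) (chartData t u) δ = δ.X i i) ∧
      ∀ j δ, fderiv ℂ (fun p => (F p).2 j) (chartData t u) δ
        = (laxWeight t u.1 j)⁻¹ * ((δ.Y - (Matrix.diagonal u.1)⁻¹ * δ.X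
            * (Matrix.diagonal u.1)⁻¹) j j
          + (eigenGradient u.1 (laxMatrix t u) j * δ.X).trace
          - u.2 j * ∑ k, fderiv ℂ (fun x => laxWeight t x j) u.1 (Pi.single k 1) * δ.X k k) := by
  have hxne : ∀ i j, i ≠ j → u.1 i ≠ u.1 j := fun i j h => (hu.2.2 i j h).1
  obtain ⟨Ψ, aΨ, Ψ0, hΨ, dΨ⟩ := exists_analytic_localInverse (analyticAt_diagConj u.1)
    (fderiv_diagConj_injective hxne)
  have hT0 : diagConj (1, u.1) = (Matrix.diagonal u.1, fun _ => 1) := by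
    simp [diagConj, Matrix.one_apply]
  rw [hT0] at aΨ Ψ0 hΨ dΨ
  let y : TadData n → Matrix (Fin n) (Fin n) ℂ × (Fin n → ℂ) := fun p => (p.X, fun i => p.V i 0)
  have hy0 : y (chartData t u) = (Matrix.diagonal u.1, fun _ => 1) := rfl
  have ay : AnalyticAt ℂ y (chartData t u) := (analyticAt_tadX _).prod
    (analyticAt_pi_iff.mpr fun i => analyticAt_matrix.mp (analyticAt_tadV _) i 0)
  have az : AnalyticAt ℂ (fun p => Ψ (y p)) (chartData t u) := 
    analyticAt_comp_of_eq aΨ ay hy0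
  have ag : AnalyticAt ℂ (fun p => (Ψ (y p)).1) (chartData t u) := analyticAt_fst.comp az
  have ax : AnalyticAt ℂ (fun p => (Ψ (y p)).2) (chartData t u) := analyticAt_snd.comp az
  have hg0 : (Ψ (y (chartData t u))).1 = 1 := congrArg Prod.fst Ψ0
  have hx0 : (Ψ (y (chartData t u))).2 = u.1 := congrArg Prod.snd Ψ0
  have hX : IsUnit (chartData t u).X := isUnit_diagonal hu.1
  have aZ := analyticAt_tadZ hX
  have hgu : IsUnit (Ψ (y (chartData t u))).1 := by rw [hg0]; exact isUnit_one
  have aB := analyticAt_matMul (analyticAt_matMul (analyticAt_matInv ag hgu) aZ) ag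
  have aw : ∀ j, AnalyticAt ℂ (fun x => laxWeight t x j) u.1 := fun j =>
    analyticAt_laxWeight hu.1 hxne j
  have awx : ∀ j, AnalyticAt ℂ (fun p => laxWeight t (Ψ (y p)).2 j) (chartData t u) := fun j =>
    analyticAt_comp_of_eq (g := fun x => laxWeight t x j) (aw j) ax hx0
  have hw0 : ∀ j, laxWeight t (Ψ (y (chartData t u))).2 j ≠ 0 := fun j => by
    rw [hx0]; exact laxWeight_ne_zero hu j
  let F : TadData n → (Fin n → ℂ) × (Fin n → ℂ) := fun p =>
    ((Ψ (y p)).2, fun j => (((Ψ (y p)).1)⁻¹ * p.Z * (Ψ (y p)).1) j j / laxWeight t (Ψ (y p)).2 j)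
  have aF : AnalyticAt ℂ F (chartData t u) := ax.prod (analyticAt_pi_iff.mpr fun j =>
    (analyticAt_matrix.mp aB j j).fun_div (awx j) (hw0 j))
  have F0 : F (chartData t u) = u := by
    refine Prod.ext hx0 (funext fun j => ?_)
    change (((Ψ (y (chartData t u))).1)⁻¹ * (chartData t u).Z * (Ψ (y (chartData t u))).1) j j
      / laxWeight t (Ψ (y (chartData t u))).2 j = u.2 j
    rw [hg0, hx0, inv_one, one_mul, mul_one, chartData_Z, laxMatrix_diag ht1 hu,
      mul_div_cancel_right₀ _ (laxWeight_ne_zero hu j)]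
  have hΨ' : ∀ᶠ p in 𝓝 (chartData t u), diagConj (Ψ (y p)) = y p := ay.continuousAt.eventually hΨ
  have hFD : ∀ᶠ p in 𝓝 (chartData t u), F p ∈ coordDomain n t :=
    aF.continuousAt.eventually ((isOpen_coordDomain n t).mem_nhds (by rw [F0]; exact hu))
  refine ⟨F, aF, F0, ?_, ?_⟩
  · filter_upwards [hΨ', hFD, eventually_isUnit ag.continuousAt hgu] with p h1 h2 h3 hp
    refine ⟨h2, ?_⟩
    obtain ⟨g, hg⟩ := h3
    have hgi : g⁻¹.1 = ((Ψ (y p)).1)⁻¹ := by rw [← hg, Matrix.coe_units_inv]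
    have hX1 : g.1 * Matrix.diagonal (F p).1 * g⁻¹.1 = p.X := by
      rw [hgi, hg]; exact congrArg Prod.fst h1
    have hV1 : ∀ i, ∑ j, g.1 i j = p.V i 0 := fun i => by
      rw [hg]; exact congrFun (congrArg Prod.snd h1) i
    have c1 : g⁻¹.1 * g.1 = 1 := g.inv_mul
    have hX2 : (tadAct g⁻¹ p).X = Matrix.diagonal (F p).1 := by
      change g⁻¹.1 * p.X * g⁻¹⁻¹.1 = _
      rw [inv_inv, ← hX1]
      simp only [Matrix.mul_assoc, GL_inv_mul_cancel_left, c1, Matrix.mul_one]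
    have hV2 : (tadAct g⁻¹ p).V = Matrix.of fun _ _ => 1 := by
      change g⁻¹.1 * p.V = _
      have : p.V = g.1 * Matrix.of fun (_ : Fin n) (_ : Fin 1) => (1 : ℂ) := by
        ext i j
        rw [Subsingleton.elim j 0, ← hV1, Matrix.mul_apply]
        simp
      rw [this, GL_inv_mul_cancel_left]
    have hZ2 : (tadAct g⁻¹ p).Z = g⁻¹.1 * p.Z * g.1 := by
      have e : (tadAct g⁻¹ p).X⁻¹ = g⁻¹.1 * p.X⁻¹ * g.1 := by
        have := GL_conj_inv g⁻¹ p.X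
        rw [inv_inv] at this
        exact this
      rw [TadData.Z, e, TadData.Z, mul_add, add_mul]
      change g⁻¹.1 * p.Y * g⁻¹⁻¹.1 + _ = _
      rw [inv_inv]
    have key := eq_chartData ht1 (tadAct_mem ht0 g⁻¹ hp) h2 hX2 hV2 fun j => by
      rw [hZ2, hgi, hg]
      have hw : laxWeight t (F p).1 j ≠ 0 := laxWeight_ne_zero h2 j
      exact (div_mul_cancel₀ _ hw).symm
    exact ⟨g, by rw [← key, ← tadAct_mul, mul_inv_cancel, tadAct_one]⟩
  -- the derivative along a line
  have curve : ∀ δ : TadData n, ∃ v : Matrix (Fin n) (Fin n) ℂ × (Fin n → ℂ),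
      HasDerivAt (fun s : ℂ => Ψ (y (chartData t u + s • δ))) v 0 ∧
      v.1 * Matrix.diagonal u.1 - Matrix.diagonal u.1 * v.1 + Matrix.diagonal v.2 = δ.X := by
    intro δ
    have hyl : HasDerivAt (fun s : ℂ => y (chartData t u + s • δ)) (y δ) 0 := by
      refine HasDerivAt.prodMk (hasDerivAt_line (chartData t u).X δ.X) (hasDerivAt_pi.mpr fun i => ?_)
      exact hasDerivAt_matrix.mp (hasDerivAt_line (chartData t u).V δ.V) i 0
    refine ⟨_, hasDerivAt_comp_of_analyticAt aΨ hyl (by rw [zero_smul, add_zero, hy0]), ?_⟩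
    exact congrArg Prod.fst ((fderiv_diagConj u.1 _).symm.trans (dΨ (y δ)))
  -- First-order perturbation theory: the eigenvalues move by δX_ii and the off-diagonal part of δg
  -- is δX_ij/(x_j - x_i). The diagonal part of δg is not needed, since it cancels in the diagonal
  -- entries of g⁻¹Zg.
  have hxi : ∀ (δ : TadData n) (v : Matrix (Fin n) (Fin n) ℂ × (Fin n → ℂ)),
      v.1 * Matrix.diagonal u.1 - Matrix.diagonal u.1 * v.1 + Matrix.diagonal v.2 = δ.X →
      (∀ i, v.2 i = δ.X i i) ∧ ∀ i j, i ≠ j → v.1 i j = δ.X i j / (u.1 j - u.1 i) := by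
    intro δ v h
    refine ⟨fun i => ?_, fun i j hij => ?_⟩
    · rw [← h]
      simp only [Matrix.add_apply, Matrix.sub_apply, Matrix.mul_diagonal, Matrix.diagonal_mul,
        Matrix.diagonal_apply_eq]
      ring
    · rw [eq_div_iff (sub_ne_zero.mpr (hxne j i hij.symm)), ← h]
      simp only [Matrix.add_apply, Matrix.sub_apply, Matrix.mul_diagonal, Matrix.diagonal_mul,
        Matrix.diagonal_apply_ne _ hij]
      ring
  refine ⟨fun i δ => ?_, fun j δ => ?_⟩
  · obtain ⟨v, hv, hv'⟩ := curve δ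
    refine fderiv_apply_eq (analyticAt_pi_iff.mp (analyticAt_fst.comp aF) i)
      (γ := fun s => chartData t u + s • δ) (by simp) (hasDerivAt_line _ δ) ?_
    rw [← (hxi δ v hv').1]
    exact hasDerivAt_pi.mp (hasDerivAt_snd_comp hv) i
  · obtain ⟨v, hv, hv'⟩ := curve δ
    obtain ⟨e1, e2⟩ := hxi δ v hv'
    have dg : HasDerivAt (fun s : ℂ => (Ψ (y (chartData t u + s • δ))).1) v.1 0 :=
      hasDerivAt_fst_comp hv
    have dx : HasDerivAt (fun s : ℂ => (Ψ (y (chartData t u + s • δ))).2) v.2 0 :=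
      hasDerivAt_snd_comp hv
    have dgi := hasDerivAt_matInv dg (by rw [zero_smul, add_zero]; exact hgu)
    have dXi : HasDerivAt (fun s : ℂ => (chartData t u + s • δ).X⁻¹)
        (-((Matrix.diagonal u.1)⁻¹ * δ.X * (Matrix.diagonal u.1)⁻¹)) 0 := by
      have := hasDerivAt_matInv (hasDerivAt_line (chartData t u).X δ.X) (by simpa using hX)
      simp only [zero_smul, add_zero] at this
      exact this
    have dZ : HasDerivAt (fun s : ℂ => (chartData t u + s • δ).Z)
        (δ.Y - (Matrix.diagonal u.1)⁻¹ * δ.X * (Matrix.diagonal u.1)⁻¹) 0 := by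
      rw [sub_eq_add_neg]
      exact (hasDerivAt_line (chartData t u).Y δ.Y).fun_add dXi
    have dB := hasDerivAt_matMul (hasDerivAt_matMul dgi dZ) dg
    simp only [zero_smul, add_zero, hg0, inv_one, one_mul, mul_one, chartData_Z] at dB
    have dw : HasDerivAt (fun s : ℂ => laxWeight t (Ψ (y (chartData t u + s • δ))).2 j)
        (fderiv ℂ (fun x => laxWeight t x j) u.1 v.2) 0 :=
      hasDerivAt_comp_of_analyticAt (g := fun x => laxWeight t x j) (aw j) dx (by rw [zero_smul, add_zero, hx0])
    have hwj := laxWeight_ne_zero hu j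
    have dq := (hasDerivAt_matrix.mp dB j j).fun_div dw (by
      rw [zero_smul, add_zero]; exact hw0 j)
    refine fderiv_apply_eq (analyticAt_pi_iff.mp (analyticAt_snd.comp aF) j)
      (γ := fun s => chartData t u + s • δ) (by simp) (hasDerivAt_line _ δ) ?_
    refine HasDerivAt.congr_deriv dq ?_
    simp only [zero_smul, add_zero, hg0, hx0, inv_one, one_mul, mul_one, chartData_Z]
    have ew : fderiv ℂ (fun x => laxWeight t x j) u.1 v.2
        = ∑ k, fderiv ℂ (fun x => laxWeight t x j) u.1 (Pi.single k 1) * δ.X k k := by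
      conv_lhs => rw [pi_eq_sum_univ' v.2]
      rw [map_sum]
      refine Finset.sum_congr rfl fun k _ => ?_
      rw [map_smul, smul_eq_mul, e1, mul_comm]
    have eB : (-v.1 * laxMatrix t u + laxMatrix t u * v.1) j j
        = (eigenGradient u.1 (laxMatrix t u) j * δ.X).trace := by
      rw [eigenGradient_trace, Matrix.add_apply, Matrix.mul_apply, Matrix.mul_apply,
        ← Finset.sum_add_distrib]
      refine Finset.sum_congr rfl fun k _ => ?_
      by_cases hk : k = j
      -- The term k = j vanishes on both sides: the two products in the commutator cancel, and the
      -- gradient has the denominator x_j - x_j, for which division returns 0.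
      · subst hk
        simp only [Matrix.neg_apply, sub_self, div_zero, zero_mul, add_zero]
        ring
      · have h1 := sub_ne_zero.mpr (hxne j k (Ne.symm hk))
        have h2 := sub_ne_zero.mpr (hxne k j hk)
        rw [Matrix.neg_apply, e2 j k (Ne.symm hk), e2 k j hk,
          ← neg_sub (u.1 j) (u.1 k)]
        field_simp
        ring
    rw [ew, ← eB, laxMatrix_diag ht1 hu]
    simp only [Matrix.add_apply]
    field_simp
    ring

end

end LocalCoordinates

/-! ### Brackets of the coordinates -/

section CoordinateBrackets

variable {n : ℕ} {t : ℂ}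

/-- The bracket of two invariant functions of `X` and `Z`. -/
theorem two_mul_tadBivector_of_XZ {p : TadData n} (hp : p ∈ tadRep n t)
    {l₁ l₂ : TadData n →L[ℂ] ℂ} (h₁ : TadHorizontal p l₁) (h₂ : TadHorizontal p l₂)
    {a₁ b₁ a₂ b₂ : Matrix (Fin n) (Fin n) ℂ}
    (e₁ : ∀ δ, l₁ δ = (a₁ * δ.X).trace + (b₁ * (δ.Y - p.X⁻¹ * δ.X * p.X⁻¹)).trace)
    (e₂ : ∀ δ, l₂ δ = (a₂ * δ.X).trace + (b₂ * (δ.Y - p.X⁻¹ * δ.X * p.X⁻¹)).trace) :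
    2 * tadBivector p l₁ l₂ = (b₂ * (p.Z * p.X * a₁ + a₁ * (p.X * p.Z))).trace
      - (b₁ * (p.Z * p.X * a₂ + a₂ * (p.X * p.Z))).trace := by
  obtain ⟨uX, -, hXZ, hZX⟩ := tadRep_units hp
  have hXd := (Matrix.isUnit_iff_isUnit_det _).mp uX
  have grad : ∀ {l : TadData n →L[ℂ] ℂ} {a b : Matrix (Fin n) (Fin n) ℂ}, TadHorizontal p l →
      (∀ δ, l δ = (a * δ.X).trace + (b * (δ.Y - p.X⁻¹ * δ.X * p.X⁻¹)).trace) →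
      tadDx l = a - p.X⁻¹ * b * p.X⁻¹ ∧ tadDy l = b ∧ tadDv l = 0 ∧ tadDw l = 0 ∧
        tadFv l p = 0 ∧ tadFy l p = -tadFx l p := by
    intro l a b h e
    obtain ⟨d1, d2, d3, d4⟩ := tadGradient_eq (l := l) (a := a - p.X⁻¹ * b * p.X⁻¹) (b := b)
      (v := 0) (w := 0) fun δ => by
        have c : (b * (p.X⁻¹ * δ.X * p.X⁻¹)).trace = (p.X⁻¹ * b * p.X⁻¹ * δ.X).trace := by
          rw [← Matrix.mul_assoc b, Matrix.trace_mul_comm]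
          simp only [Matrix.mul_assoc]
        rw [e, mul_sub, sub_mul, Matrix.trace_sub, Matrix.trace_sub, c, Matrix.zero_mul,
          Matrix.zero_mul, Matrix.trace_zero, Matrix.trace_zero]
        ring
    have hv : tadFv l p = 0 := by
      rw [tadFv, d3, d4, Matrix.zero_mul, Matrix.mul_zero, sub_zero]
    refine ⟨d1, d2, d3, d4, hv, ?_⟩
    have h : tadFx l p + tadFy l p + tadFv l p = 0 := h
    rw [hv, add_zero] at h
    exact eq_neg_of_add_eq_zero_right h
  obtain ⟨x1, y1, v1, w1, f1, g1⟩ := grad h₁ e₁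
  obtain ⟨x2, y2, v2, w2, f2, g2⟩ := grad h₂ e₂
  have key : ∀ a b c : Matrix (Fin n) (Fin n) ℂ,
      (p.Z * p.X * (a - p.X⁻¹ * b * p.X⁻¹) * c).trace
        = (c * (p.Z * p.X * a)).trace - (p.Z * b * p.X⁻¹ * c).trace := by
    intro a b c
    rw [Matrix.trace_mul_comm, mul_sub, mul_sub, Matrix.trace_sub,
      Matrix.trace_mul_comm c (p.Z * p.X * (p.X⁻¹ * b * p.X⁻¹))]
    congr 2
    simp only [Matrix.mul_assoc, Matrix.mul_nonsing_inv_cancel_left _ _ hXd]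
  have key' : ∀ a b c : Matrix (Fin n) (Fin n) ℂ,
      (p.X * p.Z * c * (a - p.X⁻¹ * b * p.X⁻¹)).trace
        = (c * (a * (p.X * p.Z))).trace - (p.Z * c * p.X⁻¹ * b).trace := by
    intro a b c
    have c1 : (p.X * p.Z * c * a).trace = (c * (a * (p.X * p.Z))).trace := by
      rw [Matrix.mul_assoc, Matrix.trace_mul_comm, Matrix.mul_assoc]
    have c2 : (p.X * p.Z * c * (p.X⁻¹ * b * p.X⁻¹)).trace = (p.Z * c * p.X⁻¹ * b).trace := by
      have : p.X * p.Z * c * (p.X⁻¹ * b * p.X⁻¹) = p.X * (p.Z * c * p.X⁻¹ * b * p.X⁻¹) := by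
        simp only [Matrix.mul_assoc]
      rw [this, Matrix.trace_mul_comm, Matrix.nonsing_inv_mul_cancel_right _ _ hXd]
    rw [mul_sub, Matrix.trace_sub, c1, c2]
  -- With F_v = 0 and F_y = -F_x the only cross term is -tr(F_x F_x), symmetric in the two
  -- covectors, so just the terms of the double derivations remain.
  rw [tadBivector, tadPre, tadPre, x1, y1, v1, w1, f1, g1, x2, y2, v2, w2, f2, g2, hXZ, hZX, key,
    key', key, key', mul_add, mul_add, Matrix.trace_add, Matrix.trace_add, mul_neg, mul_neg,
    Matrix.trace_neg, Matrix.trace_neg, Matrix.trace_mul_comm (tadFx l₂ p)]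
  simp only [Matrix.mul_zero, Matrix.trace_zero]
  ring

/-- For i ≠ j only the factor with k = i involves x_i. It equals (x_i - t x_j)/(x_i - x_j), and the
bracket on the right is its logarithmic derivative. -/
theorem fderiv_laxWeight_single {u : (Fin n → ℂ) × (Fin n → ℂ)} (hu : u ∈ coordDomain n t)
    {i j : Fin n} (hij : i ≠ j) :
    fderiv ℂ (fun x => laxWeight t x j) u.1 (Pi.single i 1)
      = laxWeight t u.1 j * ((u.1 i - t * u.1 j)⁻¹ - (u.1 i - u.1 j)⁻¹) := by
  have h1 := sub_ne_zero.mpr (hu.2.2 i j hij).1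
  have h2 := sub_ne_zero.mpr (hu.2.2 i j hij).2
  have hi := hu.1 i
  have hmem : i ∈ Finset.univ.erase j := Finset.mem_erase.mpr ⟨hij, Finset.mem_univ i⟩
  refine fderiv_apply_eq (analyticAt_laxWeight hu.1 (fun i j h => (hu.2.2 i j h).1) j)
    (γ := fun s => u.1 + s • Pi.single i 1) (by simp) (hasDerivAt_line _ _) ?_
  have e : ∀ s : ℂ, laxWeight t (u.1 + s • Pi.single i 1) j
      = (1 - t * u.1 j / (u.1 i + s)) / (1 - u.1 j / (u.1 i + s))
        * ∏ k ∈ (Finset.univ.erase j).erase i, (1 - t * u.1 j / u.1 k) / (1 - u.1 j / u.1 k) := by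
    intro s
    rw [laxWeight, ← Finset.mul_prod_erase _ _ hmem]
    congr 1
    · simp [Pi.single_eq_of_ne hij.symm]
    · refine Finset.prod_congr rfl fun k hk => ?_
      simp [Pi.single_eq_of_ne hij.symm, Pi.single_eq_of_ne (Finset.ne_of_mem_erase hk)]
  have e0 : laxWeight t u.1 j = (1 - t * u.1 j / u.1 i) / (1 - u.1 j / u.1 i)
        * ∏ k ∈ (Finset.univ.erase j).erase i, (1 - t * u.1 j / u.1 k) / (1 - u.1 j / u.1 k) :=
    (Finset.mul_prod_erase _ _ hmem).symm
  simp only [e]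
  rw [e0]
  have d : HasDerivAt (fun s : ℂ => u.1 i + s) 1 0 := (hasDerivAt_id 0).const_add _
  have hne : u.1 i + 0 ≠ 0 := by rwa [add_zero]
  have hden : 1 - u.1 j / (u.1 i + 0) ≠ 0 := by
    rw [add_zero, one_sub_div hi]
    exact div_ne_zero h1 hi
  have dq := ((((hasDerivAt_const (0 : ℂ) (t * u.1 j)).fun_div d hne).const_sub 1).fun_div
    (((hasDerivAt_const (0 : ℂ) (u.1 j)).fun_div d hne).const_sub 1) hden).mul_const
    (∏ k ∈ (Finset.univ.erase j).erase i, (1 - t * u.1 j / u.1 k) / (1 - u.1 j / u.1 k))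
  refine HasDerivAt.congr_deriv dq ((congrArg (· * _) ?_).trans (mul_right_comm _ _ _))
  rw [add_zero, one_sub_div hi, one_sub_div hi]
  field_simp
  ring

theorem trace_single_mul (M : Matrix (Fin n) (Fin n) ℂ) (i j : Fin n) :
    (Matrix.single i j 1 * M).trace = M j i := by
  rw [Matrix.trace_mul_comm, Matrix.trace_mul_single, MulOpposite.op_one, one_smul]

/-- In the variables X, Z the coordinate x_i has no Z-gradient, which settles {x_i, x_j}, and the
Z-gradient of σ_j is a multiple of the matrix unit E_jj, which settles {x_i, σ_j}. For {σ_i, σ_j}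
the derivatives of the weights compensate the rotation of the eigenvectors; this is the purpose of
the product in the Lax matrix. -/
theorem tadBivector_coordinates (ht0 : t ≠ 0) (ht1 : t ≠ 1) {u : (Fin n → ℂ) × (Fin n → ℂ)}
    (hu : u ∈ coordDomain n t) {lx ls : Fin n → TadData n →L[ℂ] ℂ}
    (hx : ∀ i, TadHorizontal (chartData t u) (lx i))
    (hs : ∀ i, TadHorizontal (chartData t u) (ls i)) (ex : ∀ i δ, lx i δ = δ.X i i)
    (es : ∀ j δ, ls j δ
        = (laxWeight t u.1 j)⁻¹ * ((δ.Y - (Matrix.diagonal u.1)⁻¹ * δ.X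
            * (Matrix.diagonal u.1)⁻¹) j j
          + (eigenGradient u.1 (laxMatrix t u) j * δ.X).trace
          - u.2 j * ∑ k, fderiv ℂ (fun x => laxWeight t x j) u.1 (Pi.single k 1) * δ.X k k))
    (i j : Fin n) :
    tadBivector (chartData t u) (lx i) (lx j) = 0 ∧
    tadBivector (chartData t u) (lx i) (ls j) = (if i = j then u.1 i * u.2 j else 0) ∧
    tadBivector (chartData t u) (ls i) (ls j) = 0 := by
  have hp := chartData_mem ht0 ht1 hu
  let a : Fin n → Matrix (Fin n) (Fin n) ℂ := fun j => (laxWeight t u.1 j)⁻¹ •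
    (eigenGradient u.1 (laxMatrix t u) j - u.2 j •
      Matrix.diagonal fun k => fderiv ℂ (fun x => laxWeight t x j) u.1 (Pi.single k 1))
  let b : Fin n → Matrix (Fin n) (Fin n) ℂ := fun j => (laxWeight t u.1 j)⁻¹ • Matrix.single j j 1
  have ex' : ∀ i δ, lx i δ = (Matrix.single i i 1 * δ.X).trace
      + (0 * (δ.Y - (chartData t u).X⁻¹ * δ.X * (chartData t u).X⁻¹)).trace := fun i δ => by
    rw [ex, trace_single_mul, zero_mul, Matrix.trace_zero, add_zero]
  have es' : ∀ j δ, ls j δ = (a j * δ.X).trace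
      + (b j * (δ.Y - (chartData t u).X⁻¹ * δ.X * (chartData t u).X⁻¹)).trace := fun j δ => by
    have e : (Matrix.diagonal (fun k => fderiv ℂ (fun x => laxWeight t x j) u.1 (Pi.single k 1))
        * δ.X).trace = ∑ k, fderiv ℂ (fun x => laxWeight t x j) u.1 (Pi.single k 1) * δ.X k k :=
      Finset.sum_congr rfl fun k _ => Matrix.diagonal_mul _ _ _ _
    rw [es, ← e, Matrix.smul_mul, Matrix.smul_mul, Matrix.trace_smul, Matrix.trace_smul,
      trace_single_mul, sub_mul, Matrix.smul_mul, Matrix.trace_sub, Matrix.trace_smul]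
    simp only [smul_eq_mul]
    rw [show (chartData t u).X = Matrix.diagonal u.1 from rfl]
    ring
  have trb : ∀ (j : Fin n) (c : Matrix (Fin n) (Fin n) ℂ), (b j * ((chartData t u).Z
      * (chartData t u).X * c + c * ((chartData t u).X * (chartData t u).Z))).trace
      = (laxWeight t u.1 j)⁻¹ * ∑ k, u.1 k * (laxMatrix t u j k * c k j + laxMatrix t u k j * c j k) := by
    intro j c
    rw [Matrix.smul_mul, Matrix.trace_smul, trace_single_mul, smul_eq_mul, Matrix.add_apply,
      Matrix.mul_apply, Matrix.mul_apply, ← Finset.sum_add_distrib, chartData_Z]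
    congr 1
    refine Finset.sum_congr rfl fun k _ => ?_
    change (laxMatrix t u * Matrix.diagonal u.1) j k * _
      + _ * (Matrix.diagonal u.1 * laxMatrix t u) k j = _
    rw [Matrix.mul_diagonal, Matrix.diagonal_mul]
    ring
  refine ⟨?_, ?_, ?_⟩
  · have h := two_mul_tadBivector_of_XZ hp (hx i) (hx j) (ex' i) (ex' j)
    rw [zero_mul, zero_mul, sub_self] at h
    exact (mul_eq_zero.mp h).resolve_left two_ne_zero
  · have h := two_mul_tadBivector_of_XZ hp (hx i) (hs j) (ex' i) (es' j)
    rw [zero_mul, Matrix.trace_zero, sub_zero, trb] at h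
    refine mul_left_cancel₀ two_ne_zero (h.trans ?_)
    split_ifs with hij
    · subst hij
      rw [Finset.sum_eq_single i (fun k _ hk => by
        rw [Matrix.single_apply_of_row_ne hk.symm, Matrix.single_apply_of_col_ne _ _ hk.symm,
          mul_zero, mul_zero, add_zero, mul_zero]) (by simp), Matrix.single_apply_same,
        laxMatrix_diag ht1 hu]
      have := laxWeight_ne_zero hu i
      field_simp
      ring
    · rw [Finset.sum_eq_zero fun k _ => by
        rw [Matrix.single_apply_of_col_ne _ _ hij, Matrix.single_apply_of_row_ne hij,
          mul_zero, mul_zero, add_zero, mul_zero], mul_zero, mul_zero]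
  · have h := two_mul_tadBivector_of_XZ hp (hs i) (hs j) (es' i) (es' j)
    rw [trb, trb] at h
    refine mul_left_cancel₀ two_ne_zero (h.trans ?_)
    rw [mul_zero, sub_eq_zero]
    by_cases hij : i = j
    · subst hij; rfl
    -- In row and column j the X-gradient of σ_i has support at the index i, from the eigenvectors,
    -- and at j, from the weight; so only two summands survive.
    have off : ∀ i j : Fin n, i ≠ j →
        ∑ k, u.1 k * (laxMatrix t u j k * a i k j + laxMatrix t u k j * a i j k)
          = 2 * (laxWeight t u.1 i)⁻¹ * (u.1 i * laxMatrix t u j i * laxMatrix t u i j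
              / (u.1 i - u.1 j) - u.2 i * u.1 j * laxMatrix t u j j
                * fderiv ℂ (fun x => laxWeight t x i) u.1 (Pi.single j 1)) := by
      intro i j hij
      have h1 : ∀ k, a i k j = (laxWeight t u.1 i)⁻¹ * ((if k = i then laxMatrix t u i j
          / (u.1 i - u.1 j) else 0) - if k = j then u.2 i * fderiv ℂ (fun x => laxWeight t x i) u.1
            (Pi.single j 1) else 0) := fun k => by
        simp only [a, eigenGradient, Matrix.smul_apply, Matrix.sub_apply, Matrix.of_apply,
          Matrix.diagonal_apply, smul_eq_mul, if_neg hij.symm, add_zero, mul_ite, mul_zero]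
        split_ifs with h h' <;> simp_all
      have h2 : ∀ k, a i j k = (laxWeight t u.1 i)⁻¹ * ((if k = i then laxMatrix t u j i
          / (u.1 i - u.1 j) else 0) - if k = j then u.2 i * fderiv ℂ (fun x => laxWeight t x i) u.1
            (Pi.single j 1) else 0) := fun k => by
        simp only [a, eigenGradient, Matrix.smul_apply, Matrix.sub_apply, Matrix.of_apply,
          Matrix.diagonal_apply, smul_eq_mul, if_neg hij.symm, zero_add, mul_ite, mul_zero,
          eq_comm (a := j) (b := k)]
      simp only [h1, h2]
      have h3 : ∀ k, u.1 k * (laxMatrix t u j k * ((laxWeight t u.1 i)⁻¹ * ((if k = i then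
            laxMatrix t u i j / (u.1 i - u.1 j) else 0) - if k = j then u.2 i *
            fderiv ℂ (fun x => laxWeight t x i) u.1 (Pi.single j 1) else 0)) + laxMatrix t u k j *
            ((laxWeight t u.1 i)⁻¹ * ((if k = i then laxMatrix t u j i / (u.1 i - u.1 j) else 0)
            - if k = j then u.2 i * fderiv ℂ (fun x => laxWeight t x i) u.1 (Pi.single j 1)
              else 0)))
          = (if k = i then 2 * (laxWeight t u.1 i)⁻¹ * (u.1 i * laxMatrix t u j i
              * laxMatrix t u i j / (u.1 i - u.1 j)) else 0)
            - if k = j then 2 * (laxWeight t u.1 i)⁻¹ * (u.2 i * u.1 j * laxMatrix t u j j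
                * fderiv ℂ (fun x => laxWeight t x i) u.1 (Pi.single j 1)) else 0 := by
        intro k
        by_cases h : k = i
        · subst h
          simp only [if_true, if_neg hij]
          ring
        · by_cases h' : k = j
          · subst h'
            simp only [if_true, if_neg h]
            ring
          · simp only [if_neg h, if_neg h']
            ring
      simp only [h3, Finset.sum_sub_distrib, Finset.sum_ite_eq', Finset.mem_univ, if_true]
      ring
    rw [off i j hij, off j i (Ne.symm hij), fderiv_laxWeight_single hu hij,
      fderiv_laxWeight_single hu (Ne.symm hij), laxMatrix_diag ht1 hu, laxMatrix_diag ht1 hu,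
      laxMatrix_apply ht1 hu, laxMatrix_apply ht1 hu, laxRow, laxRow]
    have n1 := sub_ne_zero.mpr (hu.2.2 i j hij).1
    have n2 := mul_sub_ne_zero ht1 hu i j
    have n3 := mul_sub_ne_zero ht1 hu j i
    have w1 := laxWeight_ne_zero hu i
    have w2 := laxWeight_ne_zero hu j
    -- Orienting all differences alike leaves the three denominators x_i - x_j, t x_j - x_i and t
    -- x_i - x_j, after which the symmetry in i and j is a polynomial identity.
    rw [← neg_sub (u.1 i) (u.1 j), ← neg_sub (t * u.1 i) (u.1 j), ← neg_sub (t * u.1 j) (u.1 i)]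
    clear_value a b
    generalize laxWeight t u.1 i = P at w1 ⊢
    generalize laxWeight t u.1 j = Q at w2 ⊢
    generalize hD : u.1 i - u.1 j = D at n1 ⊢
    generalize hE : t * u.1 j - u.1 i = E at n2 ⊢
    generalize hG : t * u.1 i - u.1 j = G at n3 ⊢
    field_simp
    rw [← hD, ← hE, ← hG]
    ring

end CoordinateBrackets

/-! ### The chart -/

section LogCanonicalChart

variable {n : ℕ} {t : ℂ}

/-- The saturation of an open set is a union of its translates under the group, each of which is
open. -/
theorem isOpenMap_tadMk (ht0 : t ≠ 0) : IsOpenMap (Quotient.mk (tadSetoid n t)) := by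
  intro U hU
  let A : GL (Fin n) ℂ → tadRep n t → tadRep n t := fun g p =>
    ⟨tadAct g p.1, tadAct_mem ht0 g p.2⟩
  have hA : ∀ g, Continuous (A g) := fun g =>
    ((tadActL g).continuous.comp continuous_subtype_val).subtype_mk _
  have e : Quotient.mk (tadSetoid n t) ⁻¹' (Quotient.mk (tadSetoid n t) '' U) = ⋃ g, A g ⁻¹' U := by
    ext p
    simp only [Set.mem_preimage, Set.mem_image, Set.mem_iUnion]
    constructor
    · rintro ⟨p', hp', h⟩
      obtain ⟨g, hg⟩ := Quotient.exact h.symm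
      refine ⟨g, ?_⟩
      have : A g p = p' := Subtype.ext hg.symm
      rwa [this]
    · rintro ⟨g, hg⟩
      exact ⟨_, hg, Eq.symm (Quotient.sound ⟨g, rfl⟩)⟩
  rw [← isQuotientMap_quotient_mk'.isOpen_preimage]
  change IsOpen (Quotient.mk (tadSetoid n t) ⁻¹' _)
  rw [e]
  exact isOpen_iUnion fun g => hU.preimage (hA g)

/-- An isomorphism intertwines the two diagonal matrices. `hne` excludes a relabelling of the
eigenvalues, so it is diagonal, and since it fixes (1, …, 1)ᵀ it is the identity. Globally the chart
is only injective up to permutations. -/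
theorem eq_of_mk_chartData_eq (ht0 : t ≠ 0) (ht1 : t ≠ 1) {u u' : (Fin n → ℂ) × (Fin n → ℂ)}
    (hu : u ∈ coordDomain n t) (hu' : u' ∈ coordDomain n t)
    (hne : ∀ i j, i ≠ j → u.1 i ≠ u'.1 j)
    (h : Quotient.mk (tadSetoid n t) ⟨chartData t u, chartData_mem ht0 ht1 hu⟩
      = Quotient.mk _ ⟨chartData t u', chartData_mem ht0 ht1 hu'⟩) : u = u' := by
  obtain ⟨g, hg⟩ := Quotient.exact h
  have hg : chartData t u' = tadAct g (chartData t u) := hg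
  have eX : Matrix.diagonal u'.1 * g.1 = g.1 * Matrix.diagonal u.1 := by
    have e : Matrix.diagonal u'.1 = g.1 * Matrix.diagonal u.1 * g⁻¹.1 := congrArg TadData.X hg
    have c : g⁻¹.1 * g.1 = 1 := g.inv_mul
    rw [e, Matrix.mul_assoc, c, Matrix.mul_one]
  have off : ∀ i j, i ≠ j → g.1 i j = 0 := by
    intro i j hij
    have := congrFun (congrFun eX i) j
    rw [Matrix.diagonal_mul, Matrix.mul_diagonal] at this
    have h0 : (u.1 j - u'.1 i) * g.1 i j = 0 := by linear_combination -this
    exact (mul_eq_zero.mp h0).resolve_left (sub_ne_zero.mpr (hne j i hij.symm))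
  have hg1 : g = 1 := by
    refine Units.ext (Matrix.ext fun i j => ?_)
    by_cases hij : i = j
    · subst hij
      have e : (Matrix.of fun (_ : Fin n) (_ : Fin 1) => (1 : ℂ))
          = g.1 * Matrix.of fun (_ : Fin n) (_ : Fin 1) => (1 : ℂ) := congrArg TadData.V hg
      have e := congrFun (congrFun e i) 0
      rw [Matrix.mul_apply, Finset.sum_eq_single i (fun k _ hk => by
        rw [off i k hk.symm, zero_mul]) (by simp), Matrix.of_apply, mul_one] at e
      rw [← e, Units.val_one, Matrix.one_apply_eq]
    · rw [off i j hij, Units.val_one, Matrix.one_apply_ne hij]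
  rw [hg1, tadAct_one] at hg
  have e1 : u.1 = u'.1 := Matrix.diagonal_injective (congrArg TadData.X hg.symm)
  refine Prod.ext e1 (funext fun j => ?_)
  have e2 : laxMatrix t u = laxMatrix t u' := by
    rw [← chartData_Z, ← chartData_Z, hg]
  have e3 := congrFun (congrFun e2 j) j
  rw [laxMatrix_diag ht1 hu, laxMatrix_diag ht1 hu', ← e1] at e3
  exact mul_right_cancel₀ (laxWeight_ne_zero hu j) e3

variable {ζ : (Fin n → ℂ) × (Fin n → ℂ) → TadSpace n t}

/-- Openness of the chart: the coordinates of `exists_localCoordinates` give a preimage for every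
nearby point of the locus, and the quotient map is open. -/
theorem eventually_exists_chart (ht0 : t ≠ 0) (ht1 : t ≠ 1)
    (hζ : ∀ u (hu : u ∈ coordDomain n t),
      ζ u = Quotient.mk _ ⟨chartData t u, chartData_mem ht0 ht1 hu⟩)
    {u : (Fin n → ℂ) × (Fin n → ℂ)} (hu : u ∈ coordDomain n t)
    {N : Set ((Fin n → ℂ) × (Fin n → ℂ))} (hN : N ∈ 𝓝 u) :
    ∀ᶠ c in 𝓝 (ζ u), ∃ u' ∈ N, ζ u' = c := by
  obtain ⟨F, aF, F0, hF, -⟩ := exists_localCoordinates ht0 ht1 hu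
  have h1 : ∀ᶠ p in 𝓝 (chartData t u), F p ∈ N :=
    aF.continuousAt.eventually (by rw [F0]; exact hN)
  rw [hζ u hu]
  refine (isOpenMap_tadMk ht0).nhds_le _ ?_
  rw [Filter.mem_map]
  have h2 : Filter.Tendsto (Subtype.val : tadRep n t → TadData n)
      (𝓝 ⟨chartData t u, chartData_mem ht0 ht1 hu⟩) (𝓝 (chartData t u)) :=
    continuous_subtype_val.tendsto _
  filter_upwards [h2.eventually (h1.and hF)] with p hp
  obtain ⟨hD, g, hg⟩ := hp.2 p.2
  exact ⟨F p.1, hp.1, (hζ _ hD).trans (Quotient.sound ⟨g, hg⟩)⟩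

theorem analyticAt_comp_chart (ht0 : t ≠ 0) (ht1 : t ≠ 1)
    (hζ : ∀ u (hu : u ∈ coordDomain n t),
      ζ u = Quotient.mk _ ⟨chartData t u, chartData_mem ht0 ht1 hu⟩)
    {u : (Fin n → ℂ) × (Fin n → ℂ)} (hu : u ∈ coordDomain n t) {f : TadSpace n t → ℂ}
    (hf : HolomorphicAt f (ζ u)) : AnalyticAt ℂ (f ∘ ζ) u := by
  rw [hζ u hu] at hf
  obtain ⟨F, hF⟩ := exists_lift_of_holomorphicAt ht0 hf
  rw [isLiftAt_iff] at hF
  have aC := analyticAt_chartData ht0 ht1 hu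
  have aF : AnalyticAt ℂ F (chartData t u) := hF.1
  refine (aF.comp aC).congr ?_
  filter_upwards [aC.continuousAt.eventually hF.2, (isOpen_coordDomain n t).mem_nhds hu]
    with u' h1 h2
  rw [Function.comp_apply, Function.comp_apply, h1 (chartData_mem ht0 ht1 h2), hζ u' h2]

/-- The brackets of the components of a local inverse of the chart. -/
theorem hasBracketAt_coordinates (ht0 : t ≠ 0) (ht : ∀ k : ℕ, 0 < k → t ^ k ≠ 1) (ht1 : t ≠ 1)
    (hζ : ∀ u (hu : u ∈ coordDomain n t),
      ζ u = Quotient.mk _ ⟨chartData t u, chartData_mem ht0 ht1 hu⟩)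
    {N : Set ((Fin n → ℂ) × (Fin n → ℂ))} (hNo : IsOpen N)
    {φ : TadSpace n t → (Fin n → ℂ) × (Fin n → ℂ)} (hφ : ∀ u' ∈ N, φ (ζ u') = u')
    {u' : (Fin n → ℂ) × (Fin n → ℂ)} (hu' : u' ∈ N) (hD : u' ∈ coordDomain n t) (i j : Fin n) :
    HasBracketAt tadBivector (fun c => (φ c).1 i) (fun c => (φ c).1 j) (ζ u') 0 ∧
    HasBracketAt tadBivector (fun c => (φ c).1 i) (fun c => (φ c).2 j) (ζ u')
      (if i = j then u'.1 i * u'.2 j else 0) ∧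
    HasBracketAt tadBivector (fun c => (φ c).2 i) (fun c => (φ c).2 j) (ζ u') 0 := by
  obtain ⟨F, aF, F0, hF, dx, dσ⟩ := exists_localCoordinates ht0 ht1 hD
  -- On the locus ζ (F p) is the class of p, and φ inverts ζ on N; so the components of F are lifts
  -- of those of φ, with known derivatives.
  have lift : ∀ᶠ p in 𝓝 (chartData t u'), ∀ hp : p ∈ tadRep n t,
      F p = φ (Quotient.mk _ ⟨p, hp⟩) := by
    filter_upwards [hF, aF.continuousAt.eventually (by rw [F0]; exact hNo.mem_nhds hu')]
      with p h1 h2 hp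
    obtain ⟨hFD, g, hg⟩ := h1 hp
    have e : ζ (F p) = Quotient.mk (tadSetoid n t) ⟨p, hp⟩ :=
      (hζ _ hFD).trans (Quotient.sound ⟨g, hg⟩)
    rw [← e, hφ _ h2]
  have key : ∀ (p : tadRep n t) (_ : p.1 = chartData t u') (_ : Quotient.mk _ p = ζ u'),
      HasBracketAt tadBivector (fun c => (φ c).1 i) (fun c => (φ c).1 j) (ζ u') 0 ∧
      HasBracketAt tadBivector (fun c => (φ c).1 i) (fun c => (φ c).2 j) (ζ u')
        (if i = j then u'.1 i * u'.2 j else 0) ∧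
      HasBracketAt tadBivector (fun c => (φ c).2 i) (fun c => (φ c).2 j) (ζ u') 0 := by
    intro p hp hpζ
    rw [← hp] at aF lift
    have lx : ∀ i, IsLiftAt (fun c => (φ c).1 i) p (fun p => (F p).1 i) := fun i =>
      isLiftAt_iff.mpr ⟨analyticAt_pi_iff.mp (analyticAt_fst.comp aF) i,
        lift.mono fun p h hp => congrFun (congrArg Prod.fst (h hp)) i⟩
    have ls : ∀ i, IsLiftAt (fun c => (φ c).2 i) p (fun p => (F p).2 i) := fun i =>
      isLiftAt_iff.mpr ⟨analyticAt_pi_iff.mp (analyticAt_snd.comp aF) i,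
        lift.mono fun p h hp => congrFun (congrArg Prod.snd (h hp)) i⟩
    have hx := fun i => tadHorizontal_of_lift ht0 (lx i)
    have hs := fun i => tadHorizontal_of_lift ht0 (ls i)
    have hb := tadBivector_coordinates ht0 ht1 hD (lx := fun i => fderiv ℂ (fun p => (F p).1 i) p.1)
      (ls := fun i => fderiv ℂ (fun p => (F p).2 i) p.1) (by rw [← hp]; exact hx)
      (by rw [← hp]; exact hs) (by rw [hp]; exact dx) (by rw [hp]; exact dσ) i j
    rw [← hp] at hb
    obtain ⟨b1, b2, b3⟩ := hb
    have hb1 := tadHasBracketAt ht0 ht (lx i) (lx j)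
    have hb2 := tadHasBracketAt ht0 ht (lx i) (ls j)
    have hb3 := tadHasBracketAt ht0 ht (ls i) (ls j)
    rw [hpζ] at hb1 hb2 hb3
    exact ⟨b1 ▸ hb1, b2 ▸ hb2, b3 ▸ hb3⟩
  exact key ⟨chartData t u', chartData_mem ht0 ht1 hD⟩ rfl (hζ u' hD).symm

theorem isLogCanonicalChartAt_tad (ht0 : t ≠ 0) (ht : ∀ k : ℕ, 0 < k → t ^ k ≠ 1) (ht1 : t ≠ 1)
    (hζ : ∀ u (hu : u ∈ coordDomain n t),
      ζ u = Quotient.mk _ ⟨chartData t u, chartData_mem ht0 ht1 hu⟩)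
    {u : (Fin n → ℂ) × (Fin n → ℂ)} (hu : u ∈ coordDomain n t) :
    IsLogCanonicalChartAt tadBivector ζ u := by
  refine ⟨fun f hf => analyticAt_comp_chart ht0 ht1 hζ hu hf, ?_⟩
  -- The neighbourhood is taken so small that different indices never share an eigenvalue, even
  -- between two of its points; this rules out permutations and makes ζ injective on it.
  obtain ⟨M, hM, hMne⟩ : ∃ M ∈ 𝓝 u, ∀ u₁ ∈ M, ∀ u₂ ∈ M, ∀ i j : Fin n, i ≠ j → u₁.1 i ≠ u₂.1 j := by
    have h : ∀ᶠ w : ((Fin n → ℂ) × (Fin n → ℂ)) × (Fin n → ℂ) × (Fin n → ℂ) in 𝓝 u ×ˢ 𝓝 u,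
        ∀ i j : Fin n, i ≠ j → w.1.1 i ≠ w.2.1 j := by
      rw [← nhds_prod_eq]
      refine Filter.eventually_all.mpr fun i => Filter.eventually_all.mpr fun j => ?_
      by_cases hij : i = j
      · exact Filter.Eventually.of_forall fun _ h => absurd hij h
      · have c1 : Continuous fun w : ((Fin n → ℂ) × (Fin n → ℂ)) × (Fin n → ℂ) × (Fin n → ℂ) =>
            w.1.1 i := (continuous_apply i).comp (continuous_fst.comp continuous_fst)
        have c2 : Continuous fun w : ((Fin n → ℂ) × (Fin n → ℂ)) × (Fin n → ℂ) × (Fin n → ℂ) =>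
            w.2.1 j := (continuous_apply j).comp (continuous_fst.comp continuous_snd)
        filter_upwards [(isOpen_ne_fun c1 c2).mem_nhds (x := (u, u)) (hu.2.2 i j hij).1] with w hw _
        exact hw
    exact Filter.eventually_prod_self_iff.mp h
  obtain ⟨N, hNM, hNo, huN⟩ := mem_nhds_iff.mp
    (Filter.inter_mem hM ((isOpen_coordDomain n t).mem_nhds hu))
  have hND : ∀ u' ∈ N, u' ∈ coordDomain n t := fun u' h => (hNM h).2
  have inj : Set.InjOn ζ N := fun u₁ h₁ u₂ h₂ h => by
    rw [hζ _ (hND _ h₁), hζ _ (hND _ h₂)] at h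
    exact eq_of_mk_chartData_eq ht0 ht1 (hND _ h₁) (hND _ h₂) (hMne _ (hNM h₁).1 _ (hNM h₂).1) h
  let φ := Function.invFunOn ζ N
  have hφ : ∀ u' ∈ N, φ (ζ u') = u' := inj.leftInvOn_invFunOn
  refine ⟨fun i c => (φ c).1 i, fun i c => (φ c).2 i, ?_, ?_⟩
  · filter_upwards [hNo.mem_nhds huN] with u' hu' i
    rw [hφ u' hu']
    exact ⟨rfl, rfl⟩
  filter_upwards [eventually_exists_chart ht0 ht1 hζ hu (hNo.mem_nhds huN)]
  rintro _ ⟨u', hu', rfl⟩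
  have hD := hND u' hu'
  refine ⟨congrArg ζ (hφ u' hu'), fun i j => ?_⟩
  obtain ⟨b1, b2, b3⟩ := hasBracketAt_coordinates ht0 ht ht1 hζ hNo hφ hu' hD i j
  refine ⟨b1, ?_, b3⟩
  rw [hφ u' hu']
  exact b2

end LogCanonicalChart

/-! ### Transport of brackets and charts to the cyclic space -/

section Transfer

variable {m n : ℕ} [NeZero m] {q : Fin m → ℂ}

theorem holomorphicAt_comp_eta (hq : ∀ i, q i ≠ 0) {f : TadSpace n (∏ i, q i) → ℂ}
    {c : CycSpace m n q} (hf : HolomorphicAt f (eta n q hq c)) :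
    HolomorphicAt (f ∘ eta n q hq) c := by
  obtain ⟨p, rfl⟩ := Quotient.exists_rep c
  obtain ⟨F, hF⟩ := exists_lift_of_holomorphicAt (p := ⟨etaData q p.1, etaData_mem hq p.2⟩)
    (Finset.prod_ne_zero_iff.mpr fun i _ => hq i) hf
  exact ⟨p, rfl, _, isLiftAt_comp (analyticAt_etaData q hq p.2) rfl
    (fun y hy => ⟨etaData_mem hq hy, rfl⟩) hF⟩

/-- The Poisson property of ξ provides a common value of both brackets; evaluating on one pair of
tadpole lifts shows that this value is b. -/
theorem hasBracketAt_comp_eta (hq : ∀ i, q i ≠ 0)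
    (ht : ∀ k : ℕ, 0 < k → (∏ i, q i) ^ k ≠ 1) {f g : TadSpace n (∏ i, q i) → ℂ}
    {c : CycSpace m n q} {b : ℂ} (h : HasBracketAt tadBivector f g (eta n q hq c) b) :
    HasBracketAt cycBivector (f ∘ eta n q hq) (g ∘ eta n q hq) c b := by
  have ht0 : (∏ i, q i) ≠ 0 := Finset.prod_ne_zero_iff.mpr fun i _ => hq i
  obtain ⟨hf, hg, hb⟩ := h
  have hP := xi_isPoissonMap (n := n) hq ht (eta n q hq c) (f ∘ eta n q hq) (g ∘ eta n q hq)
  rw [xi_eta] at hP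
  obtain ⟨b', h1, -, -, h2⟩ := hP (holomorphicAt_comp_eta hq hf) (holomorphicAt_comp_eta hq hg)
  obtain ⟨p, hp⟩ := Quotient.exists_rep (eta n q hq c)
  rw [← hp] at hf hg
  obtain ⟨F, hF⟩ := exists_lift_of_holomorphicAt ht0 hf
  obtain ⟨G, hG⟩ := exists_lift_of_holomorphicAt ht0 hg
  have e : ∀ f : TadSpace n (∏ i, q i) → ℂ, (f ∘ eta n q hq) ∘ xi n q hq = f := fun f =>
    funext fun c => congrArg f (eta_xi q hq c)
  rw [e, e] at h2
  rwa [← hb p hp F G hF hG, h2 p hp F G hF hG]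

theorem isLogCanonicalChartAt_comp_xi (hq : ∀ i, q i ≠ 0)
    (ht : ∀ k : ℕ, 0 < k → (∏ i, q i) ^ k ≠ 1)
    {ζ : (Fin n → ℂ) × (Fin n → ℂ) → TadSpace n (∏ i, q i)} {u : (Fin n → ℂ) × (Fin n → ℂ)}
    (h : IsLogCanonicalChartAt tadBivector ζ u) :
    IsLogCanonicalChartAt cycBivector (xi n q hq ∘ ζ) u := by
  obtain ⟨hol, x, σ, h1, h2⟩ := h
  refine ⟨fun f hf => hol (f ∘ xi n q hq) ?_, fun i => x i ∘ eta n q hq,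
    fun i => σ i ∘ eta n q hq, ?_, ?_⟩
  · obtain ⟨p, hp⟩ := Quotient.exists_rep (ζ u)
    rw [Function.comp_apply, ← hp] at hf
    rw [← hp]
    obtain ⟨F, hF⟩ := exists_cycLift_of_holomorphicAt
      (p := ⟨xiData q p.1, xiData_mem hq p.2⟩) hf
    exact ⟨p, rfl, _, isLiftAt_comp_xiData hq hF⟩
  · filter_upwards [h1] with u' hu' i
    simpa only [Function.comp_apply, eta_xi] using hu' i
  · have hc : ∀ᶠ c in 𝓝 ((xi n q hq ∘ ζ) u), _ :=
      (continuous_eta q hq).continuousAt.eventually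
        (by rw [Function.comp_apply, eta_xi]; exact h2)
    filter_upwards [hc] with c hc
    refine ⟨?_, fun i j => ?_⟩
    · exact (congrArg (xi n q hq) hc.1).trans (xi_eta q hq c)
    · obtain ⟨b1, b2, b3⟩ := hc.2 i j
      exact ⟨hasBracketAt_comp_eta hq ht b1, hasBracketAt_comp_eta hq ht b2,
        hasBracketAt_comp_eta hq ht b3⟩

end Transfer
end CalogeroMoser

theorem proposition4p7 (m n : ℕ) [NeZero m] (hm : 2 ≤ m) (hn : 0 < n) (q : Fin m → ℂ)
    (hq : RegularParam q) :
    Function.Bijective (xi n q hq.1) ∧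
    (∀ f : CycSpace m n q → ℂ,
      IsRegularFunction (cycRing m n q) f ↔ IsRegularFunction (tadRing n (∏ i, q i)) (f ∘ xi n q hq.1)) ∧
    (∀ f g : CycSpace m n q → ℂ,
      IsRegularFunction (cycRing m n q) f → IsRegularFunction (cycRing m n q) g →
        ∀ c : TadSpace n (∏ i, q i), ∃ b : ℂ,
          HasBracketAt cycBivector f g (xi n q hq.1 c) b ∧
          HasBracketAt tadBivector (f ∘ xi n q hq.1) (g ∘ xi n q hq.1) c b) ∧
    IsPoissonMap tadBivector cycBivector (xi n q hq.1) ∧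
    ∃ ζ : (Fin n → ℂ) × (Fin n → ℂ) → TadSpace n (∏ i, q i),
      (∀ u ∈ coordDomain n (∏ i, q i),
        ∃ p : tadRep n (∏ i, q i), ζ u = Quotient.mk _ p ∧
          p.1.X = Matrix.diagonal u.1 ∧ p.1.Z = laxMatrix (∏ i, q i) u ∧
          ∀ p' : tadRep n (∏ i, q i),
            p'.1.X = Matrix.diagonal u.1 → p'.1.Z = laxMatrix (∏ i, q i) u →
              ∃ c : ℂ, c ≠ 0 ∧ p'.1.V = c • p.1.V ∧ p'.1.W = c⁻¹ • p.1.W) ∧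
      ∀ u ∈ coordDomain n (∏ i, q i),
        IsLogCanonicalChartAt cycBivector (xi n q hq.1 ∘ ζ) u := by
  classical
  have ht0 : (∏ i, q i) ≠ 0 := Finset.prod_ne_zero_iff.mpr fun i _ => hq.1 i
  have ht := hq.2.1
  have ht1 : (∏ i, q i) ≠ 1 := by simpa using ht 1 one_pos
  have hP := xi_isPoissonMap (n := n) hq.1 ht
  refine ⟨xi_bijective q hq.1,
    fun f => ⟨regular_comp_xi hq.1, regular_of_comp_xi hq.1⟩,
    fun f g hf hg c => hP c f g (holomorphicAt_of_isRegularFunction hf _)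
      (holomorphicAt_of_isRegularFunction hg _), hP, ?_⟩
  obtain ⟨u₀, hu₀⟩ := coordDomain_nonempty n ht0 ht
  -- Off the open coordinate domain the value is a fixed class and plays no role, all claims being
  -- local at points of the domain.
  let ζ : (Fin n → ℂ) × (Fin n → ℂ) → TadSpace n (∏ i, q i) := fun u =>
    if hu : u ∈ coordDomain n (∏ i, q i) then
      Quotient.mk _ ⟨chartData (∏ i, q i) u, chartData_mem ht0 ht1 hu⟩
    else Quotient.mk _ ⟨chartData (∏ i, q i) u₀, chartData_mem ht0 ht1 hu₀⟩
  have hζ : ∀ u (hu : u ∈ coordDomain n (∏ i, q i)),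
      ζ u = Quotient.mk _ ⟨chartData (∏ i, q i) u, chartData_mem ht0 ht1 hu⟩ := fun u hu =>
    dif_pos hu
  refine ⟨ζ, fun u hu => ⟨⟨_, chartData_mem ht0 ht1 hu⟩, hζ u hu, rfl, chartData_Z _ _,
    fun p' hX hZ => ?_⟩, fun u hu => isLogCanonicalChartAt_comp_xi hq.1 ht
      (isLogCanonicalChartAt_tad ht0 ht ht1 hζ hu)⟩
  exact exists_scaling hn ht1 hu (chartData_mem ht0 ht1 hu) p'.2 rfl (chartData_Z _ _) rfl hX hZ
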